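/- Let $K$ be an oriented virtual knot that is almost classical, i.e. it is represented by a virtual knot diagram that is Alexander numberable: the short arcs of the diagram (the arcs between consecutive classical crossings) can be numbered by integers so that at every classical crossing the incoming and the outgoing arc on the left have the same number, the incoming and the outgoing arc on the right have the same number, and the left number is one more than the right number. Let $\Delta_K(t)\in\mathbb{Z}[t^{\pm1}]$ be the Alexander polynomial of $K$, i.e. the generator (unique up to units $\pm t^k$) of the smallest principal ideal containing the first elementary ideal $\mathcal{E}_1$ of $K$; here $\mathcal{E}_1$ is generated by the $(n-1)\times(n-1)$ minors of the Jacobian matrix, obtained by Fox calculus and $x_\ell\mapsto t$, of the Wirtinger presentation $$G_K=\langle x_1,\dots,x_n \mid x_{i+1}=x_k^{-\varepsilon_i}x_ix_k^{\varepsilon_i},\ i=1,\dots,n\rangle$$ of the knot group read off a diagram with $n$ classical crossings ($\mathcal E_1$ is the unit ideal if $n\le 1$); in the $i$-th relation, $x_i$, $x_{i+1}$ and $x_k$ are the incoming under-arc, the outgoing under-arc and the over-arc of the $i$-th crossing, $\varepsilon_i$ is its sign, and indices are taken modulo $n$. For a prime $p$ let $\operatorname{span}_p\Delta_K$ be the difference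 of the largest and the smallest exponent of $\Delta_K \bmod p\in\mathbb{F}_p[t^{\pm1}]$. Suppose that $\Delta_K \bmod p$ is nontrivial for every prime $p$, in the sense that $\operatorname{span}_p\Delta_K>0$. Then $K$ admits only finitely many periods: there are only finitely many integers $q>1$ such that $K$ is represented by a virtual knot diagram in the plane which misses the origin and is invariant under the rotation by $2\pi/q$ about the origin. -/

import Mathlib

open scoped LaurentPolynomial ContDiff

/-! ### Gauss codes -/

/-- A letter of a Gauss code: `Oc` (if `isOver`) or `Uc`, where `c` is the label of a classical
crossing, together with the sign of that crossing. -/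
structure GaussLetter where
  label : ℕ
  isOver : Bool
  sign : ℤˣ
deriving DecidableEq

/-- A word is a Gauss code (of a diagram with one component) if every label that occurs in it
occurs exactly once as `O` and exactly once as `U`, both times with the same sign. -/
def IsGaussWord (w : List GaussLetter) : Prop :=
  (w.map fun l => (l.label, l.isOver)).Nodup ∧
    ∀ l ∈ w, (⟨l.label, !l.isOver, l.sign⟩ : GaussLetter) ∈ w

/-- Gauss codes of oriented virtual knot diagrams.  The empty word is the code of a diagram
without classical crossings. -/
def GaussCode : Type := {w : List GaussLetter // IsGaussWord w}

/-- The two letters `a`, `b` in this order if `d = 1`, and in the opposite order if `d = -1`. -/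
def orderedPair (d : ℤˣ) (a b : GaussLetter) : List GaussLetter :=
  if d = 1 then [a, b] else [b, a]

/-- The moves on Gauss codes: change of basepoint, relabelling of the crossings, and the
oriented Reidemeister moves.

In the third Reidemeister move the top strand passes over the two others at the crossings `x`
(with the middle strand) and `y` (with the bottom strand), and the middle strand passes over the
bottom strand at `z`.  The orders `a`, `b`, `c` in which the three strands meet their two
crossings are all reversed; the three strands bound an embedded triangle in the plane exactly
when `b * εx = c * εy` and `a * εx = c * εz`.  The two constructors correspond to the two cyclic
orders in which the knot can run through the three strands. -/
inductive GaussMove : List GaussLetter → List GaussLetter → Prop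
  | rotate (u v : List GaussLetter) : GaussMove (u ++ v) (v ++ u)
  | relabel (f : ℕ → ℕ) (hf : Function.Injective f) (w : List GaussLetter) :
      GaussMove w (w.map fun l => ⟨f l.label, l.isOver, l.sign⟩)
  | reidemeister1 (w : List GaussLetter) (x : ℕ) (o : Bool) (ε : ℤˣ) :
      GaussMove w ([⟨x, o, ε⟩, ⟨x, !o, ε⟩] ++ w)
  | reidemeister2 (u v : List GaussLetter) (x y : ℕ) (ε d : ℤˣ) :
      GaussMove (u ++ v)
        ([⟨x, true, ε⟩, ⟨y, true, -ε⟩] ++ u ++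
          orderedPair d ⟨x, false, ε⟩ ⟨y, false, -ε⟩ ++ v)
  | reidemeister3 (u v w : List GaussLetter) (x y z : ℕ) (εx εy εz a b c : ℤˣ)
      (h₁ : b * εx = c * εy) (h₂ : a * εx = c * εz) :
      GaussMove
        (orderedPair a ⟨x, true, εx⟩ ⟨y, true, εy⟩ ++ u ++
          orderedPair b ⟨x, false, εx⟩ ⟨z, true, εz⟩ ++ v ++
          orderedPair c ⟨y, false, εy⟩ ⟨z, false, εz⟩ ++ w)
        (orderedPair (-a) ⟨x, true, εx⟩ ⟨y, true, εy⟩ ++ u ++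
          orderedPair (-b) ⟨x, false, εx⟩ ⟨z, true, εz⟩ ++ v ++
          orderedPair (-c) ⟨y, false, εy⟩ ⟨z, false, εz⟩ ++ w)
  | reidemeister3' (u v w : List GaussLetter) (x y z : ℕ) (εx εy εz a b c : ℤˣ)
      (h₁ : b * εx = c * εy) (h₂ : a * εx = c * εz) :
      GaussMove
        (orderedPair a ⟨x, true, εx⟩ ⟨y, true, εy⟩ ++ u ++
          orderedPair c ⟨y, false, εy⟩ ⟨z, false, εz⟩ ++ v ++
          orderedPair b ⟨x, false, εx⟩ ⟨z, true, εz⟩ ++ w)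
        (orderedPair (-a) ⟨x, true, εx⟩ ⟨y, true, εy⟩ ++ u ++
          orderedPair (-c) ⟨y, false, εy⟩ ⟨z, false, εz⟩ ++ v ++
          orderedPair (-b) ⟨x, false, εx⟩ ⟨z, true, εz⟩ ++ w)

/-- An oriented virtual knot: an equivalence class of Gauss codes (equivalently, of Gauss
diagrams) under the equivalence relation generated by the moves. -/
def VirtualKnot : Type := Quot fun w w' : GaussCode => GaussMove w.1 w'.1

/-- The virtual knot represented by a Gauss code. -/
def GaussCode.toVirtualKnot (w : GaussCode) : VirtualKnot := Quot.mk _ w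

/-! ### Alexander numberings and almost classical knots -/

/-- A Gauss code is Alexander numberable if the short arcs of the diagram carry an integer
numbering `lam` such that, at every crossing, the two arcs (incoming and outgoing) on the left
have the same number, the two arcs on the right have the same number, and the left number is one
more than the right number.

The short arc that arrives at the `k`-th letter has number `lam k`, the one that leaves it has
number `lam (k + 1)`.  At a positive crossing the incoming over-arc and the outgoing under-arc
are on the left, at a negative crossing they are on the right. -/
def GaussCode.AlexanderNumberable (w : GaussCode) : Prop :=
  ∃ lam : ℕ → ℤ, lam w.1.length = lam 0 ∧
    ∀ i j : Fin w.1.length, (w.1.get i).label = (w.1.get j).label →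
      (w.1.get i).isOver = true → (w.1.get j).isOver = false →
        lam i = lam (j + 1) ∧ lam (i + 1) = lam j ∧
          lam i = lam (i + 1) + ((w.1.get i).sign : ℤ)

/-- A virtual knot is almost classical if some diagram of it is Alexander numberable. -/
def VirtualKnot.AlmostClassical (K : VirtualKnot) : Prop :=
  ∃ w : GaussCode, w.toVirtualKnot = K ∧ w.AlexanderNumberable

/-! ### The Alexander polynomial -/

/-- The under-crossing letters of a Gauss code in the order in which they are met.  The `i`-th
one is the undercrossing of the crossing `c_i`; it ends the long arc `x_i` and starts the long
arc `x_{i+1}`, with indices taken modulo the number of crossings. -/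
def GaussCode.unders (w : GaussCode) : List GaussLetter :=
  w.1.filter fun l => !l.isOver

/-- The index of the long arc that passes over the crossing with under-crossing letter `l`. -/
def GaussCode.overArc (w : GaussCode) (l : GaussLetter) : ℕ :=
  (w.1.takeWhile fun m => decide (m ≠ ⟨l.label, true, l.sign⟩)).countP (fun m => !m.isOver)
    % w.unders.length

/-- The Jacobian matrix: the Fox derivatives of the Wirtinger relators
`x_k^{-ε_i} x_i x_k^{ε_i} x_{i+1}^{-1}`, with all generators sent to `t`. -/
noncomputable def GaussCode.jacobian (w : GaussCode) :
    Matrix (Fin w.unders.length) (Fin w.unders.length) ℤ[T;T⁻¹] := fun i j =>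
  (if j = i then LaurentPolynomial.T (-((w.unders.get i).sign : ℤ)) else 0)
    + (if (j : ℕ) = ((i : ℕ) + 1) % w.unders.length then -1 else 0)
    + (if (j : ℕ) = w.overArc (w.unders.get i) then
        1 - LaurentPolynomial.T (-((w.unders.get i).sign : ℤ)) else 0)

/-- The first elementary ideal, generated by the `(n - 1) × (n - 1)` minors of the Jacobian
matrix, where `n` is the number of crossings.  It is the unit ideal if `n ≤ 1`. -/
noncomputable def GaussCode.firstElementaryIdeal (w : GaussCode) : Ideal ℤ[T;T⁻¹] :=
  Ideal.span {d | ∃ r c : Fin (w.unders.length - 1) → Fin w.unders.length,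
    d = (w.jacobian.submatrix r c).det}

/-- `Δ` is an Alexander polynomial of the virtual knot `K` (they differ by units `± t ^ k`): it
generates the smallest principal ideal that contains the first elementary ideal. -/
def VirtualKnot.IsAlexanderPolynomial (K : VirtualKnot) (Δ : ℤ[T;T⁻¹]) : Prop :=
  ∃ w : GaussCode, w.toVirtualKnot = K ∧
    w.firstElementaryIdeal ≤ Ideal.span {Δ} ∧
      ∀ g : ℤ[T;T⁻¹], w.firstElementaryIdeal ≤ Ideal.span {g} → Ideal.span {Δ} ≤ Ideal.span {g}

/-- The span of a nonzero Laurent polynomial, the difference of its largest and its smallest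
exponent (and `0` for the zero polynomial). -/
def laurentSpan {R : Type*} [Semiring R] (f : R[T;T⁻¹]) : ℕ :=
  if h : f.coeff.support.Nonempty then
    (f.coeff.support.max' h - f.coeff.support.min' h).toNat
  else 0

/-! ### Virtual knot diagrams in the plane, and periods -/

/-- An oriented virtual knot diagram in the plane `ℂ`: a smooth immersion of the circle `ℝ / ℤ`,
given as a `1`-periodic curve, whose only singularities are finitely many transverse double
points, some of which are classical crossings.  `classical s t` says that the curve has a
classical crossing with over-crossing parameter `s` and under-crossing parameter `t`; the other
double points are the virtual crossings. -/
structure PlanarDiagram where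
  curve : ℝ → ℂ
  smooth : ContDiff ℝ ∞ curve
  periodic : Function.Periodic curve 1
  immersed : ∀ s, deriv curve s ≠ 0
  double : ∀ r s t : ℝ, r ∈ Set.Ico (0 : ℝ) 1 → s ∈ Set.Ico (0 : ℝ) 1 → t ∈ Set.Ico (0 : ℝ) 1 →
    curve r = curve s → curve s = curve t → r = s ∨ s = t ∨ r = t
  transverse : ∀ s t : ℝ, s ∈ Set.Ico (0 : ℝ) 1 → t ∈ Set.Ico (0 : ℝ) 1 → s ≠ t →
    curve s = curve t → (starRingEnd ℂ (deriv curve s) * deriv curve t).im ≠ 0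
  finite_double : {s : ℝ | s ∈ Set.Ico (0 : ℝ) 1 ∧
    ∃ t ∈ Set.Ico (0 : ℝ) 1, s ≠ t ∧ curve s = curve t}.Finite
  classical : ℝ → ℝ → Prop
  classical_add_int : ∀ (s t : ℝ) (m n : ℤ), classical (s + m) (t + n) ↔ classical s t
  classical_double : ∀ s t : ℝ, classical s t → curve s = curve t ∧ ∀ m : ℤ, s ≠ t + m
  classical_asymm : ∀ s t : ℝ, classical s t → ¬ classical t s

/-- The sign of the crossing with over-crossing parameter `s` and under-crossing parameter `t`:
positive if the tangent vectors of the over-strand and the under-strand form, in this order, a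
positively oriented basis of the plane. -/
noncomputable def PlanarDiagram.crossingSign (P : PlanarDiagram) (s t : ℝ) : ℤˣ :=
  if 0 < (starRingEnd ℂ (deriv P.curve s) * deriv P.curve t).im then 1 else -1

/-- `w` is the Gauss code that is read off the planar diagram `P` when it is traversed once from
parameter `0` to parameter `1`; the `i`-th letter is met at parameter `θ i`. -/
def PlanarDiagram.HasGaussCode (P : PlanarDiagram) (w : GaussCode) : Prop :=
  ∃ θ : Fin w.1.length → ℝ, StrictMono θ ∧ (∀ i, θ i ∈ Set.Ico (0 : ℝ) 1) ∧
    (∀ s ∈ Set.Ico (0 : ℝ) 1, ∀ t ∈ Set.Ico (0 : ℝ) 1, P.classical s t →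
      ∃ i j, θ i = s ∧ θ j = t) ∧
    ∀ i j, (w.1.get i).label = (w.1.get j).label →
      (w.1.get i).isOver = true → (w.1.get j).isOver = false →
        P.classical (θ i) (θ j) ∧ (w.1.get i).sign = P.crossingSign (θ i) (θ j)

/-- The planar diagram `P` represents the virtual knot `K`. -/
def PlanarDiagram.Represents (P : PlanarDiagram) (K : VirtualKnot) : Prop :=
  ∃ w : GaussCode, P.HasGaussCode w ∧ w.toVirtualKnot = K

/-- The planar diagram `P` is invariant under the rotation by the angle `α` about the origin: the
rotated curve is a reparametrization of the curve, by a map of the circle with lift `φ`, and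
classical crossings are taken to classical crossings with the same over-strand.  (A rotation that
leaves the diagram of a knot invariant and reverses its orientation would fix a point of it.) -/
def PlanarDiagram.InvariantUnderRotation (P : PlanarDiagram) (α : ℝ) : Prop :=
  ∃ φ : ℝ ≃o ℝ, (∀ s, φ (s + 1) = φ s + 1) ∧
    (∀ s, P.curve (φ s) = Complex.exp (α * Complex.I) * P.curve s) ∧
    ∀ s t, P.classical (φ s) (φ t) ↔ P.classical s t

/-- The virtual knot `K` has period `q > 1`: it admits a virtual knot diagram in the plane which
misses the origin and is invariant under the rotation by `2 π / q` about the origin. -/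
def VirtualKnot.HasPeriod (K : VirtualKnot) (q : ℕ) : Prop :=
  1 < q ∧ ∃ P : PlanarDiagram, P.Represents K ∧ (∀ s, P.curve s ≠ 0) ∧
    P.InvariantUnderRotation (2 * Real.pi / q)

open scoped Polynomial Matrix

/-! ### Kernels and adjugates -/

section Adjugate

variable {ι S : Type*} [Fintype ι] [DecidableEq ι]

/-! Everything reduces to bounding the prime powers `q = p ^ r` that are periods
(`exists_primePow_period_le`): a divisor greater than 1 of a period is a period, so once all prime
power periods are at most `N`, every period divides `N!`.

Fix a Gauss code `w₀` of the knot with `n` crossings and put R = F_p[t, t⁻¹]. A coloring by an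
R-module assigns to each arc a module element subject to the Fox-Wirtinger relations. Colorings are
natural in the module and invariant under the moves, and they are represented by the cokernel of the
Jacobian. Since Δ mod p is nonzero, some minor d of the Jacobian of `w₀` is nonzero mod p, so over
the fraction field of R only the constant colorings exist. Since Δ mod p is not a unit, it lies in a
maximal ideal; Δ divides all minors, so over that residue field there are nonconstant colorings. For
large q a diagram of period q rules out this jump in rank.

The Gauss code of such a diagram is invariant under a shift by `L` letters, where `q * L` is its
length (`PlanarDiagram.exists_letterAt_shift`). Colorings are then governed by an L × L matrix A
over R[X], with X acting as the shift. Constants give det A = (X - 1) E. In characteristic p, X^q -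
1 = (X - 1)^q, and over a field the colorings are all constant exactly when E(1) ≠ 0
(`rank_cyclicSolutions_le_one`, `eval_one_ne_zero_of_rank_cyclicSolutions_le_one`). So E(1) ≠ 0 in
R, and it remains to see that E(1) is a unit, because then it survives in the residue field.

The shift minus the identity is nilpotent on the coloring module. The module has `n` generators that
agree up to d-torsion, so this operator factors through a quotient of (R/d)^n, whose dimension over
F_p is at most n deg d. Its order of nilpotency is therefore bounded in terms of `w₀` alone
(`pow_eq_zero_of_smul_sub_eq_zero`, `shift_sub_one_pow_eq_zero`). As soon as q exceeds that bound,
(X - 1)^(q-1) kills the module presented by A and X^q - 1, and comparing determinants makes E(1)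
invertible (`isUnit_eval_one_of_shift_sub_one_pow_eq_zero`). -/

theorem det_smul_eq_zero_of_sum_smul_eq_zero [CommRing S] {M : Type*} [AddCommGroup M]
    [Module S M] (Q : Matrix ι ι S) (y : ι → M) (h : ∀ i, ∑ j, Q i j • y j = 0) (k : ι) :
    Q.det • y k = 0 := by
  have h1 : ∑ i, Q.adjugate k i • ∑ j, Q i j • y j = 0 := by simp [h]
  simp_rw [Finset.smul_sum, smul_smul] at h1
  rw [Finset.sum_comm] at h1
  simp_rw [← Finset.sum_smul, ← Matrix.mul_apply, Matrix.adjugate_mul] at h1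
  simpa [Matrix.smul_apply, Matrix.one_apply, ite_smul] using h1

/-- The entry (k, i) of the adjugate is the determinant of A with row i replaced by the k-th unit
row. If it is nonzero, this modified matrix is injective, and it kills every kernel vector of A
whose k-th entry is zero. -/
theorem exists_forall_mulVec_eq_zero_of_adjugate_ne_zero [Field S] {A : Matrix ι ι S}
    (hA : A.adjugate ≠ 0) : ∃ k, ∀ x : ι → S, A *ᵥ x = 0 → x k = 0 → x = 0 := by
  obtain ⟨k, i, hki⟩ : ∃ k i, A.adjugate k i ≠ 0 := by
    by_contra! h
    exact hA (by ext k i; exact h k i)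
  refine ⟨k, fun x hx hk => ?_⟩
  by_contra hx0
  rw [Matrix.adjugate_apply] at hki
  refine hki (Matrix.exists_mulVec_eq_zero_iff.mp ⟨x, hx0, ?_⟩)
  ext j
  rw [Matrix.updateRow_mulVec, hx]
  by_cases hj : j = i
  · subst hj; simp [hk]
  · simp [hj]

/-- Suppose A is singular, let u span a left relation with u i ≠ 0, and let k be an index with v k ≠
0. If the adjugate entry (k, i) vanished, some y ≠ 0 with y k = 0 would be killed by all rows except
possibly row i. The relation u makes row i kill y as well, so y is a multiple of v, which
contradicts y k = 0. -/
theorem adjugate_ne_zero_of_forall_mulVec_eq_zero [Nonempty ι] [Field S] {A : Matrix ι ι S}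
    (v : ι → S) (hv : ∀ x : ι → S, A *ᵥ x = 0 → ∃ a : S, x = a • v) : A.adjugate ≠ 0 := by
  by_cases hdet : A.det = 0
  · obtain ⟨x, hx0, hx⟩ := Matrix.exists_mulVec_eq_zero_iff.mpr hdet
    obtain ⟨u, hu0, hu⟩ := Matrix.exists_vecMul_eq_zero_iff.mpr hdet
    obtain ⟨a, rfl⟩ := hv x hx
    obtain ⟨k, hk⟩ := Function.ne_iff.mp (right_ne_zero_of_smul hx0)
    obtain ⟨i, hi⟩ := Function.ne_iff.mp hu0
    intro h0
    have h1 : (A.updateRow i (Pi.single k 1)).det = 0 := by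
      rw [← Matrix.adjugate_apply, h0]; rfl
    obtain ⟨y, hy0, hy⟩ := Matrix.exists_mulVec_eq_zero_iff.mpr h1
    rw [Matrix.updateRow_mulVec] at hy
    have hyk : y k = 0 := by simpa using congrFun hy i
    have hrow : ∀ j, j ≠ i → (A *ᵥ y) j = 0 := fun j hj => by
      simpa [Function.update_of_ne hj] using congrFun hy j
    have hrow' : (A *ᵥ y) i = 0 := by
      have h2 : u ⬝ᵥ (A *ᵥ y) = 0 := by rw [Matrix.dotProduct_mulVec, hu, zero_dotProduct]
      rw [dotProduct, Finset.sum_eq_single i (fun j _ hj => by rw [hrow j hj, mul_zero])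
        (fun h => (h (Finset.mem_univ _)).elim)] at h2
      exact (mul_eq_zero.mp h2).resolve_left hi
    obtain ⟨b, rfl⟩ := hv y (by ext j; by_cases hj : j = i; exacts [hj ▸ hrow', hrow j hj])
    have hb : b = 0 := (mul_eq_zero.mp hyk).resolve_right hk
    exact hy0 (by simp [hb])
  · intro h0
    have h1 := A.mul_adjugate
    rw [h0, mul_zero] at h1
    obtain ⟨i⟩ := ‹Nonempty ι›
    have h2 := congrFun (congrFun h1 i) i
    simp only [Matrix.zero_apply, Matrix.smul_apply, Matrix.one_apply_eq, smul_eq_mul,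
      mul_one] at h2
    exact hdet h2.symm

end Adjugate

/-! ### Periodic systems of recurrences -/

/-- The sequences of period `q * L` that solve the recurrences
`x (j + 1) = c j * x j + (1 - c j) * x (par j)`, where `j < L`, and all their translates by
multiples of `L`. -/
def cyclicSolutions {R : Type*} [CommRing R] (B : Type*) [AddCommGroup B] [Module R B] (L q : ℕ)
    (c : ℕ → R) (par : ℕ → ℕ) : Submodule R (ℕ → B) where
  carrier := {x | (∀ m, x (m + q * L) = x m) ∧
    ∀ j < L, ∀ s, x (j + 1 + s * L) = c j • x (j + s * L) + (1 - c j) • x (par j + s * L)}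
  add_mem' := by
    rintro x y ⟨hx, hx'⟩ ⟨hy, hy'⟩
    refine ⟨fun m => by simp [hx, hy], fun j hj s => ?_⟩
    simp only [Pi.add_apply, hx' j hj, hy' j hj, smul_add]
    abel
  zero_mem' := by simp
  smul_mem' := by
    rintro r x ⟨hx, hx'⟩
    refine ⟨fun m => by simp [hx], fun j hj s => ?_⟩
    simp only [Pi.smul_apply, hx' j hj, smul_add, smul_comm r]

/-! ### The matrix of a periodic system of recurrences. -/

section Recurrence

variable {R : Type*} [CommRing R] {B : Type*} [AddCommGroup B] [Module R B] (L : ℕ)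

/-- The element of the free `R[X]`-module of rank `L` that represents the `m`-th entry of a
sequence: translation by `L` is multiplication by `X`. -/
noncomputable def entryVector (R : Type*) [CommRing R] (L m : ℕ) : Fin L → R[X] :=
  fun i => if m % L = i then Polynomial.X ^ (m / L) else 0

theorem entryVector_add (m s : ℕ) (hL : 0 < L) :
    entryVector R L (m + s * L) = (Polynomial.X ^ s : R[X]) • entryVector R L m := by
  ext1 i
  simp only [entryVector, Nat.add_mul_mod_self_right, Nat.add_mul_div_right _ _ hL, Pi.smul_apply,
    smul_eq_mul, mul_ite, mul_zero, pow_add]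
  rw [mul_comm]

theorem entryVector_fin (i : Fin L) : entryVector R L i = Pi.single i 1 := by
  ext1 j
  simp only [entryVector, Nat.mod_eq_of_lt i.2, Nat.div_eq_of_lt i.2, pow_zero, Pi.single_apply,
    Fin.ext_iff, eq_comm]

theorem sum_entryVector_smul {M : Type*} [AddCommGroup M] [Module R[X] M] (hL : 0 < L) (m : ℕ)
    (y : Fin L → M) : ∑ i, entryVector R L m i • y i
      = (Polynomial.X ^ (m / L) : R[X]) • y ⟨m % L, Nat.mod_lt _ hL⟩ := by
  rw [Finset.sum_eq_single ⟨m % L, Nat.mod_lt _ hL⟩]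
  · simp [entryVector]
  · intro i _ hi
    rw [entryVector, if_neg (fun h => hi (Fin.ext h.symm)), zero_smul]
  · simp

/-- The matrix of the system of recurrences. -/
noncomputable def recurrenceMatrix (c : ℕ → R) (par : ℕ → ℕ) : Matrix (Fin L) (Fin L) R[X] :=
  fun j => entryVector R L (j + 1) - Polynomial.C (c j) • entryVector R L j
    - Polynomial.C (1 - c j) • entryVector R L (par j)

theorem sum_recurrenceMatrix_smul {M : Type*} [AddCommGroup M] [Module R[X] M] (c : ℕ → R)
    (par : ℕ → ℕ) (y : Fin L → M) (j : Fin L) :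
    ∑ i, recurrenceMatrix L c par j i • y i = ∑ i, entryVector R L (j + 1) i • y i
      - Polynomial.C (c j) • ∑ i, entryVector R L j i • y i
      - Polynomial.C (1 - c j) • ∑ i, entryVector R L (par j) i • y i := by
  simp only [recurrenceMatrix, Pi.sub_apply, Pi.smul_apply, sub_smul, Finset.sum_sub_distrib,
    Finset.smul_sum, smul_smul, smul_eq_mul]

theorem recurrenceMatrix_map {R' : Type*} [CommRing R'] (f : R →+* R') (c : ℕ → R) (par : ℕ → ℕ) :
    (recurrenceMatrix L c par).map (Polynomial.mapRingHom f)
      = recurrenceMatrix L (fun j => f (c j)) par := by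
  ext1 j i
  simp only [recurrenceMatrix, entryVector, Matrix.map_apply, Pi.sub_apply, Pi.smul_apply, map_sub,
    smul_eq_mul, map_mul, apply_ite (Polynomial.mapRingHom f), map_pow, map_zero]
  simp

/-- The sequence of solutions with all entries equal. -/
theorem const_mem_cyclicSolutions (q : ℕ) (c : ℕ → R) (par : ℕ → ℕ) (b : B) :
    (fun _ => b) ∈ cyclicSolutions B L q c par :=
  ⟨fun _ => rfl, fun j _ _ => by rw [← add_smul]; simp⟩

theorem eval_one_recurrenceMatrix_mulVec_one (hL : 0 < L) (c : ℕ → R) (par : ℕ → ℕ) :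
    (recurrenceMatrix L c par).map (Polynomial.evalRingHom 1) *ᵥ (fun _ => 1) = 0 := by
  have key : ∀ m, ∑ i, Polynomial.eval 1 (entryVector R L m i) = 1 := fun m => by
    rw [Finset.sum_eq_single ⟨m % L, Nat.mod_lt _ hL⟩]
    · simp [entryVector]
    · intro i _ hi
      rw [entryVector, if_neg (fun h => hi (Fin.ext h.symm)), Polynomial.eval_zero]
    · simp
  ext j
  simp only [Matrix.mulVec, dotProduct, Matrix.map_apply, recurrenceMatrix, Pi.sub_apply,
    Pi.smul_apply, smul_eq_mul, Polynomial.coe_evalRingHom, mul_one, Polynomial.eval_sub,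
    Polynomial.eval_mul, Polynomial.eval_C]
  simp only [Finset.sum_sub_distrib, ← Finset.mul_sum, key]
  simp

/-- At X = 1 each row sums to 1 - c - (1 - c) = 0, which reflects the constant solutions. This
yields the factorization det = (X - 1) E; the value E(1) is what the argument tracks. -/
theorem eval_one_det_recurrenceMatrix [IsDomain R] (hL : 0 < L) (c : ℕ → R) (par : ℕ → ℕ) :
    (recurrenceMatrix L c par).det.eval 1 = 0 := by
  rw [← Polynomial.coe_evalRingHom, RingHom.map_det]
  refine Matrix.exists_mulVec_eq_zero_iff.mp ⟨fun _ => 1, ?_, ?_⟩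
  · exact fun h => one_ne_zero (congrFun h ⟨0, hL⟩)
  · exact eval_one_recurrenceMatrix_mulVec_one L hL c par

end Recurrence

/-! ### Solutions over a field: the role of E(1). -/

section Field

variable {κ : Type*} [Field κ] (L : ℕ) {q : ℕ} (c : ℕ → κ) (par : ℕ → ℕ)

/-- If the adjugate vanished at 1, then (X - 1)^L would divide its determinant. That determinant is
(det A)^(L-1) = (X - 1)^(L-1) E^(L-1), so E would vanish at 1. -/
theorem adjugate_eval_one_ne_zero {A : Matrix (Fin L) (Fin L) κ[X]} (hL : 0 < L) {E : κ[X]}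
    (hE : A.det = (Polynomial.X - Polynomial.C 1) * E) (hE1 : E.eval 1 ≠ 0) :
    (A.map (Polynomial.evalRingHom 1)).adjugate ≠ 0 := by
  intro h0
  have hdvd : ∀ i j, Polynomial.X - Polynomial.C 1 ∣ A.adjugate i j := fun i j => by
    rw [Polynomial.dvd_iff_isRoot]
    have := congrFun (congrFun h0 i) j
    rwa [← RingHom.mapMatrix_apply, ← RingHom.map_adjugate] at this
  choose G hG using hdvd
  have hA : A.adjugate = (Polynomial.X - Polynomial.C (1 : κ)) • Matrix.of G := by
    ext1 i j
    simp [hG i j]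
  have hdet := A.det_adjugate
  rw [hA, Matrix.det_smul, Fintype.card_fin, hE] at hdet
  obtain ⟨n, rfl⟩ : ∃ n, L = n + 1 := ⟨L - 1, by omega⟩
  rw [Nat.add_sub_cancel, mul_pow, pow_succ, mul_assoc] at hdet
  have h1 := mul_left_cancel₀ (pow_ne_zero n (Polynomial.X_sub_C_ne_zero (1 : κ))) hdet
  have h2 := congrArg (Polynomial.eval 1) h1
  simp only [Polynomial.eval_mul, Polynomial.eval_sub, Polynomial.eval_X, Polynomial.eval_C,
    sub_self, zero_mul, Polynomial.eval_pow] at h2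
  exact pow_ne_zero n hE1 h2.symm

/-- The module structure on sequences for which `X` acts as the shift. -/
noncomputable abbrev shiftModule : Module κ[X] (ℕ → κ) :=
  Module.compHom (ℕ → κ) (Polynomial.aeval (LinearMap.funLeft κ κ (· + 1))).toRingHom

theorem X_pow_shift_smul (n : ℕ) (y : ℕ → κ) (s : ℕ) :
    letI := shiftModule (κ := κ)
    ((Polynomial.X ^ n : κ[X]) • y) s = y (s + n) := by
  change (Polynomial.aeval (LinearMap.funLeft κ κ (· + 1)) (Polynomial.X ^ n : κ[X]) y) s = _
  rw [map_pow, Polynomial.aeval_X]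
  induction n generalizing s with
  | zero => rfl
  | succ n ih =>
    rw [pow_succ', Module.End.mul_apply, LinearMap.funLeft_apply, ih]
    congr 1; omega

theorem C_shift_smul (a : κ) (y : ℕ → κ) :
    letI := shiftModule (κ := κ)
    (Polynomial.C a : κ[X]) • y = a • y := by
  change (Polynomial.aeval (LinearMap.funLeft κ κ (· + 1)) (Polynomial.C a : κ[X]) y) = _
  rw [Polynomial.aeval_C]
  rfl

/-- Let X act by shifting s in the sequences s ↦ x (i + s L). By Cramer's rule these are killed by
det A = (X - 1) E, and by periodicity they are killed by X^q - 1 = (X - 1)^q. Since E is prime to X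
- 1, they are killed by X - 1 itself. Thus x has period L and is a kernel vector of A at X = 1, a
matrix with nonzero adjugate. -/
theorem rank_cyclicSolutions_le_one {p r : ℕ} [CharP κ p] [Fact p.Prime] (hL : 0 < L)
    {E : κ[X]} (hE : (recurrenceMatrix L c par).det = (Polynomial.X - Polynomial.C 1) * E)
    (hE1 : E.eval 1 ≠ 0) : Module.rank κ (cyclicSolutions κ L (p ^ r) c par) ≤ 1 := by
  let := shiftModule (κ := κ)
  have hsum : ∀ x ∈ cyclicSolutions κ L (p ^ r) c par, ∀ m,
      ∑ i, entryVector κ L m i • (fun s => x (i + s * L)) = fun s => x (m + s * L) := by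
    intro x hx m
    rw [sum_entryVector_smul L hL]
    ext s
    rw [X_pow_shift_smul]
    congr 1
    have := Nat.mod_add_div m L
    simp only
    nlinarith
  have hzero : ∀ x ∈ cyclicSolutions κ L (p ^ r) c par, ∀ i : Fin L, ∀ s,
      x (i + s * L) = x i := by
    intro x hx
    have h1 : ∀ i : Fin L, (recurrenceMatrix L c par).det • (fun s => x (i + s * L)) = 0 := by
      refine det_smul_eq_zero_of_sum_smul_eq_zero _ _ fun j => ?_
      rw [sum_recurrenceMatrix_smul, hsum x hx, hsum x hx, hsum x hx, C_shift_smul, C_shift_smul]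
      ext s
      simp [hx.2 j j.2 s]
    have hcop : IsCoprime E ((Polynomial.X - Polynomial.C (1 : κ)) ^ p ^ r) := by
      refine IsCoprime.pow_right ?_
      rw [isCoprime_comm, (Polynomial.irreducible_X_sub_C (1 : κ)).coprime_iff_not_dvd,
        Polynomial.dvd_iff_isRoot]
      exact hE1
    obtain ⟨a, b, hab⟩ := hcop
    have h2 : ∀ i : Fin L,
        (Polynomial.X - Polynomial.C (1 : κ)) • (fun s => x (i + s * L)) = 0 := fun i => by
      -- The Bézout identity multiplied by X - 1, with (X - 1)^q rewritten as X^q - 1 in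
      -- characteristic p.
      have h3 : (Polynomial.X - Polynomial.C (1 : κ))
          = a * (recurrenceMatrix L c par).det
            + (Polynomial.X - Polynomial.C (1 : κ)) * b * (Polynomial.X ^ p ^ r - 1) := by
        rw [sub_pow_char_pow, ← Polynomial.C_pow, one_pow, Polynomial.C_1] at hab
        rw [hE]
        simp only [Polynomial.C_1]
        linear_combination -(Polynomial.X - 1) * hab
      rw [h3, add_smul, mul_smul, h1 i, mul_smul, sub_smul, one_smul]
      have h4 : (Polynomial.X ^ p ^ r : κ[X]) • (fun s => x (i + s * L))
          = fun s => x (i + s * L) := by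
        ext s
        rw [X_pow_shift_smul, add_mul, ← add_assoc, hx.1]
      rw [h4, sub_self, smul_zero, smul_zero, add_zero]
    intro i s
    induction s with
    | zero => simp
    | succ s ih =>
      have h5 := congrFun (h2 i) s
      rw [sub_smul, C_shift_smul, one_smul, ← pow_one Polynomial.X] at h5
      change ((Polynomial.X ^ 1 : κ[X]) • (fun s : ℕ => x (i + s * L))) s - x (i + s * L) = 0 at h5
      rw [X_pow_shift_smul, sub_eq_zero] at h5
      rw [h5, ih]
  obtain ⟨k, hk⟩ := exists_forall_mulVec_eq_zero_of_adjugate_ne_zero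
    (adjugate_eval_one_ne_zero L hL hE hE1)
  have hval : ∀ x ∈ cyclicSolutions κ L (p ^ r) c par, ∀ m, x m = x (m % L) := by
    intro x hx m
    conv_lhs => rw [← Nat.mod_add_div m L, mul_comm]
    exact hzero x hx ⟨m % L, Nat.mod_lt _ hL⟩ _
  -- Evaluation at the index k singled out by the nonzero adjugate entry is injective on solutions.
  let f : cyclicSolutions κ L (p ^ r) c par →ₗ[κ] κ :=
    (LinearMap.proj (k : ℕ)) ∘ₗ (cyclicSolutions κ L (p ^ r) c par).subtype
  have hf : Function.Injective f := by
    rw [← LinearMap.ker_eq_bot, LinearMap.ker_eq_bot']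
    rintro ⟨x, hx⟩ hxk
    have hxk' : x k = 0 := hxk
    have h6 : ∀ m, ∑ i, Polynomial.eval 1 (entryVector κ L m i) * x i = x m := fun m => by
      rw [Finset.sum_eq_single ⟨m % L, Nat.mod_lt _ hL⟩]
      · simp [entryVector, ← hval x hx m]
      · intro i _ hi
        rw [entryVector, if_neg (fun h => hi (Fin.ext h.symm)), Polynomial.eval_zero, zero_mul]
      · simp
    have h7 := hk (fun i => x i) (by
      ext j
      simp only [Matrix.mulVec, dotProduct, Matrix.map_apply, recurrenceMatrix, Pi.sub_apply,
        Pi.smul_apply, smul_eq_mul, Polynomial.coe_evalRingHom, Polynomial.eval_sub,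
        Polynomial.eval_mul, Polynomial.eval_C, sub_mul, mul_assoc]
      simp only [Finset.sum_sub_distrib, ← Finset.mul_sum, h6]
      have := hx.2 j j.2 0
      simp only [zero_mul, add_zero, smul_eq_mul] at this
      rw [this, Pi.zero_apply]
      ring) hxk'
    ext m
    change x m = 0
    rw [hval x hx m]
    exact congrFun h7 ⟨m % L, Nat.mod_lt _ hL⟩
  simpa using LinearMap.rank_le_of_injective f hf

/-- The nonzero constants already span a line of solutions. -/
theorem eq_of_rank_cyclicSolutions_le_one
    (hr : Module.rank κ (cyclicSolutions κ L q c par) ≤ 1) :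
    ∀ x ∈ cyclicSolutions κ L q c par, ∀ m n, x m = x n := by
  obtain ⟨v, hv, hv'⟩ := (rank_submodule_le_one_iff _).mp hr
  obtain ⟨a, ha⟩ := Submodule.mem_span_singleton.mp
    (hv' (const_mem_cyclicSolutions L q c par (1 : κ)))
  have ha0 : a ≠ 0 := fun h => by
    have := congrFun ha 0
    simp [h] at this
  have hvm : ∀ m, v m = a⁻¹ := fun m => eq_inv_of_mul_eq_one_right (congrFun ha m)
  intro x hx m n
  obtain ⟨b, rfl⟩ := Submodule.mem_span_singleton.mp (hv' hx)
  simp [hvm]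

/-- If E(1) = 0, then det A vanishes to order two at X = 1. Take a column of the adjugate of A that
is nonzero at 1, extend it to a sequence y with y (m + s L) = X^s y m, and differentiate at X = 1.
The result is a nonconstant solution, which is impossible. -/
theorem eval_one_ne_zero_of_rank_cyclicSolutions_le_one (hL : 0 < L) (hq : (q : κ) = 0)
    (hr : Module.rank κ (cyclicSolutions κ L q c par) ≤ 1) {E : κ[X]}
    (hE : (recurrenceMatrix L c par).det = (Polynomial.X - Polynomial.C 1) * E) :
    E.eval 1 ≠ 0 := by
  intro hE1
  have hconst := eq_of_rank_cyclicSolutions_le_one L c par hr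
  set A := recurrenceMatrix L c par with hA
  -- A kernel vector of A at X = 1 extends to a solution of period L. By hypothesis that solution is
  -- constant, so the kernel is the line of constants.
  have hadj : (A.map (Polynomial.evalRingHom 1)).adjugate ≠ 0 := by
    have : Nonempty (Fin L) := ⟨⟨0, hL⟩⟩
    refine adjugate_ne_zero_of_forall_mulVec_eq_zero (fun _ => 1) fun x hx => ?_
    let w : ℕ → κ := fun m => x ⟨m % L, Nat.mod_lt _ hL⟩
    have h6 : ∀ m, ∑ i, Polynomial.eval 1 (entryVector κ L m i) * x i = w m := fun m => by
      rw [Finset.sum_eq_single ⟨m % L, Nat.mod_lt _ hL⟩]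
      · simp [entryVector, w]
      · intro i _ hi
        rw [entryVector, if_neg (fun h => hi (Fin.ext h.symm)), Polynomial.eval_zero, zero_mul]
      · simp
    have hw : w ∈ cyclicSolutions κ L q c par := by
      refine ⟨fun m => by simp [w], fun j hj s => ?_⟩
      have h7 := congrFun hx ⟨j, hj⟩
      simp only [Matrix.mulVec, dotProduct, Matrix.map_apply, hA, recurrenceMatrix, Pi.sub_apply,
        Pi.smul_apply, smul_eq_mul, Polynomial.coe_evalRingHom, Polynomial.eval_sub,
        Polynomial.eval_mul, Polynomial.eval_C, sub_mul, mul_assoc] at h7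
      simp only [Finset.sum_sub_distrib, ← Finset.mul_sum, h6, Pi.zero_apply] at h7
      have hs : ∀ m, w (m + s * L) = w m := fun m => by simp [w]
      simp only [hs, smul_eq_mul]
      linear_combination h7
    refine ⟨x ⟨0, hL⟩, ?_⟩
    ext i
    have := hconst w hw i 0
    simp only [w, Nat.mod_eq_of_lt i.2, Nat.zero_mod] at this
    simpa using this
  obtain ⟨i, j, hij⟩ : ∃ i j, (A.adjugate i j).eval 1 ≠ 0 := by
    by_contra! h
    refine hadj ?_
    rw [← RingHom.mapMatrix_apply, ← RingHom.map_adjugate]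
    ext i j
    exact h i j
  obtain ⟨F, hF⟩ := Polynomial.dvd_iff_isRoot.mpr hE1
  let y : ℕ → κ[X] := fun m => ∑ i, entryVector κ L m i * A.adjugate i j
  have hy : ∀ m s, y (m + s * L) = Polynomial.X ^ s * y m := fun m s => by
    simp only [y, entryVector_add L m s hL, Pi.smul_apply, smul_eq_mul, mul_assoc, Finset.mul_sum]
  have hyA : ∀ k : Fin L, y (k + 1) - Polynomial.C (c k) * y k
      - Polynomial.C (1 - c k) * y (par k) = (A * A.adjugate) k j := fun k => by
    have := sum_recurrenceMatrix_smul L c par (fun i => A.adjugate i j) k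
    simp only [smul_eq_mul] at this
    exact this.symm
  have hyi : y i = A.adjugate i j := by
    simp [y, entryVector_fin, Pi.single_apply]
  -- The recurrences hold for y up to a multiple of (X - 1)^2, whose derivative vanishes at 1. The
  -- period survives because the derivative of X^q at 1 is q = 0 in κ.
  let x : ℕ → κ := fun m => (Polynomial.derivative (y m)).eval 1
  have hx : x ∈ cyclicSolutions κ L q c par := by
    refine ⟨fun m => ?_, fun k hk s => ?_⟩
    · simp [x, hy, Polynomial.derivative_mul, Polynomial.derivative_X_pow, hq]
    · have h8 := hyA ⟨k, hk⟩
      rw [Matrix.mul_adjugate, Matrix.smul_apply, hE, hF] at h8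
      have h9 : y (k + 1) = Polynomial.C (c k) * y k + Polynomial.C (1 - c k) * y (par k)
          + (Polynomial.X - Polynomial.C 1) * ((Polynomial.X - Polynomial.C 1) * F)
            * (1 : Matrix (Fin L) (Fin L) κ[X]) ⟨k, hk⟩ j := by
        rw [← smul_eq_mul (_ * _), ← h8]
        ring
      simp only [x, hy, h9, Polynomial.derivative_mul, Polynomial.derivative_add,
        Polynomial.eval_add, Polynomial.eval_mul, Polynomial.derivative_C, Polynomial.eval_zero,
        Polynomial.eval_C, Polynomial.derivative_sub, Polynomial.derivative_X,
        Polynomial.eval_sub, Polynomial.eval_X, smul_eq_mul, Polynomial.eval_pow]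
      ring
  -- By the product rule, shifting by L adds the value at 1 of the chosen adjugate entry, which is
  -- nonzero.
  have h10 := hconst x hx (i + 1 * L) i
  simp only [x, hy, hyi] at h10
  simp at h10
  exact hij h10

end Field

/-! ### Solutions over a domain: nilpotency of the shift makes E(1) a unit. -/

section Domain

variable {R : Type} [CommRing R] (L : ℕ) (c : ℕ → R) (par : ℕ → ℕ)

/-- The module generated by the entries of a universal solution. -/
abbrev universalSolutionModule (q : ℕ) : Type :=
  (Fin L → R[X]) ⧸ (Submodule.span R[X] (Set.range (recurrenceMatrix L c par)) ⊔
    LinearMap.range ((Polynomial.X ^ q - 1 : R[X]) • (LinearMap.id : (Fin L → R[X]) →ₗ[R[X]] _)))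

theorem universalSolution_mem (hL : 0 < L) (q : ℕ) :
    (fun m => Submodule.Quotient.mk (entryVector R L m)) ∈
      cyclicSolutions (universalSolutionModule L c par q) L q c par := by
  refine ⟨fun m => ?_, fun j hj s => ?_⟩
  · simp only
    rw [Submodule.Quotient.eq]
    refine Submodule.mem_sup_right ⟨entryVector R L m, ?_⟩
    rw [entryVector_add L m q hL, LinearMap.smul_apply, LinearMap.id_apply, sub_smul, one_smul]
  · simp only [← Submodule.Quotient.mk_smul, ← Submodule.Quotient.mk_add]
    rw [Submodule.Quotient.eq]
    refine Submodule.mem_sup_left ?_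
    have h := Submodule.smul_mem (Submodule.span R[X] (Set.range (recurrenceMatrix L c par)))
      (Polynomial.X ^ s : R[X]) (Submodule.subset_span ⟨(⟨j, hj⟩ : Fin L), rfl⟩)
    convert h using 1
    simp only [entryVector_add L _ s hL]
    ext1 i
    simp only [recurrenceMatrix, Pi.sub_apply, Pi.add_apply, Pi.smul_apply, smul_eq_mul,
      Polynomial.smul_eq_C_mul]
    ring

/-- Applied to the universal solution, the hypothesis says that (X - 1)^(q-1) times each unit vector
is a combination of rows of A plus a multiple of X^q - 1 = (X - 1)^q. Hence (X - 1)^(q-1) (1 - (X -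
1) H) = G A. Taking determinants and cancelling powers of X - 1, which is prime and does not divide
E, gives det (1 - (X - 1) H) = W E. At X = 1 this reads 1 = W(1) E(1). -/
theorem isUnit_eval_one_of_shift_sub_one_pow_eq_zero [IsDomain R] {p r : ℕ} [CharP R p] [Fact p.Prime]
    (hL : 0 < L)
    (h : ∀ (B : Type) [AddCommGroup B] [Module R B], ∀ x ∈ cyclicSolutions B L (p ^ r) c par,
      ((LinearMap.funLeft R B (· + L) - 1) ^ (p ^ r - 1) : Module.End R (ℕ → B)) x = 0)
    {E : R[X]} (hE : (recurrenceMatrix L c par).det = (Polynomial.X - Polynomial.C 1) * E)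
    (hE1 : E.eval 1 ≠ 0) : IsUnit (E.eval 1) := by
  set q := p ^ r with hq
  have hq0 : 0 < q := pow_pos (Fact.out (p := p.Prime)).pos r
  have hpow : ∀ k m,
      ((LinearMap.funLeft R (universalSolutionModule L c par q) (· + L) - 1) ^ k :
        Module.End R (ℕ → universalSolutionModule L c par q))
        (fun m => Submodule.Quotient.mk (entryVector R L m)) m
        = Submodule.Quotient.mk ((Polynomial.X - Polynomial.C (1 : R)) ^ k • entryVector R L m) := by
    intro k
    induction k with
    | zero => intro m; simp
    | succ k ih =>
      intro m
      rw [pow_succ', Module.End.mul_apply, LinearMap.sub_apply, Pi.sub_apply,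
        LinearMap.funLeft_apply, Module.End.one_apply, ih, ih, ← Submodule.Quotient.mk_sub,
        ← smul_sub, pow_succ, mul_smul]
      congr 2
      have := entryVector_add (R := R) L m 1 hL
      rw [one_mul] at this
      rw [this, sub_smul, pow_one, Polynomial.C_1, one_smul]
  have hrow : ∀ i : Fin L, ∃ G H : Fin L → R[X],
      (Polynomial.X - Polynomial.C (1 : R)) ^ (q - 1) • Pi.single i (1 : R[X])
        = ∑ j, G j • recurrenceMatrix L c par j + (Polynomial.X ^ q - 1 : R[X]) • H := by
    intro i
    have h1 := congrFun (h _ _ (universalSolution_mem L c par hL q)) i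
    rw [hpow, Pi.zero_apply, Submodule.Quotient.mk_eq_zero, entryVector_fin,
      Submodule.mem_sup] at h1
    obtain ⟨y, hy, _, ⟨H, rfl⟩, hyz⟩ := h1
    obtain ⟨G, rfl⟩ := (Submodule.mem_span_range_iff_exists_fun _).mp hy
    exact ⟨G, H, hyz.symm⟩
  choose G H hGH using hrow
  have hmat : (Polynomial.X - Polynomial.C (1 : R)) ^ (q - 1) •
      (1 - (Polynomial.X - Polynomial.C (1 : R)) • Matrix.of H)
        = Matrix.of G * recurrenceMatrix L c par := by
    ext1 i k
    have h1 := congrFun (hGH i) k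
    have h2 : (Polynomial.X ^ q - 1 : R[X]) = (Polynomial.X - Polynomial.C (1 : R)) ^ (q - 1)
        * (Polynomial.X - Polynomial.C (1 : R)) := by
      rw [← pow_succ, Nat.sub_add_cancel hq0, hq, sub_pow_char_pow, ← Polynomial.C_pow, one_pow,
        Polynomial.C_1]
    simp only [Pi.smul_apply, Pi.add_apply, Finset.sum_apply, smul_eq_mul, h2] at h1
    simp only [Matrix.smul_apply, Matrix.sub_apply, Matrix.mul_apply, Matrix.of_apply, smul_eq_mul]
    rw [← sub_eq_iff_eq_add] at h1
    rw [← h1, show (1 : Matrix (Fin L) (Fin L) R[X]) i k = (Pi.single i 1 : Fin L → R[X]) k by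
      simp [Matrix.one_apply, Pi.single_apply, eq_comm]]
    ring
  have hdet := congrArg Matrix.det hmat
  rw [Matrix.det_smul, Fintype.card_fin, Matrix.det_mul, hE, ← pow_mul] at hdet
  have hprime := Polynomial.prime_X_sub_C (1 : R)
  have hndvd : ¬ Polynomial.X - Polynomial.C (1 : R) ∣ E := by
    rw [Polynomial.dvd_iff_isRoot]
    exact hE1
  -- The factor X - 1 of det A is kept together with det G, so the whole power of X - 1 divides that
  -- product.
  obtain ⟨W, hW⟩ := hprime.pow_dvd_of_dvd_mul_left ((q - 1) * L) hndvd
    (b := (Matrix.of G).det * (Polynomial.X - Polynomial.C (1 : R)))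
    ⟨_, by rw [hdet]; ring⟩
  have h3 : (1 - (Polynomial.X - Polynomial.C (1 : R)) • Matrix.of H).det = W * E := by
    refine mul_left_cancel₀ (pow_ne_zero ((q - 1) * L) (Polynomial.X_sub_C_ne_zero (1 : R))) ?_
    rw [hdet, ← mul_assoc, ← mul_assoc, hW]
  have h4 := congrArg (Polynomial.evalRingHom 1) h3
  rw [RingHom.map_det, map_mul] at h4
  have h5 : (Polynomial.evalRingHom (1 : R)).mapMatrix
      (1 - (Polynomial.X - Polynomial.C (1 : R)) • Matrix.of H) = 1 := by
    ext i k
    simp [Matrix.one_apply, apply_ite (Polynomial.eval (1 : R))]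
  rw [h5, Matrix.det_one] at h4
  exact IsUnit.of_mul_eq_one_right _ h4.symm

/-- If the translation by `L` acts on the solutions with a small order of nilpotency and the
generic space of solutions is one-dimensional, then so are the spaces of solutions over the
residue fields. -/
theorem rank_cyclicSolutions_residueField_le_one [IsDomain R] {p r : ℕ} [CharP R p]
    [Fact p.Prime] (hr : r ≠ 0) (hL : 0 < L)
    (h : ∀ (B : Type) [AddCommGroup B] [Module R B], ∀ x ∈ cyclicSolutions B L (p ^ r) c par,
      ((LinearMap.funLeft R B (· + L) - 1) ^ (p ^ r - 1) : Module.End R (ℕ → B)) x = 0)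
    {F κ : Type} [Field F] [Field κ] (f : R →+* F) (g : R →+* κ)
    (hF : Module.rank F (cyclicSolutions F L (p ^ r) (fun j => f (c j)) par) ≤ 1) :
    Module.rank κ (cyclicSolutions κ L (p ^ r) (fun j => g (c j)) par) ≤ 1 := by
  obtain ⟨E, hE⟩ := Polynomial.dvd_iff_isRoot.mpr (eval_one_det_recurrenceMatrix L hL c par)
  have hmap : ∀ {S : Type} [CommRing S] (f : R →+* S),
      (recurrenceMatrix L (fun j => f (c j)) par).det
        = (Polynomial.X - Polynomial.C 1) * Polynomial.map f E := fun f => by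
    rw [← recurrenceMatrix_map, ← RingHom.mapMatrix_apply, ← RingHom.map_det, hE]
    simp
  have hp : ∀ {S : Type} [CommRing S] (f : R →+* S), (p : S) = 0 := fun f => by
    rw [← map_natCast f, CharP.cast_eq_zero, map_zero]
  -- One-dimensionality over F gives a nonzero value in F, hence in R. Nilpotency then upgrades
  -- nonzero to unit, and a unit has nonzero image in κ.
  have hE1 : E.eval 1 ≠ 0 := fun h0 => by
    refine eval_one_ne_zero_of_rank_cyclicSolutions_le_one L _ par hL ?_ hF (hmap f) ?_
    · rw [Nat.cast_pow, hp f, zero_pow hr]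
    · rw [Polynomial.eval_one_map, h0, map_zero]
  have hu := isUnit_eval_one_of_shift_sub_one_pow_eq_zero L c par hL h hE hE1
  have : CharP κ p := ringChar.of_eq <| (Nat.dvd_prime Fact.out).mp (ringChar.dvd (hp g)) |>.resolve_left
    CharP.ringChar_ne_one
  refine rank_cyclicSolutions_le_one L _ par hL (hmap g) ?_
  rw [Polynomial.eval_one_map]
  exact (hu.map g).ne_zero

end Domain

/-! ### Colorings of Gauss codes -/

section Coloring

variable {R : Type*} [CommRing R] (t : Rˣ)

/-- The color of the arc that leaves a letter, in terms of the color `a` of the arc that arrives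
and of the colors `g` of the over-crossing arcs. -/
def passLetter {B : Type*} [AddCommGroup B] [Module R B] (g : ℕ → B) (l : GaussLetter) (a : B) : B :=
  if l.isOver then a else
    ((t ^ (-(l.sign : ℤ)) : Rˣ) : R) • a + (1 - ((t ^ (-(l.sign : ℤ)) : Rˣ) : R)) • g l.label

/-- The color of the last arc of a word. -/
def passWord {B : Type*} [AddCommGroup B] [Module R B] (g : ℕ → B) : List GaussLetter → B → B
  | [], a => a
  | l :: w, a => passWord g w (passLetter t g l a)

/-- The arcs of a word that starts with the color `a` have, at its over-crossing letters, the
colors `g`. -/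
def OverAgree {B : Type*} [AddCommGroup B] [Module R B] (g : ℕ → B) : List GaussLetter → B → Prop
  | [], _ => True
  | l :: w, a => (l.isOver = true → g l.label = a) ∧ OverAgree g w (passLetter t g l a)

section Word

variable {B B' : Type*} [AddCommGroup B] [Module R B] [AddCommGroup B'] [Module R B']

theorem passWord_append (g : ℕ → B) (u v : List GaussLetter) (a : B) :
    passWord t g (u ++ v) a = passWord t g v (passWord t g u a) := by
  induction u generalizing a with
  | nil => rfl
  | cons l u ih => exact ih _

theorem overAgree_append (g : ℕ → B) (u v : List GaussLetter) (a : B) :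
    OverAgree t g (u ++ v) a ↔ OverAgree t g u a ∧ OverAgree t g v (passWord t g u a) := by
  induction u generalizing a with
  | nil => simp [OverAgree, passWord]
  | cons l u ih => simp only [List.cons_append, OverAgree, passWord, ih, and_assoc]

theorem passWord_congr {g g' : ℕ → B} {w : List GaussLetter}
    (h : ∀ l ∈ w, g l.label = g' l.label) (a : B) : passWord t g w a = passWord t g' w a := by
  induction w generalizing a with
  | nil => rfl
  | cons l w ih =>
    rw [List.forall_mem_cons] at h
    simp only [passWord, passLetter, h.1, ih h.2]

theorem overAgree_congr {g g' : ℕ → B} {w : List GaussLetter}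
    (h : ∀ l ∈ w, g l.label = g' l.label) (a : B) : OverAgree t g w a ↔ OverAgree t g' w a := by
  induction w generalizing a with
  | nil => rfl
  | cons l w ih =>
    rw [List.forall_mem_cons] at h
    simp only [OverAgree, passLetter, h.1, ih h.2]

theorem passLetter_add (g g' : ℕ → B) (l : GaussLetter) (a a' : B) :
    passLetter t (g + g') l (a + a') = passLetter t g l a + passLetter t g' l a' := by
  unfold passLetter
  split_ifs
  · rfl
  · simp only [Pi.add_apply, smul_add]; abel

theorem passWord_add (g g' : ℕ → B) (w : List GaussLetter) (a a' : B) :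
    passWord t (g + g') w (a + a') = passWord t g w a + passWord t g' w a' := by
  induction w generalizing a a' with
  | nil => rfl
  | cons l w ih => simp only [passWord, passLetter_add, ih]

theorem passLetter_map (f : B →ₗ[R] B') (g : ℕ → B) (l : GaussLetter) (a : B) :
    passLetter t (fun c => f (g c)) l (f a) = f (passLetter t g l a) := by
  unfold passLetter
  split_ifs <;> simp

theorem passWord_map (f : B →ₗ[R] B') (g : ℕ → B) (w : List GaussLetter) (a : B) :
    passWord t (fun c => f (g c)) w (f a) = f (passWord t g w a) := by
  induction w generalizing a with
  | nil => rfl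
  | cons l w ih => simp only [passWord, passLetter_map, ih]

theorem OverAgree.add {g g' : ℕ → B} {w : List GaussLetter} {a a' : B} (h : OverAgree t g w a)
    (h' : OverAgree t g' w a') : OverAgree t (g + g') w (a + a') := by
  induction w generalizing a a' with
  | nil => trivial
  | cons l w ih =>
    refine ⟨fun hl => by rw [Pi.add_apply, h.1 hl, h'.1 hl], ?_⟩
    rw [passLetter_add]
    exact ih h.2 h'.2

theorem OverAgree.map (f : B →ₗ[R] B') {g : ℕ → B} {w : List GaussLetter} {a : B}
    (h : OverAgree t g w a) : OverAgree t (fun c => f (g c)) w (f a) := by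
  induction w generalizing a with
  | nil => trivial
  | cons l w ih =>
    refine ⟨fun hl => congrArg f (h.1 hl), ?_⟩
    rw [passLetter_map]
    exact ih h.2

theorem passWord_smul (r : R) (g : ℕ → B) (w : List GaussLetter) (a : B) :
    passWord t (r • g) w (r • a) = r • passWord t g w a :=
  passWord_map t (LinearMap.lsmul R B r) g w a

end Word

/-- The colorings of a Gauss code by a module: pairs of the color of the first arc and the colors
of the over-crossing arcs. -/
def colorings (B : Type*) [AddCommGroup B] [Module R B] (w : List GaussLetter) :
    Submodule R (B × (ℕ → B)) where
  carrier := {x | OverAgree t x.2 w x.1 ∧ passWord t x.2 w x.1 = x.1 ∧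
    -- Labels that do not occur would otherwise contribute free coordinates.
    ∀ c, (∀ l ∈ w, l.label ≠ c) → x.2 c = 0}
  add_mem' := by
    rintro x y ⟨hx, hx', hx''⟩ ⟨hy, hy', hy''⟩
    refine ⟨hx.add t hy, ?_, fun c hc => ?_⟩
    · rw [Prod.fst_add, Prod.snd_add, passWord_add, hx', hy']
    · rw [Prod.snd_add, Pi.add_apply, hx'' c hc, hy'' c hc, add_zero]
  zero_mem' := by
    have h : OverAgree t (0 : ℕ → B) w 0 := by
      induction w with
      | nil => trivial
      | cons l w ih => exact ⟨fun _ => rfl, by simpa [passLetter] using ih⟩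
    exact ⟨h, by simpa using passWord_smul t (0 : R) (0 : ℕ → B) w 0, fun _ _ => rfl⟩
  smul_mem' := by
    rintro r x ⟨hx, hx', hx''⟩
    refine ⟨hx.map t (LinearMap.lsmul R B r), ?_, fun c hc => ?_⟩
    · rw [Prod.smul_fst, Prod.smul_snd, passWord_smul, hx']
    · rw [Prod.smul_snd, Pi.smul_apply, hx'' c hc, smul_zero]

/-- The action of a linear map on pairs of colors. -/
def mapPair {B B' : Type*} [AddCommGroup B] [Module R B] [AddCommGroup B'] [Module R B']
    (f : B →ₗ[R] B') : B × (ℕ → B) →ₗ[R] B' × (ℕ → B') :=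
  f.prodMap (f.compLeft ℕ)

theorem mapPair_mem {B B' : Type*} [AddCommGroup B] [Module R B] [AddCommGroup B'] [Module R B']
    (f : B →ₗ[R] B') {w : List GaussLetter} {x : B × (ℕ → B)} (hx : x ∈ colorings t B w) :
    mapPair f x ∈ colorings t B' w := by
  refine ⟨hx.1.map t f, ?_, fun c hc => ?_⟩
  · exact (passWord_map t f x.2 w x.1).trans (congrArg f hx.2.1)
  · exact (congrArg f (hx.2.2 c hc)).trans (map_zero f)

/-- Natural linear equivalences between the modules of colorings of two words. -/
structure ColoringEquiv (w w' : List GaussLetter) where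
  toEquiv : ∀ (B : Type) [AddCommGroup B] [Module R B], colorings t B w ≃ₗ[R] colorings t B w'
  natural : ∀ (B B' : Type) [AddCommGroup B] [Module R B] [AddCommGroup B'] [Module R B']
    (f : B →ₗ[R] B') (x : colorings t B w),
      (toEquiv B' ⟨mapPair f x, mapPair_mem t f x.2⟩ : B' × (ℕ → B')) = mapPair f (toEquiv B x)

variable {t}

def ColoringEquiv.refl (w : List GaussLetter) : ColoringEquiv t w w where
  toEquiv _ _ _ := LinearEquiv.refl R _
  natural _ _ _ _ _ _ _ _ := rfl

def ColoringEquiv.symm {w w' : List GaussLetter} (e : ColoringEquiv t w w') :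
    ColoringEquiv t w' w where
  toEquiv B _ _ := (e.toEquiv B).symm
  natural B B' _ _ _ _ f x := by
    have h := e.natural B B' f ((e.toEquiv B).symm x)
    rw [LinearEquiv.apply_symm_apply] at h
    rw [← Subtype.ext_iff (a2 := ⟨_, mapPair_mem t f ((e.toEquiv B).symm x).2⟩),
      LinearEquiv.symm_apply_eq]
    exact Subtype.ext h.symm

def ColoringEquiv.trans {w w' w'' : List GaussLetter} (e : ColoringEquiv t w w')
    (e' : ColoringEquiv t w' w'') : ColoringEquiv t w w'' where
  toEquiv B _ _ := (e.toEquiv B).trans (e'.toEquiv B)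
  natural B B' _ _ _ _ f x := by
    have h := e'.natural B B' f (e.toEquiv B x)
    rw [LinearEquiv.trans_apply, LinearEquiv.trans_apply, ← h]
    congr 2
    exact Subtype.ext (e.natural B B' f x)

/-- A pair of natural maps that are inverse to each other on colorings. -/
def ColoringEquiv.mk' {w w' : List GaussLetter}
    (F G : ∀ (B : Type) [AddCommGroup B] [Module R B], B × (ℕ → B) →ₗ[R] B × (ℕ → B))
    (hF : ∀ (B : Type) [AddCommGroup B] [Module R B], ∀ x ∈ colorings t B w,
      F B x ∈ colorings t B w' ∧ G B (F B x) = x)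
    (hG : ∀ (B : Type) [AddCommGroup B] [Module R B], ∀ x ∈ colorings t B w',
      G B x ∈ colorings t B w ∧ F B (G B x) = x)
    (hnat : ∀ (B B' : Type) [AddCommGroup B] [Module R B] [AddCommGroup B'] [Module R B']
      (f : B →ₗ[R] B') (x : B × (ℕ → B)), F B' (mapPair f x) = mapPair f (F B x)) :
    ColoringEquiv t w w' where
  toEquiv B _ _ := LinearEquiv.ofLinearMap
    ((F B).restrict fun x hx => (hF B x hx).1) ((G B).restrict fun x hx => (hG B x hx).1)
    (by ext1 x; exact Subtype.ext (hG B x x.2).2) (by ext1 x; exact Subtype.ext (hF B x x.2).2)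
  natural B B' _ _ _ _ f x := hnat B B' f x

end Coloring

/-! ### Invariance of colorings: basepoint, relabelling, first Reidemeister move. -/

section Moves

variable {R : Type*} [CommRing R] {t : Rˣ}

/-- The linear map that replaces the color of the label `x`. -/
def updateColor {B : Type*} [AddCommGroup B] [Module R B] (x : ℕ) (φ : B × (ℕ → B) →ₗ[R] B) :
    B × (ℕ → B) →ₗ[R] B × (ℕ → B) where
  toFun y := (y.1, Function.update y.2 x (φ y))
  map_add' y z := by
    refine Prod.ext rfl ?_
    rw [map_add, Prod.snd_add, Prod.snd_add]
    exact Function.update_add _ _ _ _ _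
  map_smul' r y := by
    refine Prod.ext rfl ?_
    rw [map_smul, Prod.smul_snd]
    exact Function.update_smul _ _ _ _

theorem updateColor_mapPair {B B' : Type*} [AddCommGroup B] [Module R B] [AddCommGroup B']
    [Module R B'] (f : B →ₗ[R] B') (x : ℕ) {φ : B × (ℕ → B) →ₗ[R] B}
    {φ' : B' × (ℕ → B') →ₗ[R] B'} (h : ∀ y, φ' (mapPair f y) = f (φ y)) (y : B × (ℕ → B)) :
    updateColor x φ' (mapPair f y) = mapPair f (updateColor x φ y) := by
  refine Prod.ext rfl ?_
  ext c
  change Function.update (fun c => f (y.2 c)) x _ c = f (Function.update y.2 x _ c)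
  rw [h]
  by_cases hc : c = x
  · subst hc; simp
  · simp [hc]

/-- A label occurs at most once as O and once as U, so no occurrence of x is left for u when v
already contains both. -/
theorem label_ne_of_nodup {u v : List GaussLetter} {x : ℕ}
    (h : ((v ++ u).map fun l => (l.label, l.isOver)).Nodup)
    (hx : ∀ o, ∃ l ∈ v, (l.label, l.isOver) = (x, o)) : ∀ l ∈ u, l.label ≠ x := by
  rintro l hl rfl
  rw [List.map_append, List.nodup_append] at h
  obtain ⟨m, hm, hm'⟩ := hx l.isOver
  exact h.2.2 _ (List.mem_map_of_mem hm) _ (List.mem_map_of_mem hl) hm'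

theorem passWord_update_of_label_ne {B : Type*} [AddCommGroup B] [Module R B] {w : List GaussLetter}
    {x : ℕ} (h : ∀ l ∈ w, l.label ≠ x) (g : ℕ → B) (b a : B) :
    passWord t (Function.update g x b) w a = passWord t g w a :=
  passWord_congr t (fun l hl => Function.update_of_ne (h l hl) _ _) a

theorem overAgree_update_of_label_ne {B : Type*} [AddCommGroup B] [Module R B]
    {w : List GaussLetter} {x : ℕ} (h : ∀ l ∈ w, l.label ≠ x) (g : ℕ → B) (b a : B) :
    OverAgree t (Function.update g x b) w a ↔ OverAgree t g w a :=
  overAgree_congr t (fun l hl => Function.update_of_ne (h l hl) _ _) a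

/-- The map on colorings induced by a change of basepoint. -/
def rotateColor (t : Rˣ) {B : Type*} [AddCommGroup B] [Module R B] (u : List GaussLetter) :
    B × (ℕ → B) →ₗ[R] B × (ℕ → B) where
  toFun y := (passWord t y.2 u y.1, y.2)
  map_add' _ _ := Prod.ext (passWord_add t _ _ _ _ _) rfl
  map_smul' _ _ := Prod.ext (passWord_smul t _ _ _ _) rfl

theorem rotateColor_mem {B : Type*} [AddCommGroup B] [Module R B] {u v : List GaussLetter}
    {x : B × (ℕ → B)} (hx : x ∈ colorings t B (u ++ v)) :
    rotateColor t u x ∈ colorings t B (v ++ u) ∧ rotateColor t v (rotateColor t u x) = x := by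
  obtain ⟨h1, h2, h3⟩ := hx
  rw [overAgree_append] at h1
  rw [passWord_append] at h2
  refine ⟨⟨?_, ?_, fun c hc => h3 c fun l hl => hc l ?_⟩, Prod.ext h2 rfl⟩
  · change OverAgree t x.2 (v ++ u) (passWord t x.2 u x.1)
    rw [overAgree_append, h2]
    exact h1.symm
  · change passWord t x.2 (v ++ u) (passWord t x.2 u x.1) = passWord t x.2 u x.1
    rw [passWord_append, h2]
  · rw [List.mem_append] at hl ⊢
    exact hl.symm

def ColoringEquiv.rotate (t : Rˣ) (u v : List GaussLetter) :
    ColoringEquiv t (u ++ v) (v ++ u) :=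
  .mk' (fun _ _ _ => rotateColor t u) (fun _ _ _ => rotateColor t v)
    (fun _ _ _ _ hx => rotateColor_mem hx) (fun _ _ _ _ hx => rotateColor_mem hx)
    fun _ _ _ _ _ _ f x => Prod.ext (passWord_map t f x.2 u x.1) rfl

theorem passWord_relabel {B : Type*} [AddCommGroup B] [Module R B] (f : ℕ → ℕ) (g : ℕ → B)
    (w : List GaussLetter) (a : B) :
    passWord t g (w.map fun l => ⟨f l.label, l.isOver, l.sign⟩) a
      = passWord t (g ∘ f) w a := by
  induction w generalizing a with
  | nil => rfl
  | cons l w ih => simp only [List.map_cons, passWord, passLetter, ih, Function.comp]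

theorem overAgree_relabel {B : Type*} [AddCommGroup B] [Module R B] (f : ℕ → ℕ) (g : ℕ → B)
    (w : List GaussLetter) (a : B) :
    OverAgree t g (w.map fun l => ⟨f l.label, l.isOver, l.sign⟩) a
      ↔ OverAgree t (g ∘ f) w a := by
  induction w generalizing a with
  | nil => rfl
  | cons l w ih => simp only [List.map_cons, OverAgree, passLetter, ih, Function.comp]

noncomputable def ColoringEquiv.relabel (t : Rˣ) (f : ℕ → ℕ) (hf : Function.Injective f)
    (w : List GaussLetter) :
    ColoringEquiv t w (w.map fun l => ⟨f l.label, l.isOver, l.sign⟩) :=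
  .mk'
    (fun B _ _ => LinearMap.id.prodMap
      { toFun := fun g => Function.extend f g 0
        map_add' := fun g g' => by
          ext c
          by_cases hc : ∃ a, f a = c
          · obtain ⟨a, rfl⟩ := hc
            simp [hf.extend_apply]
          · simp [Function.extend_apply' _ _ _ hc]
        map_smul' := fun r g => by
          ext c
          by_cases hc : ∃ a, f a = c
          · obtain ⟨a, rfl⟩ := hc
            simp [hf.extend_apply]
          · simp [Function.extend_apply' _ _ _ hc] })
    (fun B _ _ => LinearMap.id.prodMap (LinearMap.funLeft R B f))
    (fun B _ _ x hx => by
      obtain ⟨h1, h2, h3⟩ := hx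
      have h4 : Function.extend f x.2 0 ∘ f = x.2 := funext fun a => hf.extend_apply _ _ a
      refine ⟨⟨?_, ?_, ?_⟩, Prod.ext rfl h4⟩
      · change OverAgree t (Function.extend f x.2 0) _ x.1
        rwa [overAgree_relabel, h4]
      · change passWord t (Function.extend f x.2 0) _ x.1 = x.1
        rwa [passWord_relabel, h4]
      · intro c hc
        change Function.extend f x.2 0 c = 0
        by_cases hc' : ∃ a, f a = c
        · obtain ⟨a, rfl⟩ := hc'
          rw [hf.extend_apply]
          refine h3 a fun l hl hla => hc _ (List.mem_map_of_mem hl) ?_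
          simp [hla]
        · rw [Function.extend_apply' _ _ _ hc', Pi.zero_apply])
    (fun B _ _ x hx => by
      obtain ⟨h1, h2, h3⟩ := hx
      rw [overAgree_relabel] at h1
      rw [passWord_relabel] at h2
      refine ⟨⟨h1, h2, fun c hc => h3 _ fun l hl => ?_⟩, Prod.ext rfl ?_⟩
      · obtain ⟨m, hm, rfl⟩ := List.mem_map.mp hl
        exact fun h => hc m hm (hf h)
      · ext c
        change Function.extend f (x.2 ∘ f) 0 c = x.2 c
        by_cases hc' : ∃ a, f a = c
        · obtain ⟨a, rfl⟩ := hc'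
          rw [hf.extend_apply, Function.comp]
        · rw [Function.extend_apply' _ _ _ hc', Pi.zero_apply]
          refine (h3 c fun l hl h => hc' ?_).symm
          obtain ⟨m, hm, rfl⟩ := List.mem_map.mp hl
          exact ⟨m.label, h⟩)
    fun B B' _ _ _ _ φ x => by
      refine Prod.ext rfl ?_
      ext c
      change Function.extend f (fun a => φ (x.2 a)) 0 c = φ (Function.extend f x.2 0 c)
      by_cases hc : ∃ a, f a = c
      · obtain ⟨a, rfl⟩ := hc
        simp [hf.extend_apply]
      · simp [Function.extend_apply' _ _ _ hc]

/-- In a kink the over-arc is adjacent to the undercrossing, so the color passes through unchanged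
and the color of x must be the incoming one. The inverse map forgets it. -/
def ColoringEquiv.reidemeister1 (t : Rˣ) {w : List GaussLetter} {x : ℕ} {o : Bool} {ε : ℤˣ}
    (hw : IsGaussWord ([⟨x, o, ε⟩, ⟨x, !o, ε⟩] ++ w)) :
    ColoringEquiv t w ([⟨x, o, ε⟩, ⟨x, !o, ε⟩] ++ w) := by
  have hxw : ∀ l ∈ w, l.label ≠ x := label_ne_of_nodup hw.1 fun o' => by
    by_cases h : o' = o
    · exact ⟨⟨x, o, ε⟩, by simp, by simp [h]⟩
    · exact ⟨⟨x, !o, ε⟩, by simp, by cases o <;> cases o' <;> simp_all⟩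
  have key : ∀ {B : Type} [AddCommGroup B] [Module R B] (g : ℕ → B) (a : B), g x = a →
      OverAgree t g [⟨x, o, ε⟩, ⟨x, !o, ε⟩] a ∧
        passWord t g [⟨x, o, ε⟩, ⟨x, !o, ε⟩] a = a := by
    rintro B _ _ g a rfl
    cases o <;> simp [OverAgree, passWord, passLetter, ← add_smul]
  -- If the undercrossing comes first, the over-color is the outgoing color, so t^(-ε) g x = t^(-ε)
  -- a; the unit cancels.
  have key' : ∀ {B : Type} [AddCommGroup B] [Module R B] (g : ℕ → B) (a : B),
      OverAgree t g [⟨x, o, ε⟩, ⟨x, !o, ε⟩] a → g x = a := by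
    intro B _ _ g a h
    cases o
    · simp only [OverAgree, passLetter] at h
      have h1 : g x = ((t ^ (-(ε : ℤ)) : Rˣ) : R) • a
        + (1 - ((t ^ (-(ε : ℤ)) : Rˣ) : R)) • g x := by simpa using h
      have h2 : ((t ^ (-(ε : ℤ)) : Rˣ) : R) • g x = ((t ^ (-(ε : ℤ)) : Rˣ) : R) • a := by
        rw [sub_smul, one_smul, add_sub_left_comm, left_eq_add, sub_eq_zero] at h1
        exact h1.symm
      have h3 := congrArg (fun b => (((t ^ (-(ε : ℤ)))⁻¹ : Rˣ) : R) • b) h2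
      simpa only [smul_smul, Units.inv_mul, one_smul] using h3
    · exact h.1 rfl
  refine .mk' (fun B _ _ => updateColor x (LinearMap.fst R B _)) (fun B _ _ => updateColor x 0)
    (fun B _ _ y hy => ?_) (fun B _ _ y hy => ?_) fun B B' _ _ _ _ f y => ?_
  · obtain ⟨h1, h2, h3⟩ := hy
    obtain ⟨h4, h5⟩ := key (Function.update y.2 x y.1) y.1 (Function.update_self _ _ _)
    refine ⟨⟨?_, ?_, fun c hc => ?_⟩, Prod.ext rfl ?_⟩
    · change OverAgree t (Function.update y.2 x y.1) _ y.1
      rw [overAgree_append, h5, overAgree_update_of_label_ne hxw]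
      exact ⟨h4, h1⟩
    · change passWord t (Function.update y.2 x y.1) _ y.1 = y.1
      rw [passWord_append, h5, passWord_update_of_label_ne hxw, h2]
    · change Function.update y.2 x y.1 c = 0
      rw [Function.update_of_ne (fun h => hc ⟨x, o, ε⟩ (by simp) h.symm)]
      exact h3 c fun l hl => hc l (List.mem_append_right _ hl)
    · change Function.update (Function.update y.2 x y.1) x 0 = y.2
      rw [Function.update_idem, Function.update_eq_self_iff]
      exact (h3 x hxw).symm
  · obtain ⟨h1, h2, h3⟩ := hy
    rw [overAgree_append] at h1
    have h4 := key' _ _ h1.1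
    obtain ⟨-, h5⟩ := key _ _ h4
    rw [h5] at h1
    rw [passWord_append, h5] at h2
    refine ⟨⟨?_, ?_, fun c hc => ?_⟩, Prod.ext rfl ?_⟩
    · exact (overAgree_update_of_label_ne hxw _ _ _).mpr h1.2
    · exact (passWord_update_of_label_ne hxw _ _ _).trans h2
    · change Function.update y.2 x 0 c = 0
      by_cases hcx : c = x
      · subst hcx; simp
      · rw [Function.update_of_ne hcx]
        refine h3 c fun l hl => ?_
        simp only [List.cons_append, List.nil_append, List.mem_cons] at hl
        rcases hl with rfl | rfl | hl
        exacts [Ne.symm hcx, Ne.symm hcx, hc l hl]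
    · change Function.update (Function.update y.2 x 0) x y.1 = y.2
      rw [Function.update_idem, Function.update_eq_self_iff]
      exact h4.symm
  · exact updateColor_mapPair f x (fun _ => rfl) y

end Moves

/-! ### Invariance of colorings: second and third Reidemeister moves. -/

section Moves

variable {R : Type*} [CommRing R] {t : Rˣ}

theorem orderedPair_perm (d : ℤˣ) (a b : GaussLetter) : (orderedPair d a b).Perm [a, b] := by
  unfold orderedPair
  split_ifs
  exacts [List.Perm.refl _, List.Perm.swap _ _ _]

theorem over_pair {B : Type*} [AddCommGroup B] [Module R B] (g : ℕ → B) (d : ℤˣ) (x y : ℕ)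
    (ε δ : ℤˣ) (a : B) :
    (OverAgree t g (orderedPair d ⟨x, true, ε⟩ ⟨y, true, δ⟩) a ↔ g x = a ∧ g y = a) ∧
      passWord t g (orderedPair d ⟨x, true, ε⟩ ⟨y, true, δ⟩) a = a := by
  unfold orderedPair
  split_ifs <;> simp [OverAgree, passWord, passLetter, and_comm]

/-- Passing under the same color with opposite signs applies an affine map and then its inverse. In
a second Reidemeister move the two over-letters lie on one arc, which makes the two colors equal. -/
theorem cancelling_pair {B : Type*} [AddCommGroup B] [Module R B] {g : ℕ → B} (d : ℤˣ) {x y : ℕ}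
    (h : g x = g y) (ε : ℤˣ) (a : B) :
    OverAgree t g (orderedPair d ⟨x, false, ε⟩ ⟨y, false, -ε⟩) a ∧
      passWord t g (orderedPair d ⟨x, false, ε⟩ ⟨y, false, -ε⟩) a = a := by
  have h1 : ((t ^ (-(ε : ℤ)) : Rˣ) : R) * ((t ^ (-((-ε : ℤˣ) : ℤ)) : Rˣ) : R) = 1 := by
    rw [← Units.val_mul, ← zpow_add]
    simp
  unfold orderedPair
  split_ifs <;> refine ⟨by simp [OverAgree], ?_⟩ <;>
    simp only [passWord, passLetter, Bool.false_eq_true, if_false, h] <;>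
    generalize ((t ^ (-(ε : ℤ)) : Rˣ) : R) = Y at * <;>
    generalize ((t ^ (-((-ε : ℤˣ) : ℤ)) : Rˣ) : R) = Y' at * <;>
    match_scalars
  exacts [by linear_combination h1, by linear_combination -h1, by linear_combination h1,
    by linear_combination -h1]

/-- This is the self-distributivity of the Alexander quandle for the bottom strand. Interchanging
the passages under top and middle strand is compensated by conjugating the color of the middle
strand with the top one. The condition on the signs says that bottom and middle strand cross the top
strand compatibly. -/
theorem move_under_pair {B : Type*} [AddCommGroup B] [Module R B] {g : ℕ → B} {x y z : ℕ}
    (hy : y ≠ z) (hxy : g x = g y) {b c εx εy : ℤˣ} (εz : ℤˣ)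
    (h : b * εx = c * εy) (a : B) :
    passWord t (Function.update g z (((t ^ ((b * εx : ℤˣ) : ℤ) : Rˣ) : R) • g z
        + (1 - ((t ^ ((b * εx : ℤˣ) : ℤ) : Rˣ) : R)) • g x))
      (orderedPair (-c) ⟨y, false, εy⟩ ⟨z, false, εz⟩) a
      = passWord t g (orderedPair c ⟨y, false, εy⟩ ⟨z, false, εz⟩) a := by
  rw [h, hxy]
  have h1 : ((t ^ (-(εy : ℤ)) : Rˣ) : R) * ((t ^ (εy : ℤ) : Rˣ) : R) = 1 := by
    rw [← Units.val_mul, ← zpow_add]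
    simp
  rcases Int.units_eq_one_or c with rfl | rfl
  · simp only [orderedPair, if_true, one_mul, show ¬ (-1 : ℤˣ) = 1 by decide, if_false, passWord,
      passLetter, Bool.false_eq_true, Function.update_self, Function.update_of_ne hy]
    generalize ((t ^ (-(εy : ℤ)) : Rˣ) : R) = Y at *
    generalize ((t ^ (εy : ℤ) : Rˣ) : R) = Y' at *
    generalize ((t ^ (-(εz : ℤ)) : Rˣ) : R) = Z at *
    match_scalars
    · ring
    · linear_combination (1 - Z) * h1
    · linear_combination -(1 - Z) * h1
  · simp only [orderedPair, neg_neg, if_true, show ¬ (-1 : ℤˣ) = 1 by decide, if_false, passWord,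
      passLetter, Bool.false_eq_true, Function.update_self, Function.update_of_ne hy, neg_mul,
      one_mul, Units.val_neg]
    module

/-- The over-arc at z lies before the undercrossing x on one side of the move and after it on the
other. The new color of z is the old one carried across x. -/
theorem move_middle_pair {B : Type*} [AddCommGroup B] [Module R B] {g : ℕ → B} {x z : ℕ}
    (hx : x ≠ z) {b εx : ℤˣ} (εz : ℤˣ) {a : B}
    (h : OverAgree t g (orderedPair b ⟨x, false, εx⟩ ⟨z, true, εz⟩) a) :
    OverAgree t (Function.update g z (((t ^ ((b * εx : ℤˣ) : ℤ) : Rˣ) : R) • g z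
        + (1 - ((t ^ ((b * εx : ℤˣ) : ℤ) : Rˣ) : R)) • g x))
      (orderedPair (-b) ⟨x, false, εx⟩ ⟨z, true, εz⟩) a ∧
    passWord t (Function.update g z (((t ^ ((b * εx : ℤˣ) : ℤ) : Rˣ) : R) • g z
        + (1 - ((t ^ ((b * εx : ℤˣ) : ℤ) : Rˣ) : R)) • g x))
      (orderedPair (-b) ⟨x, false, εx⟩ ⟨z, true, εz⟩) a
      = passWord t g (orderedPair b ⟨x, false, εx⟩ ⟨z, true, εz⟩) a := by
  have h1 : ((t ^ (-(εx : ℤ)) : Rˣ) : R) * ((t ^ (εx : ℤ) : Rˣ) : R) = 1 := by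
    rw [← Units.val_mul, ← zpow_add]
    simp
  rcases Int.units_eq_one_or b with rfl | rfl
  · simp only [orderedPair, if_true, one_mul, show ¬ (-1 : ℤˣ) = 1 by decide, if_false, passWord,
      passLetter, Bool.false_eq_true, Function.update_self, Function.update_of_ne hx, OverAgree,
      false_imp_iff, true_and, and_true, true_imp_iff] at h ⊢
    rw [h]
    match_scalars
    · linear_combination h1
    · linear_combination -h1
  · simp only [orderedPair, neg_neg, if_true, show ¬ (-1 : ℤˣ) = 1 by decide, if_false, passWord,
      passLetter, Bool.false_eq_true, Function.update_self, Function.update_of_ne hx, neg_mul,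
      one_mul, Units.val_neg, OverAgree, false_imp_iff, true_and, and_true, true_imp_iff] at h ⊢
    rw [h]

def ColoringEquiv.reidemeister2 (t : Rˣ) {u v : List GaussLetter} {x y : ℕ} {ε d : ℤˣ}
    (hw : IsGaussWord ([⟨x, true, ε⟩, ⟨y, true, -ε⟩] ++ u ++
          orderedPair d ⟨x, false, ε⟩ ⟨y, false, -ε⟩ ++ v)) :
    ColoringEquiv t (u ++ v) ([⟨x, true, ε⟩, ⟨y, true, -ε⟩] ++ u ++
          orderedPair d ⟨x, false, ε⟩ ⟨y, false, -ε⟩ ++ v) := by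
  have hnd : ((([⟨x, true, ε⟩, ⟨y, true, -ε⟩, ⟨x, false, ε⟩, ⟨y, false, -ε⟩] :
      List GaussLetter) ++ (u ++ v)).map
      fun l : GaussLetter => (l.label, l.isOver)).Nodup := by
    refine (List.Perm.nodup_iff (List.Perm.map _ ?_)).mp hw.1
    refine List.perm_iff_count.mpr fun l => ?_
    have := (orderedPair_perm d ⟨x, false, ε⟩ ⟨y, false, -ε⟩).count_eq l
    simp only [List.count_append, List.count_cons, List.count_nil] at this ⊢
    omega
  have hx : ∀ l ∈ u ++ v, l.label ≠ x := label_ne_of_nodup hnd fun o => by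
    cases o
    · exact ⟨⟨x, false, ε⟩, by simp, rfl⟩
    · exact ⟨⟨x, true, ε⟩, by simp, rfl⟩
  have hy : ∀ l ∈ u ++ v, l.label ≠ y := label_ne_of_nodup hnd fun o => by
    cases o
    · exact ⟨⟨y, false, -ε⟩, by simp, rfl⟩
    · exact ⟨⟨y, true, -ε⟩, by simp, rfl⟩
  have hxy : x ≠ y := by
    rintro rfl
    simp at hnd
  have hO : ([⟨x, true, ε⟩, ⟨y, true, -ε⟩] : List GaussLetter)
      = orderedPair 1 ⟨x, true, ε⟩ ⟨y, true, -ε⟩ := rfl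
  have hux := fun l hl => hx l (List.mem_append_left v hl)
  have hvx := fun l hl => hx l (List.mem_append_right u hl)
  have huy := fun l hl => hy l (List.mem_append_left v hl)
  have hvy := fun l hl => hy l (List.mem_append_right u hl)
  refine .mk' (fun B _ _ => updateColor y (LinearMap.fst R B _) ∘ₗ updateColor x (LinearMap.fst R B _))
    (fun B _ _ => updateColor x 0 ∘ₗ updateColor y 0)
    (fun B _ _ z hz => ?_) (fun B _ _ z hz => ?_) fun B B' _ _ _ _ f z => ?_
  · obtain ⟨h1, h2, h3⟩ := hz
    rw [overAgree_append] at h1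
    rw [passWord_append] at h2
    set g := Function.update (Function.update z.2 x z.1) y z.1 with hg
    have hgx : g x = z.1 := by simp [hg, hxy]
    have hgy : g y = z.1 := by simp [hg]
    refine ⟨⟨?_, ?_, fun c hc => ?_⟩, Prod.ext rfl ?_⟩
    · change OverAgree t g _ z.1
      simp only [overAgree_append, passWord_append, hO, (over_pair g 1 x y ε (-ε) z.1).1,
        (over_pair g 1 x y ε (-ε) z.1).2, (cancelling_pair d (hgx.trans hgy.symm) ε _).1,
        (cancelling_pair d (hgx.trans hgy.symm) ε _).2]
      rw [hg, overAgree_update_of_label_ne huy, overAgree_update_of_label_ne hux,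
        overAgree_update_of_label_ne hvy, overAgree_update_of_label_ne hvx,
        passWord_update_of_label_ne huy, passWord_update_of_label_ne hux]
      exact ⟨⟨⟨⟨hgx, hgy⟩, h1.1⟩, trivial⟩, h1.2⟩
    · change passWord t g _ z.1 = z.1
      simp only [passWord_append, hO, (over_pair g 1 x y ε (-ε) z.1).2,
        (cancelling_pair d (hgx.trans hgy.symm) ε _).2]
      rw [hg, passWord_update_of_label_ne huy, passWord_update_of_label_ne hux,
        passWord_update_of_label_ne hvy, passWord_update_of_label_ne hvx, h2]
    · change g c = 0
      rw [hg, Function.update_of_ne (fun h => hc ⟨y, true, -ε⟩ (by simp) h.symm),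
        Function.update_of_ne (fun h => hc ⟨x, true, ε⟩ (by simp) h.symm)]
      refine h3 c fun l hl => hc l ?_
      simp only [List.mem_append] at hl ⊢
      tauto
    · change Function.update (Function.update g y 0) x 0 = z.2
      ext c
      by_cases hcx : c = x
      · subst hcx; simp [h3 c hx]
      by_cases hcy : c = y
      · subst hcy; simp [hcx, h3 c hy]
      simp [hg, hcx, hcy]
  · obtain ⟨h1, h2, h3⟩ := hz
    simp only [overAgree_append, passWord_append, hO, (over_pair z.2 1 x y ε (-ε) z.1).1,
      (over_pair z.2 1 x y ε (-ε) z.1).2] at h1 h2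
    have hc := cancelling_pair (t := t) d (h1.1.1.1.1.trans h1.1.1.1.2.symm) ε
    simp only [(hc _).2] at h1 h2
    refine ⟨⟨?_, ?_, fun c hc => ?_⟩, Prod.ext rfl ?_⟩
    · change OverAgree t (Function.update (Function.update z.2 y 0) x 0) _ z.1
      rw [overAgree_update_of_label_ne hx, overAgree_update_of_label_ne hy, overAgree_append]
      exact ⟨h1.1.1.2, h1.2⟩
    · change passWord t (Function.update (Function.update z.2 y 0) x 0) _ z.1 = z.1
      rw [passWord_update_of_label_ne hx, passWord_update_of_label_ne hy, passWord_append]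
      exact h2
    · change Function.update (Function.update z.2 y 0) x 0 c = 0
      by_cases hcx : c = x
      · subst hcx; simp
      by_cases hcy : c = y
      · subst hcy; simp [hcx]
      rw [Function.update_of_ne hcx, Function.update_of_ne hcy]
      refine h3 c fun l hl => ?_
      simp only [List.mem_append, List.mem_cons, List.not_mem_nil, or_false,
        (orderedPair_perm _ _ _).mem_iff] at hl
      rcases hl with (((rfl | rfl) | hl) | (rfl | rfl)) | hl
      exacts [Ne.symm hcx, Ne.symm hcy, hc l (List.mem_append_left _ hl), Ne.symm hcx,
        Ne.symm hcy, hc l (List.mem_append_right _ hl)]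
    · change Function.update (Function.update (Function.update (Function.update z.2 y 0) x 0)
        x z.1) y z.1 = z.2
      rw [Function.update_idem, Function.update_comm hxy, Function.update_idem, ← h1.1.1.1.2,
        Function.update_eq_self, h1.1.1.1.2, ← h1.1.1.1.1, Function.update_eq_self]
  · simp only [LinearMap.comp_apply]
    rw [updateColor_mapPair f x (φ := LinearMap.fst R B _) (fun _ => rfl),
      updateColor_mapPair f y (φ := LinearMap.fst R B _) (fun _ => rfl)]

/-- The color that a third Reidemeister move assigns to the crossing `z`. -/
def movedColor (t : Rˣ) (B : Type*) [AddCommGroup B] [Module R B] (x z : ℕ) (δ : ℤˣ) :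
    B × (ℕ → B) →ₗ[R] B :=
  ((t ^ (δ : ℤ) : Rˣ) : R) • (LinearMap.proj z ∘ₗ LinearMap.snd R B _)
    + (1 - ((t ^ (δ : ℤ) : Rˣ) : R)) • (LinearMap.proj x ∘ₗ LinearMap.snd R B _)

theorem movedColor_apply {B : Type*} [AddCommGroup B] [Module R B] (x z : ℕ) (δ : ℤˣ)
    (y : B × (ℕ → B)) : movedColor t B x z δ y =
      ((t ^ (δ : ℤ) : Rˣ) : R) • y.2 z + (1 - ((t ^ (δ : ℤ) : Rˣ) : R)) • y.2 x :=
  rfl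

theorem updateColor_snd {B : Type*} [AddCommGroup B] [Module R B] (x : ℕ)
    (φ : B × (ℕ → B) →ₗ[R] B) (y : B × (ℕ → B)) :
    (updateColor x φ y).2 = Function.update y.2 x (φ y) :=
  rfl

theorem update_movedColor_comp {B : Type*} [AddCommGroup B] [Module R B] {x z : ℕ} (h : x ≠ z)
    (δ : ℤˣ) (y : B × (ℕ → B)) :
    updateColor z (movedColor t B x z (-δ)) (updateColor z (movedColor t B x z δ) y) = y := by
  refine Prod.ext rfl ?_
  have h1 : ((t ^ ((-δ : ℤˣ) : ℤ) : Rˣ) : R) * ((t ^ (δ : ℤ) : Rˣ) : R) = 1 := by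
    rw [← Units.val_mul, ← zpow_add]
    simp
  rw [updateColor_snd, updateColor_snd, Function.update_idem, Function.update_eq_self_iff,
    movedColor_apply, updateColor_snd, Function.update_self, Function.update_of_ne h,
    movedColor_apply]
  generalize ((t ^ ((-δ : ℤˣ) : ℤ) : Rˣ) : R) = Y at *
  match_scalars
  · linear_combination h1
  · linear_combination -h1

/-- The six displayed letters exhaust the occurrences of z. Changing the color of z therefore
affects only the middle and the bottom pair. -/
theorem reidemeister3_distinct {u v w : List GaussLetter} {x y z : ℕ} {εx εy εz : ℤˣ}
    {l : List GaussLetter} (hl : l.Perm ([⟨x, true, εx⟩, ⟨y, true, εy⟩, ⟨x, false, εx⟩,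
      ⟨z, true, εz⟩, ⟨y, false, εy⟩, ⟨z, false, εz⟩] ++ (u ++ v ++ w))) (h : IsGaussWord l) :
    x ≠ z ∧ y ≠ z ∧ (∀ l ∈ u, l.label ≠ z) ∧ (∀ l ∈ v, l.label ≠ z) ∧ ∀ l ∈ w, l.label ≠ z := by
  have hnd := (hl.map fun l : GaussLetter => (l.label, l.isOver)).nodup_iff.mp h.1
  have hz := label_ne_of_nodup (x := z) hnd fun o => by
    cases o
    · exact ⟨⟨z, false, εz⟩, by simp, rfl⟩
    · exact ⟨⟨z, true, εz⟩, by simp, rfl⟩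
  refine ⟨?_, ?_, fun l h => hz l (by simp [h]), fun l h => hz l (by simp [h]),
    fun l h => hz l (by simp [h])⟩
  · rintro rfl
    simp at hnd
  · rintro rfl
    simp at hnd

theorem perm_reidemeister3 (u v w : List GaussLetter) {p₁ p₂ p₃ : List GaussLetter}
    {a b c : ℤˣ} {l₁ l₂ l₃ l₄ l₅ l₆ : GaussLetter} (h₁ : p₁ = orderedPair a l₁ l₂)
    (h₂ : p₂ = orderedPair b l₃ l₄) (h₃ : p₃ = orderedPair c l₅ l₆) :
    (p₁ ++ u ++ p₂ ++ v ++ p₃ ++ w).Perm ([l₁, l₂, l₃, l₄, l₅, l₆] ++ (u ++ v ++ w)) := by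
  subst h₁ h₂ h₃
  refine List.perm_iff_count.mpr fun l => ?_
  have h1 := (orderedPair_perm a l₁ l₂).count_eq l
  have h2 := (orderedPair_perm b l₃ l₄).count_eq l
  have h3 := (orderedPair_perm c l₅ l₆).count_eq l
  simp only [List.count_append, List.count_cons, List.count_nil] at h1 h2 h3 ⊢
  omega

theorem perm_reidemeister3' (u v w : List GaussLetter) {p₁ p₂ p₃ : List GaussLetter}
    {a b c : ℤˣ} {l₁ l₂ l₃ l₄ l₅ l₆ : GaussLetter} (h₁ : p₁ = orderedPair a l₁ l₂)
    (h₂ : p₂ = orderedPair b l₃ l₄) (h₃ : p₃ = orderedPair c l₅ l₆) :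
    (p₁ ++ u ++ p₃ ++ v ++ p₂ ++ w).Perm ([l₁, l₂, l₃, l₄, l₅, l₆] ++ (u ++ v ++ w)) := by
  refine List.Perm.trans (List.perm_iff_count.mpr fun l => ?_)
    (perm_reidemeister3 u v w h₁ h₂ h₃)
  simp only [List.count_append]
  omega

/-- Each of the three strands leaves the triangle with the same color as before the move, so the
arcs outside it keep their colors and only the color at z needs correction. -/
theorem updateColor_movedColor_mem {B : Type*} [AddCommGroup B] [Module R B]
    {u v w : List GaussLetter} {x y z : ℕ} {εx εy εz a b c : ℤˣ}
    (h : b * εx = c * εy)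
    (hw : IsGaussWord (orderedPair a ⟨x, true, εx⟩ ⟨y, true, εy⟩ ++ u ++
          orderedPair b ⟨x, false, εx⟩ ⟨z, true, εz⟩ ++ v ++
          orderedPair c ⟨y, false, εy⟩ ⟨z, false, εz⟩ ++ w)) {f : B × (ℕ → B)}
    (hf : f ∈ colorings t B (orderedPair a ⟨x, true, εx⟩ ⟨y, true, εy⟩ ++ u ++
          orderedPair b ⟨x, false, εx⟩ ⟨z, true, εz⟩ ++ v ++
          orderedPair c ⟨y, false, εy⟩ ⟨z, false, εz⟩ ++ w)) :
    updateColor z (movedColor t B x z (b * εx)) f ∈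
      colorings t B (orderedPair (-a) ⟨x, true, εx⟩ ⟨y, true, εy⟩ ++ u ++
          orderedPair (-b) ⟨x, false, εx⟩ ⟨z, true, εz⟩ ++ v ++
          orderedPair (-c) ⟨y, false, εy⟩ ⟨z, false, εz⟩ ++ w) := by
  obtain ⟨hxz, hyz, hu, hv, hw'⟩ :=
    reidemeister3_distinct (perm_reidemeister3 u v w rfl rfl rfl) hw
  obtain ⟨h1, h2, h3⟩ := hf
  simp only [overAgree_append, passWord_append, (over_pair f.2 a x y εx εy f.1).1,
      (over_pair f.2 a x y εx εy f.1).2] at h1 h2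
  obtain ⟨⟨⟨⟨⟨⟨hx, hy⟩, hu'⟩, hm⟩, hv'⟩, -⟩, hw''⟩ := h1
  set g := (updateColor z (movedColor t B x z (b * εx)) f).2 with hg
  have hgx : g x = f.1 := by rw [hg, ← hx]; exact Function.update_of_ne hxz _ _
  have hgy : g y = f.1 := by rw [hg, ← hy]; exact Function.update_of_ne hyz _ _
  obtain ⟨hm1, hm2⟩ := move_middle_pair hxz εz hm
  have hb := move_under_pair (t := t) hyz (hx.trans hy.symm) εz h
  have hbot : ∀ s, OverAgree t g (orderedPair (-c) ⟨y, false, εy⟩ ⟨z, false, εz⟩) s := fun s => by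
    unfold orderedPair
    split_ifs <;> simp [OverAgree]
  have eu : ∀ s, passWord t g u s = passWord t f.2 u s := passWord_update_of_label_ne hu _ _
  have ev : ∀ s, passWord t g v s = passWord t f.2 v s := passWord_update_of_label_ne hv _ _
  have ew : ∀ s, passWord t g w s = passWord t f.2 w s := passWord_update_of_label_ne hw' _ _
  change OverAgree t g (orderedPair (-b) _ _) _ at hm1
  change passWord t g (orderedPair (-b) _ _) _ = _ at hm2
  change ∀ s, passWord t g (orderedPair (-c) _ _) s = _ at hb
  refine ⟨?_, ?_, fun d hd => ?_⟩
  · change OverAgree t g _ f.1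
    simp only [overAgree_append, passWord_append, (over_pair g (-a) x y εx εy f.1).1,
      (over_pair g (-a) x y εx εy f.1).2, eu, ev, hm2, hb]
    exact ⟨⟨⟨⟨⟨⟨hgx, hgy⟩, (overAgree_update_of_label_ne hu _ _ _).mpr hu'⟩, hm1⟩,
      (overAgree_update_of_label_ne hv _ _ _).mpr hv'⟩, hbot _⟩,
      (overAgree_update_of_label_ne hw' _ _ _).mpr hw''⟩
  · change passWord t g _ f.1 = f.1
    simp only [passWord_append, (over_pair g (-a) x y εx εy f.1).2, eu, ev, ew, hm2, hb]
    exact h2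
  · have hd' := fun l => hd l ∘ (perm_reidemeister3 u v w rfl rfl rfl).mem_iff.mpr
    change g d = 0
    rw [hg]
    refine (Function.update_of_ne (fun h => hd' ⟨z, true, εz⟩ (by simp) h.symm) _ _).trans
      (h3 d fun l hl => hd' l ?_)
    exact (perm_reidemeister3 u v w rfl rfl rfl).mem_iff.mp hl

theorem updateColor_movedColor_mem' {B : Type*} [AddCommGroup B] [Module R B]
    {u v w : List GaussLetter} {x y z : ℕ} {εx εy εz a b c : ℤˣ}
    (h : b * εx = c * εy)
    (hw : IsGaussWord (orderedPair a ⟨x, true, εx⟩ ⟨y, true, εy⟩ ++ u ++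
          orderedPair c ⟨y, false, εy⟩ ⟨z, false, εz⟩ ++ v ++
          orderedPair b ⟨x, false, εx⟩ ⟨z, true, εz⟩ ++ w)) {f : B × (ℕ → B)}
    (hf : f ∈ colorings t B (orderedPair a ⟨x, true, εx⟩ ⟨y, true, εy⟩ ++ u ++
          orderedPair c ⟨y, false, εy⟩ ⟨z, false, εz⟩ ++ v ++
          orderedPair b ⟨x, false, εx⟩ ⟨z, true, εz⟩ ++ w)) :
    updateColor z (movedColor t B x z (b * εx)) f ∈
      colorings t B (orderedPair (-a) ⟨x, true, εx⟩ ⟨y, true, εy⟩ ++ u ++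
          orderedPair (-c) ⟨y, false, εy⟩ ⟨z, false, εz⟩ ++ v ++
          orderedPair (-b) ⟨x, false, εx⟩ ⟨z, true, εz⟩ ++ w) := by
  obtain ⟨hxz, hyz, hu, hv, hw'⟩ := reidemeister3_distinct (perm_reidemeister3' u v w rfl rfl rfl) hw
  obtain ⟨h1, h2, h3⟩ := hf
  simp only [overAgree_append, passWord_append, (over_pair f.2 a x y εx εy f.1).1,
      (over_pair f.2 a x y εx εy f.1).2] at h1 h2
  obtain ⟨⟨⟨⟨⟨⟨hx, hy⟩, hu'⟩, -⟩, hv'⟩, hm⟩, hw''⟩ := h1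
  set g := (updateColor z (movedColor t B x z (b * εx)) f).2 with hg
  have hgx : g x = f.1 := by rw [hg, ← hx]; exact Function.update_of_ne hxz _ _
  have hgy : g y = f.1 := by rw [hg, ← hy]; exact Function.update_of_ne hyz _ _
  obtain ⟨hm1, hm2⟩ := move_middle_pair hxz εz hm
  have hb := move_under_pair (t := t) hyz (hx.trans hy.symm) εz h
  have hbot : ∀ s, OverAgree t g (orderedPair (-c) ⟨y, false, εy⟩ ⟨z, false, εz⟩) s := fun s => by
    unfold orderedPair
    split_ifs <;> simp [OverAgree]
  have eu : ∀ s, passWord t g u s = passWord t f.2 u s := passWord_update_of_label_ne hu _ _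
  have ev : ∀ s, passWord t g v s = passWord t f.2 v s := passWord_update_of_label_ne hv _ _
  have ew : ∀ s, passWord t g w s = passWord t f.2 w s := passWord_update_of_label_ne hw' _ _
  change OverAgree t g (orderedPair (-b) _ _) _ at hm1
  change passWord t g (orderedPair (-b) _ _) _ = _ at hm2
  change ∀ s, passWord t g (orderedPair (-c) _ _) s = _ at hb
  refine ⟨?_, ?_, fun d hd => ?_⟩
  · change OverAgree t g _ f.1
    simp only [overAgree_append, passWord_append, (over_pair g (-a) x y εx εy f.1).1,
      (over_pair g (-a) x y εx εy f.1).2, eu, ev, hm2, hb]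
    exact ⟨⟨⟨⟨⟨⟨hgx, hgy⟩, (overAgree_update_of_label_ne hu _ _ _).mpr hu'⟩, hbot _⟩,
      (overAgree_update_of_label_ne hv _ _ _).mpr hv'⟩, hm1⟩,
      (overAgree_update_of_label_ne hw' _ _ _).mpr hw''⟩
  · change passWord t g _ f.1 = f.1
    simp only [passWord_append, (over_pair g (-a) x y εx εy f.1).2, eu, ev, ew, hm2, hb]
    exact h2
  · have hd' := fun l => hd l ∘ (perm_reidemeister3' u v w rfl rfl rfl).mem_iff.mpr
    change g d = 0
    rw [hg]
    refine (Function.update_of_ne (fun h => hd' ⟨z, true, εz⟩ (by simp) h.symm) _ _).trans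
      (h3 d fun l hl => hd' l ?_)
    exact (perm_reidemeister3' u v w rfl rfl rfl).mem_iff.mp hl

theorem updateColor_movedColor_mapPair {B B' : Type*} [AddCommGroup B] [Module R B]
    [AddCommGroup B'] [Module R B'] (f : B →ₗ[R] B') (x z : ℕ) (δ : ℤˣ) (y : B × (ℕ → B)) :
    updateColor z (movedColor t B' x z δ) (mapPair f y)
      = mapPair f (updateColor z (movedColor t B x z δ) y) :=
  updateColor_mapPair f z (fun y => by
    rw [movedColor_apply, movedColor_apply, map_add, map_smul, map_smul]
    rfl) y

theorem nonempty_coloringEquiv_of_gaussMove (t : Rˣ) {w w' : List GaussLetter} (hw : IsGaussWord w)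
    (hw' : IsGaussWord w') (h : GaussMove w w') : Nonempty (ColoringEquiv t w w') := by
  cases h with
  | rotate u v => exact ⟨.rotate t u v⟩
  | relabel f hf => exact ⟨.relabel t f hf w⟩
  | reidemeister1 _ x o ε => exact ⟨.reidemeister1 t hw'⟩
  | reidemeister2 u v x y ε d => exact ⟨.reidemeister2 t hw'⟩
  | reidemeister3 u v w x y z εx εy εz a b c h₁ h₂ =>
    obtain ⟨hxz, -⟩ := reidemeister3_distinct (perm_reidemeister3 u v w rfl rfl rfl) hw
    -- The inverse of a third Reidemeister move is such a move with all three orders reversed, so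
    -- the inverse map on colorings has the same form.
    have h₃ : -b * εx = -c * εy := by rw [neg_mul, neg_mul, h₁]
    refine ⟨.mk' (fun B _ _ => updateColor z (movedColor t B x z (b * εx)))
      (fun B _ _ => updateColor z (movedColor t B x z (-b * εx))) (fun B _ _ y hy => ⟨?_, ?_⟩)
      (fun B _ _ y hy => ⟨?_, ?_⟩) fun B B' _ _ _ _ f y => updateColor_movedColor_mapPair f x z _ y⟩
    · exact updateColor_movedColor_mem h₁ hw hy
    · rw [neg_mul]
      exact update_movedColor_comp hxz _ y
    · simpa only [neg_neg] using updateColor_movedColor_mem h₃ hw' hy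
    · simpa only [neg_mul, neg_neg] using update_movedColor_comp (t := t) hxz (-(b * εx)) y
  | reidemeister3' u v w x y z εx εy εz a b c h₁ h₂ =>
    obtain ⟨hxz, -⟩ := reidemeister3_distinct (perm_reidemeister3' u v w rfl rfl rfl) hw
    have h₃ : -b * εx = -c * εy := by rw [neg_mul, neg_mul, h₁]
    refine ⟨.mk' (fun B _ _ => updateColor z (movedColor t B x z (b * εx)))
      (fun B _ _ => updateColor z (movedColor t B x z (-b * εx))) (fun B _ _ y hy => ⟨?_, ?_⟩)
      (fun B _ _ y hy => ⟨?_, ?_⟩) fun B B' _ _ _ _ f y => updateColor_movedColor_mapPair f x z _ y⟩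
    · exact updateColor_movedColor_mem' h₁ hw hy
    · rw [neg_mul]
      exact update_movedColor_comp hxz _ y
    · simpa only [neg_neg] using updateColor_movedColor_mem' h₃ hw' hy
    · simpa only [neg_mul, neg_neg] using update_movedColor_comp (t := t) hxz (-(b * εx)) y

theorem nonempty_coloringEquiv_of_toVirtualKnot_eq (t : Rˣ) {w w' : GaussCode}
    (h : w.toVirtualKnot = w'.toVirtualKnot) : Nonempty (ColoringEquiv t w.1 w'.1) := by
  replace h := Quot.eqvGen_exact h
  induction h with
  | rel w w' h => exact nonempty_coloringEquiv_of_gaussMove t w.2 w'.2 h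
  | refl w => exact ⟨.refl _⟩
  | symm w w' _ ih => exact (ih).map .symm
  | trans w w' w'' _ _ ih ih' => exact ih.elim fun e => ih'.map e.trans

end Moves

/-! ### Colorings as periodic sequences of short arc colors. -/

section Sequence

variable {R : Type*} [CommRing R] (t : Rˣ)

/-- The letter of a word at a position modulo its length. -/
def letterAt (w : List GaussLetter) (m : ℕ) : GaussLetter :=
  w.getD (m % w.length) ⟨0, true, 1⟩

/-- The position of the over-crossing letter with label `c`. -/
def overIndex (w : List GaussLetter) (c : ℕ) : ℕ :=
  w.findIdx fun l => l.isOver && l.label == c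

/-- The coefficient of the recurrence for the colors of the short arcs at a letter. -/
def letterCoeff (l : GaussLetter) : R :=
  if l.isOver then 1 else ((t ^ (-(l.sign : ℤ)) : Rˣ) : R)

/-- The colorings of a Gauss code, as sequences of the colors of its short arcs. -/
abbrev arcColorings (B : Type*) [AddCommGroup B] [Module R B] (w : List GaussLetter) :
    Submodule R (ℕ → B) :=
  cyclicSolutions B w.length 1 (fun m => letterCoeff t (letterAt w m))
    fun m => overIndex w (letterAt w m).label

theorem letterAt_of_lt {w : List GaussLetter} {i : ℕ} (hi : i < w.length) : letterAt w i = w[i] := by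
  rw [letterAt, Nat.mod_eq_of_lt hi, List.getD_eq_getElem _ _ hi]

theorem IsGaussWord.overIndex_eq {w : List GaussLetter} (hw : IsGaussWord w) {i : ℕ}
    (hi : i < w.length) (ho : w[i].isOver = true) : overIndex w w[i].label = i := by
  have hlt : overIndex w w[i].label < w.length :=
    List.findIdx_lt_length_of_exists ⟨w[i], List.getElem_mem hi, by simp [ho]⟩
  have hspec := List.findIdx_getElem (w := hlt)
  simp only [Bool.and_eq_true, beq_iff_eq] at hspec
  have := (List.Nodup.getElem_inj_iff hw.1 (i := overIndex w w[i].label) (j := i)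
    (hi := by simpa using hlt) (hj := by simpa using hi)).mp
    (by simp only [List.getElem_map]; exact Prod.ext hspec.2 (hspec.1.trans ho.symm))
  exact this

theorem IsGaussWord.overIndex_lt {w : List GaussLetter} (hw : IsGaussWord w) {l : GaussLetter}
    (hl : l ∈ w) : overIndex w l.label < w.length := by
  refine List.findIdx_lt_length_of_exists ?_
  by_cases h : l.isOver = true
  · exact ⟨l, hl, by simp [h]⟩
  · exact ⟨_, hw.2 l hl, by simp [h]⟩

theorem getElem_overIndex {w : List GaussLetter} {c : ℕ} (h : overIndex w c < w.length) :
    w[overIndex w c].isOver = true ∧ w[overIndex w c].label = c := by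
  have := List.findIdx_getElem (w := h)
  simp only [Bool.and_eq_true, beq_iff_eq] at this
  exact this

section Equiv

variable {B : Type*} [AddCommGroup B] [Module R B]

theorem passWord_take_succ (g : ℕ → B) {w : List GaussLetter} {i : ℕ} (hi : i < w.length) (a : B) :
    passWord t g (w.take (i + 1)) a = passLetter t g w[i] (passWord t g (w.take i) a) := by
  rw [← List.take_append_getElem hi, passWord_append]
  rfl

theorem overAgree_iff (g : ℕ → B) (w : List GaussLetter) (a : B) : OverAgree t g w a ↔
    ∀ i (hi : i < w.length), w[i].isOver = true → g w[i].label = passWord t g (w.take i) a := by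
  have key : ∀ k ≤ w.length, OverAgree t g (w.take k) a ↔
      ∀ i (hi : i < w.length), i < k → w[i].isOver = true →
        g w[i].label = passWord t g (w.take i) a := by
    intro k
    induction k with
    | zero => simp [OverAgree]
    | succ k ih =>
      intro hk
      rw [← List.take_append_getElem (show k < w.length from hk), overAgree_append, ih (by omega)]
      simp only [OverAgree, and_true]
      constructor
      · rintro ⟨h1, h2⟩ i hi hik
        rcases Nat.lt_succ_iff_lt_or_eq.mp hik with h | rfl
        exacts [h1 i hi h, h2]
      · exact fun h => ⟨fun i hi hik => h i hi (by omega), h k hk (by omega)⟩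
  have := key w.length le_rfl
  rw [List.take_length] at this
  rw [this]
  exact ⟨fun h i hi => h i hi hi, fun h i hi _ => h i hi⟩

theorem passLetter_eq_letterCoeff {g : ℕ → B} {l : GaussLetter} {a : B} :
    passLetter t g l a = letterCoeff t l • a + (1 - letterCoeff t l : R) • g l.label := by
  unfold passLetter letterCoeff
  split_ifs <;> simp

theorem apply_mod_of_mem {L : ℕ} {c : ℕ → R} {par : ℕ → ℕ} {x : ℕ → B}
    (hx : x ∈ cyclicSolutions B L 1 c par) (m : ℕ) : x (m % L) = x m := by
  have h : Function.Periodic x L := fun m => by simpa using hx.1 m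
  exact h.map_mod_nat m

theorem mem_arcColorings_iff {w : List GaussLetter} {x : ℕ → B} :
    x ∈ arcColorings t B w ↔ (∀ m, x (m + w.length) = x m) ∧ ∀ i (hi : i < w.length),
      x (i + 1) = letterCoeff t w[i] • x i
        + (1 - letterCoeff t w[i] : R) • x (overIndex w w[i].label) := by
  constructor
  · rintro ⟨h1, h2⟩
    refine ⟨by simpa using h1, fun i hi => ?_⟩
    simpa [letterAt_of_lt hi] using h2 i hi 0
  · rintro ⟨h1, h2⟩
    have h3 : ∀ m s, x (m + s * w.length) = x m := fun m s => by
      have := Function.Periodic.nat_mul h1 s m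
      simpa using this
    refine ⟨by simpa using h1, fun i hi s => ?_⟩
    simp only [h3, letterAt_of_lt hi, h2 i hi]

/-- The colors of the short arcs determined by the colors of the first arc and of the
over-crossing arcs. -/
def shortArcColors (w : List GaussLetter) : B × (ℕ → B) →ₗ[R] ℕ → B where
  toFun y m := passWord t y.2 (w.take (m % w.length)) y.1
  map_add' _ _ := funext fun _ => passWord_add t _ _ _ _ _
  map_smul' _ _ := funext fun _ => passWord_smul t _ _ _ _

/-- The color of the first arc and the colors of the over-crossing arcs. -/
def overArcColors (R : Type*) [CommRing R] {B : Type*} [AddCommGroup B] [Module R B]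
    (w : List GaussLetter) : (ℕ → B) →ₗ[R] B × (ℕ → B) where
  toFun x := (x 0, fun c => if overIndex w c < w.length then x (overIndex w c) else 0)
  map_add' x y := by
    refine Prod.ext rfl (funext fun c => ?_)
    simp only [Prod.snd_add, Pi.add_apply]
    split_ifs <;> simp
  map_smul' r x := by
    refine Prod.ext rfl (funext fun c => ?_)
    simp only [Prod.smul_snd, Pi.smul_apply, RingHom.id_apply]
    split_ifs <;> simp

/-- The short arc that arrives at a position has the color reached after the preceding letters.
Agreement at the over-letters turns the over-colors in these passages into entries of the sequence
itself, which gives the recurrences. -/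
theorem shortArcColors_mem {w : List GaussLetter} (hw : IsGaussWord w) (hpos : 0 < w.length)
    {y : B × (ℕ → B)} (hy : y ∈ colorings t B w) :
    shortArcColors t w y ∈ arcColorings t B w ∧ overArcColors R w (shortArcColors t w y) = y := by
  obtain ⟨h1, h2, h3⟩ := hy
  rw [overAgree_iff] at h1
  have hval : ∀ i ≤ w.length, shortArcColors t w y i = passWord t y.2 (w.take i) y.1 := by
    intro i hi
    change passWord t y.2 (w.take (i % w.length)) y.1 = _
    rcases hi.lt_or_eq with h | rfl
    · rw [Nat.mod_eq_of_lt h]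
    · rw [Nat.mod_self, List.take_length, h2, List.take_zero, passWord]
  have hover : ∀ c, overIndex w c < w.length →
      shortArcColors t w y (overIndex w c) = y.2 c := fun c hc => by
    rw [hval _ hc.le, ← h1 _ hc (getElem_overIndex hc).1, (getElem_overIndex hc).2]
  refine ⟨(mem_arcColorings_iff t).mpr ⟨fun m => ?_, fun i hi => ?_⟩, Prod.ext ?_ ?_⟩
  · change passWord t y.2 (w.take ((m + w.length) % w.length)) y.1 = _
    rw [Nat.add_mod_right]
    rfl
  · rw [hval _ hi, passWord_take_succ t _ hi, passLetter_eq_letterCoeff, hval i hi.le,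
      hover _ (hw.overIndex_lt (List.getElem_mem hi))]
  · exact (hval 0 hpos.le).trans (by simp [passWord])
  · ext c
    change (if _ then _ else _) = _
    split_ifs with hc
    · exact hover c hc
    · refine (h3 c fun l hl hlc => hc ?_).symm
      rw [← hlc]
      exact hw.overIndex_lt hl

theorem overArcColors_mem {w : List GaussLetter} (hw : IsGaussWord w) (hpos : 0 < w.length)
    {x : ℕ → B} (hx : x ∈ arcColorings t B w) :
    overArcColors R w x ∈ colorings t B w ∧ shortArcColors t w (overArcColors R w x) = x := by
  have hmod := apply_mod_of_mem hx
  obtain ⟨h1, h2⟩ := (mem_arcColorings_iff t).mp hx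
  have hover : ∀ i (hi : i < w.length), (overArcColors R w x).2 w[i].label
      = x (overIndex w w[i].label) := fun i hi =>
    if_pos (hw.overIndex_lt (List.getElem_mem hi))
  have hpass : ∀ i ≤ w.length,
      passWord t (overArcColors R w x).2 (w.take i) (overArcColors R w x).1 = x i := by
    intro i hi
    induction i with
    | zero => simp [passWord, overArcColors]
    | succ i ih =>
      rw [passWord_take_succ t _ hi, ih (by omega), passLetter_eq_letterCoeff, hover i hi, h2 i hi]
  refine ⟨⟨?_, ?_, fun c hc => ?_⟩, ?_⟩
  · rw [overAgree_iff]
    intro i hi ho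
    rw [hover i hi, hpass i hi.le, hw.overIndex_eq hi ho]
  · have h3 := hpass _ le_rfl
    rw [List.take_length] at h3
    rw [h3, ← zero_add w.length, h1]
    rfl
  · refine if_neg fun hlt => ?_
    exact hc _ (List.getElem_mem hlt) (getElem_overIndex hlt).2
  · ext m
    change passWord t _ (w.take (m % w.length)) _ = _
    rw [hpass _ (Nat.mod_lt _ hpos).le, hmod]

/-- The colors of the short arcs, as an equivalence. -/
def colorings.arcEquiv {w : List GaussLetter} (hw : IsGaussWord w) (hpos : 0 < w.length) :
    colorings t B w ≃ₗ[R] arcColorings t B w :=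
  LinearEquiv.ofLinearMap
    ((shortArcColors t w).restrict fun _ hx => (shortArcColors_mem t hw hpos hx).1)
    ((overArcColors R w).restrict fun _ hx => (overArcColors_mem t hw hpos hx).1)
    (by ext1 x; exact Subtype.ext (overArcColors_mem t hw hpos x.2).2)
    (by ext1 x; exact Subtype.ext (shortArcColors_mem t hw hpos x.2).2)

end Equiv

end Sequence

/-! ### Colorings and the Jacobian matrix -/

section Jacobian

/-- The number of under-crossing letters before a position. -/
def underCount (w : List GaussLetter) (i : ℕ) : ℕ :=
  (w.take i).countP fun l => !l.isOver

theorem underCount_succ {w : List GaussLetter} {i : ℕ} (hi : i < w.length) :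
    underCount w (i + 1) = underCount w i + if w[i].isOver then 0 else 1 := by
  rw [underCount, ← List.take_append_getElem hi, List.countP_append, ← underCount]
  by_cases h : w[i].isOver = true <;> simp [h]

theorem underCount_le_underCount (w : List GaussLetter) {i j : ℕ} (h : i ≤ j) :
    underCount w i ≤ underCount w j :=
  (List.take_sublist_take_left h).countP_le

theorem GaussCode.underCount_length (w : GaussCode) :
    underCount w.1 w.1.length = w.unders.length := by
  rw [underCount, List.take_length, List.countP_eq_length_filter]
  rfl

theorem GaussCode.underCount_lt (w : GaussCode) {i : ℕ} (hi : i < w.1.length)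
    (hu : w.1[i].isOver = false) : underCount w.1 i < w.unders.length := by
  have h := underCount_le_underCount w.1 (show i + 1 ≤ w.1.length from hi)
  rw [underCount_succ hi, w.underCount_length, hu] at h
  simpa using h

theorem GaussCode.unders_underCount (w : GaussCode) {i : ℕ} (hi : i < w.1.length)
    (hu : w.1[i].isOver = false) :
    w.unders[underCount w.1 i]'(w.underCount_lt hi hu) = w.1[i] := by
  have h : w.unders = (w.1.take i).filter (fun l => !l.isOver)
      ++ w.1[i] :: (w.1.drop (i + 1)).filter (fun l => !l.isOver) := by
    rw [GaussCode.unders]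
    conv_lhs => rw [← List.take_append_drop i w.1, List.drop_eq_getElem_cons hi]
    rw [List.filter_append, List.filter_cons_of_pos (by simp [hu])]
  have h2 : underCount w.1 i = ((w.1.take i).filter (fun l => !l.isOver)).length := by
    rw [underCount, List.countP_eq_length_filter]
  simp only [h, h2]
  rw [List.getElem_append_right le_rfl]
  simp

theorem GaussCode.exists_underCount_eq (w : GaussCode) {k : ℕ} (hk : k < w.unders.length) :
    ∃ i, ∃ hi : i < w.1.length, w.1[i].isOver = false ∧ underCount w.1 i = k := by
  have key : ∀ m ≤ w.1.length, k < underCount w.1 m →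
      ∃ i, ∃ hi : i < w.1.length, w.1[i].isOver = false ∧ underCount w.1 i = k := by
    intro m
    induction m with
    | zero => intro _ h; simp [underCount] at h
    | succ m ih =>
      intro hm h
      rw [underCount_succ hm] at h
      by_cases h' : k < underCount w.1 m
      · exact ih (by omega) h'
      · refine ⟨m, hm, ?_, ?_⟩
        · by_contra hc
          rw [Bool.not_eq_false] at hc
          simp [hc] at h
          omega
        · split_ifs at h <;> omega
  exact key _ le_rfl (by rwa [w.underCount_length])

theorem GaussCode.overArc_eq (w : GaussCode) {l : GaussLetter} (hl : l ∈ w.1) :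
    w.overArc l = underCount w.1 (overIndex w.1 l.label) % w.unders.length := by
  have hmem : (⟨l.label, true, l.sign⟩ : GaussLetter) ∈ w.1 := by
    by_cases h : l.isOver = true
    · convert hl; exact h.symm
    · have := w.2.2 l hl
      rw [Bool.not_eq_true] at h
      rwa [h] at this
  obtain ⟨i, hi, hil⟩ := List.getElem_of_mem hmem
  have h1 : overIndex w.1 l.label = i := by
    have := w.2.overIndex_eq hi (by rw [hil])
    rwa [hil] at this
  have h2 : (w.1.takeWhile fun m => decide (m ≠ ⟨l.label, true, l.sign⟩)) = w.1.take i := by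
    have hnd : w.1.Nodup := List.Nodup.of_map _ w.2.1
    conv_lhs => rw [← List.take_append_drop i w.1, List.drop_eq_getElem_cons hi]
    rw [List.takeWhile_append_of_pos, List.takeWhile_cons_of_neg, List.append_nil]
    · simp [hil]
    · intro a ha
      obtain ⟨j, hj, rfl⟩ := List.getElem_of_mem ha
      have hj' : j < i := by
        rw [List.length_take] at hj
        omega
      simp only [List.getElem_take, decide_eq_true_eq, ne_eq, ← hil]
      rw [hnd.getElem_inj_iff]
      omega
  rw [GaussCode.overArc, h2, h1]
  rfl

variable {R : Type*} [CommRing R] {B : Type*} [AddCommGroup B] [Module R B]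

/-- The three entries of a row are added as separate indicator terms, so the formula holds even when
some of the three arcs coincide. -/
theorem GaussCode.sum_jacobian_smul (w : GaussCode) (f : ℤ[T;T⁻¹] →+* R)
    (X : Fin w.unders.length → B) (i : Fin w.unders.length) :
    ∑ j, f (w.jacobian i j) • X j
      = f (LaurentPolynomial.T (-((w.unders.get i).sign : ℤ))) • X i
        - X ⟨(i + 1) % w.unders.length, Nat.mod_lt _ i.pos⟩
        + (1 - f (LaurentPolynomial.T (-((w.unders.get i).sign : ℤ)))) •
          X ⟨w.overArc (w.unders.get i), Nat.mod_lt _ i.pos⟩ := by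
  have h : ∀ (k : Fin w.unders.length) (m : ℕ), m = (k : ℕ) →
      ∀ a : R, ∑ j : Fin w.unders.length, (if (j : ℕ) = m then a else 0) • X j = a • X k := by
    rintro k _ rfl a
    simp [← Fin.ext_iff, ite_smul]
  simp only [GaussCode.jacobian, map_add, apply_ite f, map_zero, map_neg, map_one, map_sub,
    add_smul, Finset.sum_add_distrib, Fin.ext_iff (n := w.unders.length)]
  rw [h i i rfl, h ⟨(i + 1) % w.unders.length, Nat.mod_lt _ i.pos⟩ _ rfl,
    h ⟨w.overArc (w.unders.get i), Nat.mod_lt _ i.pos⟩ _ rfl, neg_one_smul, ← sub_eq_add_neg]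

/-- The colors of the short arcs, in terms of those of the long arcs. -/
def longArcColors (R : Type*) [CommRing R] {B : Type*} [AddCommGroup B] [Module R B] (w : GaussCode)
    (hn : 0 < w.unders.length) : (Fin w.unders.length → B) →ₗ[R] ℕ → B where
  toFun X m := X ⟨underCount w.1 (m % w.1.length) % w.unders.length, Nat.mod_lt _ hn⟩
  map_add' _ _ := rfl
  map_smul' _ _ := rfl

theorem GaussCode.length_pos (w : GaussCode) (hn : 0 < w.unders.length) : 0 < w.1.length :=
  hn.trans_le (List.length_filter_le _ _)

theorem GaussCode.longArcColors_apply (w : GaussCode) (hn : 0 < w.unders.length)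
    (X : Fin w.unders.length → B) {i : ℕ} (hi : i ≤ w.1.length) : longArcColors R w hn X i
      = X ⟨underCount w.1 i % w.unders.length, Nat.mod_lt _ hn⟩ := by
  change X _ = X _
  rcases hi.lt_or_eq with h | rfl
  · simp only [Nat.mod_eq_of_lt h]
  · simp only [Nat.mod_self, w.underCount_length]
    simp [underCount]

theorem GaussCode.longArcColors_injective (w : GaussCode) (hn : 0 < w.unders.length) :
    Function.Injective (longArcColors R (B := B) w hn) := by
  intro X Y h
  ext k
  obtain ⟨i, hi, -, hik⟩ := w.exists_underCount_eq k.2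
  have := congrFun h i
  rw [w.longArcColors_apply hn X hi.le, w.longArcColors_apply hn Y hi.le] at this
  simpa only [hik, Nat.mod_eq_of_lt k.2] using this

theorem GaussCode.longArcColors_mem (w : GaussCode) (hn : 0 < w.unders.length)
    (f : ℤ[T;T⁻¹] →+* R) (t : Rˣ) (hf : ∀ n : ℤ, f (LaurentPolynomial.T n) = (t ^ n : Rˣ))
    {X : Fin w.unders.length → B} (hX : ∀ i, ∑ j, f (w.jacobian i j) • X j = 0) :
    longArcColors R w hn X ∈ arcColorings t B w.1 := by
  refine (mem_arcColorings_iff t).mpr ⟨fun m => ?_, fun i hi => ?_⟩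
  · change X _ = X _
    simp only [Nat.add_mod_right]
  · rw [w.longArcColors_apply hn X hi, w.longArcColors_apply hn X hi.le]
    by_cases ho : w.1[i].isOver = true
    · simp only [underCount_succ hi, ho, if_true, add_zero, letterCoeff, one_smul, sub_self,
        zero_smul]
    · rw [Bool.not_eq_true] at ho
      have h1 := hX ⟨underCount w.1 i, w.underCount_lt hi ho⟩
      rw [w.sum_jacobian_smul, List.get_eq_getElem] at h1
      simp only [w.unders_underCount hi ho, hf, w.overArc_eq (List.getElem_mem hi)] at h1
      rw [w.longArcColors_apply hn X (w.2.overIndex_lt (List.getElem_mem hi)).le]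
      simp only [underCount_succ hi, ho, letterCoeff, Bool.false_eq_true, if_false,
        Nat.mod_eq_of_lt (w.underCount_lt hi ho)]
      rw [sub_add_eq_add_sub, sub_eq_zero] at h1
      exact h1.symm

/-- A solution is constant along over-letters, so it depends only on the number of undercrossings
passed, that is, on the long arc. The recurrences at the undercrossings are then the rows of the
Jacobian. -/
theorem GaussCode.exists_longArcColors_eq (w : GaussCode) (hn : 0 < w.unders.length)
    (f : ℤ[T;T⁻¹] →+* R) (t : Rˣ) (hf : ∀ n : ℤ, f (LaurentPolynomial.T n) = (t ^ n : Rˣ))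
    {x : ℕ → B} (hx : x ∈ arcColorings t B w.1) :
    ∃ X : Fin w.unders.length → B, (∀ i, ∑ j, f (w.jacobian i j) • X j = 0) ∧
      longArcColors R w hn X = x := by
  have hmod := apply_mod_of_mem hx
  obtain ⟨h1, h2⟩ := (mem_arcColorings_iff t).mp hx
  have hconst : ∀ i j, i ≤ j → j ≤ w.1.length → underCount w.1 i = underCount w.1 j →
      x i = x j := by
    intro i j hij
    induction j, hij using Nat.le_induction with
    | base => intros; rfl
    | succ j hij ih =>
      intro hj hc
      have h3 := underCount_le_underCount w.1 hij
      rw [underCount_succ hj] at hc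
      by_cases ho : w.1[j].isOver = true
      · rw [ih (by omega) (by rw [hc]; simp [ho]), h2 j hj]
        simp [letterCoeff, ho]
      · simp only [ho, Bool.false_eq_true, if_false] at hc
        omega
  -- The representative of the long arc k is the short arc that arrives at its terminating
  -- undercrossing.
  choose pos hpos hover hcount using fun k : Fin w.unders.length => w.exists_underCount_eq k.2
  let X : Fin w.unders.length → B := fun k => x (pos k)
  have hX : ∀ i ≤ w.1.length,
      X ⟨underCount w.1 i % w.unders.length, Nat.mod_lt _ hn⟩ = x i := by
    intro i hi
    have h3 := underCount_le_underCount w.1 hi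
    rw [w.underCount_length] at h3
    have h4 := hcount ⟨underCount w.1 i % w.unders.length, Nat.mod_lt _ hn⟩
    set k : Fin w.unders.length := ⟨underCount w.1 i % w.unders.length, Nat.mod_lt _ hn⟩ with hk
    rcases h3.lt_or_eq with h | h
    · have h5 : underCount w.1 (pos k) = underCount w.1 i := by
        rw [h4, hk]
        exact Nat.mod_eq_of_lt h
      rcases le_total (pos k) i with h6 | h6
      · exact hconst _ _ h6 hi h5
      · exact (hconst _ _ h6 (hpos k).le h5.symm).symm
    -- Behind the last undercrossing the count is n, which is 0 modulo n: the final long arc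
    -- continues through the basepoint as the arc 0.
    · have h5 : underCount w.1 0 = underCount w.1 (pos k) := by
        rw [h4, hk]
        change _ = underCount w.1 i % _
        rw [h, Nat.mod_self]
        simp [underCount]
      have h6 := hconst i w.1.length hi le_rfl (by rw [w.underCount_length, h])
      change x (pos k) = x i
      rw [h6, ← hconst 0 _ (Nat.zero_le _) (hpos k).le h5, ← h1 0, zero_add]
  refine ⟨X, fun k => ?_, ?_⟩
  · have h5 : w.unders.get k = w.1[pos k]'(hpos k) := by
      rw [List.get_eq_getElem, ← w.unders_underCount (hpos k) (hover k)]
      simp only [hcount k]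
    have h6 := h2 _ (hpos k)
    have hmem : w.1[pos k]'(hpos k) ∈ w.1 := List.getElem_mem _
    rw [w.sum_jacobian_smul, h5, hf]
    have h7 : X ⟨w.overArc (w.1[pos k]'(hpos k)), Nat.mod_lt _ k.pos⟩
        = x (overIndex w.1 (w.1[pos k]'(hpos k)).label) := by
      simp only [w.overArc_eq hmem]
      exact hX _ (w.2.overIndex_lt hmem).le
    have h8 : X ⟨(k + 1) % w.unders.length, Nat.mod_lt _ k.pos⟩ = x (pos k + 1) := by
      rw [← hX _ (hpos k)]
      simp only [underCount_succ (hpos k), hover k, hcount k, Bool.false_eq_true, if_false]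
    rw [h7, h8, h6]
    simp only [letterCoeff, hover k, Bool.false_eq_true, if_false, X]
    abel
  · ext m
    rw [← hmod m]
    exact hX _ (Nat.mod_lt _ (w.length_pos hn)).le

end Jacobian

/-! ### Quotients of the ring of Laurent polynomials -/

/-- The algebra k[X]/(g) has dimension deg g and maps onto the Laurent quotient. Only an inequality
is claimed, since X may divide g. -/
theorem finrank_quotient_span_toLaurent {k : Type*} [Field k] {g : k[X]} (hg : g ≠ 0) :
    Module.Finite k (k[T;T⁻¹] ⧸ Ideal.span {Polynomial.toLaurent g}) ∧
      Module.finrank k (k[T;T⁻¹] ⧸ Ideal.span {Polynomial.toLaurent g}) ≤ g.natDegree := by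
  set I : Ideal k[T;T⁻¹] := Ideal.span {Polynomial.toLaurent g}
  let φ : AdjoinRoot g →ₐ[k] k[T;T⁻¹] ⧸ I :=
    AdjoinRoot.liftAlgHom g ((Ideal.Quotient.mkₐ k I).comp (Algebra.ofId k _))
      (Ideal.Quotient.mk I (LaurentPolynomial.T 1)) <| by
    have h : ∀ f : k[X], f.eval₂ (((Ideal.Quotient.mkₐ k I).comp (Algebra.ofId k _)) : k →+* _)
        (Ideal.Quotient.mk I (LaurentPolynomial.T 1))
        = Ideal.Quotient.mk I (Polynomial.toLaurent f) := by
      intro f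
      induction f using Polynomial.induction_on' with
      | add p q hp hq => rw [Polynomial.eval₂_add, hp, hq, map_add, map_add]
      | monomial n a =>
        rw [Polynomial.eval₂_monomial, ← Polynomial.C_mul_X_pow_eq_monomial,
          Polynomial.toLaurent_C_mul_X_pow, map_mul, ← map_pow, LaurentPolynomial.T_pow, mul_one]
        rfl
    exact (h g).trans (Ideal.Quotient.eq_zero_iff_mem.mpr (Ideal.subset_span rfl))
  have hroot : φ (AdjoinRoot.root g) = Ideal.Quotient.mk I (LaurentPolynomial.T 1) :=
    AdjoinRoot.liftAlgHom_root ..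
  have hfin : Module.Finite k (AdjoinRoot g) := (AdjoinRoot.powerBasis hg).finite
  have hrank : Module.finrank k (AdjoinRoot g) = g.natDegree := by
    rw [(AdjoinRoot.powerBasis hg).finrank, AdjoinRoot.powerBasis_dim]
  have hTinv : ∀ n : ℕ, Ideal.Quotient.mk I (LaurentPolynomial.T (-(n : ℤ))) ∈ φ.range := by
    -- Multiplication by T is injective on the image, hence surjective because the image is
    -- finite-dimensional. So the image is closed under T⁻¹.
    have hmul : ∀ x ∈ φ.range, Ideal.Quotient.mk I (LaurentPolynomial.T (-1)) * x ∈ φ.range := by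
      let m : φ.range →ₗ[k] φ.range :=
        LinearMap.mulLeft k (⟨φ (AdjoinRoot.root g), AdjoinRoot.root g, rfl⟩ : φ.range)
      have hcancel : Ideal.Quotient.mk I (LaurentPolynomial.T (-1)) * φ (AdjoinRoot.root g) = 1 := by
        rw [hroot, ← map_mul, ← LaurentPolynomial.T_add]
        simp
      have hm : Function.Injective m := by
        intro x y hxy
        have h1 : φ (AdjoinRoot.root g) * (x : k[T;T⁻¹] ⧸ I)
            = φ (AdjoinRoot.root g) * y := congrArg Subtype.val hxy
        have h2 := congrArg (Ideal.Quotient.mk I (LaurentPolynomial.T (-1)) * ·) h1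
        simp only [← mul_assoc, hcancel, one_mul] at h2
        exact Subtype.ext h2
      have hfr : Module.Finite k φ.range := Module.Finite.range φ.toLinearMap
      intro x hx
      obtain ⟨y, hy⟩ := LinearMap.injective_iff_surjective.mp hm ⟨x, hx⟩
      have h1 : φ (AdjoinRoot.root g) * (y : k[T;T⁻¹] ⧸ I) = x := congrArg Subtype.val hy
      rw [← h1, ← mul_assoc, hcancel, one_mul]
      exact y.2
    intro n
    induction n with
    | zero => simp
    | succ n ih =>
      have := hmul _ ih
      rw [← map_mul, ← LaurentPolynomial.T_add] at this
      convert this using 3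
      push_cast
      ring
  have hsurj : Function.Surjective φ := by
    intro x
    obtain ⟨x, rfl⟩ := Ideal.Quotient.mk_surjective x
    change _ ∈ φ.range
    induction x using LaurentPolynomial.induction_on' with
    | add p q hp hq => rw [map_add]; exact φ.range.add_mem hp hq
    | C_mul_T n a =>
      rw [← LaurentPolynomial.smul_eq_C_mul]
      change a • Ideal.Quotient.mk I (LaurentPolynomial.T n) ∈ φ.range
      refine φ.range.smul_mem ?_ a
      obtain ⟨m, rfl | rfl⟩ := n.eq_nat_or_neg
      · refine ⟨AdjoinRoot.root g ^ m, ?_⟩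
        change φ _ = _
        rw [map_pow, hroot, ← map_pow, LaurentPolynomial.T_pow, mul_one]
      · exact hTinv m
  exact ⟨Module.Finite.of_surjective φ.toLinearMap hsurj,
    hrank ▸ LinearMap.finrank_le_finrank_of_surjective (f := φ.toLinearMap) hsurj⟩

/-- A nilpotent endomorphism of a module that is generated by `n` elements which agree up to
torsion has a bounded order of nilpotency. -/
theorem pow_eq_zero_of_smul_sub_eq_zero {k R M : Type*} [Field k] [CommRing R] [IsDomain R]
    [Algebra k R] [AddCommGroup M] [Module R M] [Module k M] [IsScalarTower k R M] {n : ℕ}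
    {d : R} (hd : d ≠ 0) [Module.Finite k (R ⧸ Ideal.span {d})] {e : Fin n → M}
    (he : Submodule.span R (Set.range e) = ⊤) (k₀ : Fin n)
    (hek : ∀ j, d • (e j - e k₀) = 0) (ε : M →ₗ[R] R) (hε : ∀ j, ε (e j) = 1)
    (Y : Module.End R M) {q : ℕ} (hY : Y ^ q = 0) :
    Y ^ (n * Module.finrank k (R ⧸ Ideal.span {d}) + 1) = 0 := by
  -- All generators have augmentation 1 and agree with `e k₀` up to d-torsion, so after
  -- multiplication by d an element is determined by its augmentation.
  have h1 : ∀ m, d • m = (d * ε m) • e k₀ := by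
    intro m
    have hm : m ∈ Submodule.span R (Set.range e) := he ▸ Submodule.mem_top
    induction hm using Submodule.span_induction with
    | mem x hx =>
      obtain ⟨j, rfl⟩ := hx
      rw [hε, mul_one, ← sub_eq_zero, ← smul_sub, hek]
    | zero => simp
    | add x y _ _ hx hy => rw [smul_add, hx, hy, map_add, mul_add, add_smul]
    | smul a x _ hx => rw [smul_comm, hx, map_smul, smul_smul, smul_eq_mul, mul_left_comm]
  have h2 : ∀ i, d • (Y ^ i) (e k₀) = (d * ε (Y (e k₀)) ^ i) • e k₀ := by
    intro i
    induction i with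
    | zero => simp
    | succ i ih =>
      rw [pow_succ', Module.End.mul_apply, ← map_smul, ih, map_smul, mul_comm d, mul_smul, h1,
        smul_smul]
      congr 1
      ring
  -- Up to the factor d, Y acts on `e k₀` as multiplication by this scalar; nilpotency of Y makes
  -- the scalar nilpotent in a domain.
  have h3 : ε (Y (e k₀)) = 0 := by
    have h4 := congrArg ε (h2 q)
    rw [hY, LinearMap.zero_apply, smul_zero, map_zero, map_smul, hε, smul_eq_mul, mul_one] at h4
    exact eq_zero_of_pow_eq_zero ((mul_eq_zero.mp h4.symm).resolve_left hd)
  have h4 : ∀ m, d • Y m = 0 := by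
    intro m
    rw [← map_smul, h1, map_smul, mul_comm, mul_smul, h1, h3, mul_zero, zero_smul, smul_zero]
  -- The image of Y is d-torsion and generated by n elements, so it lies in the image of (R/d)^n, a
  -- finite-dimensional space.
  let ψ : (Fin n → R ⧸ Ideal.span {d}) →ₗ[k] M :=
    ∑ j, ((Submodule.liftQ (Ideal.span {d}) (LinearMap.toSpanSingleton R M (Y (e j))) (by
      rw [Ideal.span, Submodule.span_le, Set.singleton_subset_iff]
      exact h4 (e j))).restrictScalars k) ∘ₗ LinearMap.proj j
  have hψ : ∀ m, Y m ∈ LinearMap.range ψ := by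
    intro m
    have hm : m ∈ Submodule.span R (Set.range e) := he ▸ Submodule.mem_top
    obtain ⟨a, rfl⟩ := (Submodule.mem_span_range_iff_exists_fun R).mp hm
    refine ⟨fun j => Submodule.Quotient.mk (a j), ?_⟩
    simp only [ψ, LinearMap.sum_apply, map_sum, map_smul]
    exact Finset.sum_congr rfl fun j _ => rfl
  have hfin : Module.Finite k (LinearMap.range ψ) := Module.Finite.range ψ
  have hrank : Module.finrank k (LinearMap.range ψ)
      ≤ n * Module.finrank k (R ⧸ Ideal.span {d}) := by
    refine (LinearMap.finrank_range_le ψ).trans ?_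
    rw [Module.finrank_pi_fintype]
    simp
  let Z : Module.End k (LinearMap.range ψ) := (Y.restrictScalars k).restrict fun m _ => hψ m
  have hZ : ∀ i (x : LinearMap.range ψ), ((Z ^ i) x : M) = (Y ^ i) x := by
    intro i
    induction i with
    | zero => intro x; rfl
    | succ i ih =>
      intro x
      rw [pow_succ, pow_succ, Module.End.mul_apply, ih, Module.End.mul_apply]
      rfl
  have hZnil : IsNilpotent Z := ⟨q, by
    ext x
    rw [hZ, hY]
    rfl⟩
  -- A nilpotent endomorphism of a finite-dimensional space has characteristic polynomial X^dim, so
  -- Cayley-Hamilton applies. The extra +1 in the exponent is the first application of Y, which maps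
  -- M into this space.
  have hZpow : Z ^ Module.finrank k (LinearMap.range ψ) = 0 := by
    have h5 := LinearMap.aeval_self_charpoly Z
    rwa [hZnil.charpoly_eq_X_pow_finrank, map_pow, Polynomial.aeval_X] at h5
  ext m
  rw [pow_succ, Module.End.mul_apply]
  have h6 := hZ (n * Module.finrank k (R ⧸ Ideal.span {d})) ⟨Y m, hψ m⟩
  rw [pow_eq_zero_of_le hrank hZpow] at h6
  exact h6.symm

/-! ### Minors -/

/-- A nonzero minor uses n - 1 distinct columns and omits exactly one, `k₀`. As the rows sum to
zero, the differences `X j - X k₀` satisfy the same equations with the column `k₀` deleted, and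
Cramer's rule applies. -/
theorem exists_smul_sub_eq_zero_of_minor {R : Type*} [CommRing R] {n : ℕ}
    (A : Matrix (Fin n) (Fin n) R) (hA : ∀ i, ∑ j, A i j = 0) (hn : 0 < n)
    (r c : Fin (n - 1) → Fin n) (hd : (A.submatrix r c).det ≠ 0) :
    ∃ k₀, ∀ (B : Type) [AddCommGroup B] [Module R B] (X : Fin n → B),
      (∀ i, ∑ j, A i j • X j = 0) → ∀ j, (A.submatrix r c).det • (X j - X k₀) = 0 := by
  have hinj : Function.Injective c := by
    intro i j hij
    by_contra hne
    exact hd (Matrix.det_zero_of_column_eq hne fun k => by simp [hij])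
  have hcard : (Finset.univ.image c).card = n - 1 := by
    rw [Finset.card_image_of_injective _ hinj, Finset.card_univ, Fintype.card_fin]
  obtain ⟨k₀, hk₀⟩ : ∃ k₀, k₀ ∉ Finset.univ.image c := by
    by_contra! h
    have := Finset.card_le_card (fun x _ => h x : Finset.univ ⊆ Finset.univ.image c)
    rw [hcard, Finset.card_univ, Fintype.card_fin] at this
    omega
  have himage : Finset.univ.image c = Finset.univ.erase k₀ := by
    refine Finset.eq_of_subset_of_card_le (fun x hx => ?_) ?_
    · exact Finset.mem_erase.mpr ⟨fun h => hk₀ (h ▸ hx), Finset.mem_univ _⟩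
    · rw [hcard, Finset.card_erase_of_mem (Finset.mem_univ _), Finset.card_univ, Fintype.card_fin]
  refine ⟨k₀, fun B _ _ X hX j => ?_⟩
  have h1 : ∀ i, ∑ j, A i j • (X j - X k₀) = 0 := fun i => by
    simp only [smul_sub, Finset.sum_sub_distrib, hX, ← Finset.sum_smul, hA, zero_smul, sub_zero]
  have h2 := det_smul_eq_zero_of_sum_smul_eq_zero (A.submatrix r c) (fun j => X (c j) - X k₀)
    fun i => by
      have h3 := h1 (r i)
      rw [← Finset.add_sum_erase _ _ (Finset.mem_univ k₀), sub_self, smul_zero, zero_add,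
        ← himage, Finset.sum_image fun _ _ _ _ h => hinj h] at h3
      exact h3
  by_cases hj : j = k₀
  · rw [hj, sub_self, smul_zero]
  · have hj' : j ∈ Finset.univ.image c := himage ▸ Finset.mem_erase.mpr ⟨hj, Finset.mem_univ _⟩
    obtain ⟨i, -, rfl⟩ := Finset.mem_image.mp hj'
    exact h2 i

theorem adjugate_eq_zero_of_minors {R : Type*} [CommRing R] {n : ℕ} (hn : 0 < n)
    (A : Matrix (Fin n) (Fin n) R)
    (h : ∀ r c : Fin (n - 1) → Fin n, (A.submatrix r c).det = 0) : A.adjugate = 0 := by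
  obtain ⟨m, rfl⟩ : ∃ m, n = m + 1 := ⟨n - 1, by omega⟩
  ext i j
  rw [Matrix.adjugate_fin_succ_eq_det_submatrix]
  exact (congrArg _ (h j.succAbove i.succAbove)).trans (mul_zero _)

/-! ### Automorphisms of colorings -/

section Automorphism

variable {R : Type} [CommRing R] {t : Rˣ}

/-- Transports the natural equivalence to sequences, with naturality expressed entrywise. It is used
in Yoneda style to carry the tautological coloring of one code to a universal coloring of the other.
-/
theorem ColoringEquiv.exists_arcColorings_equiv {w w' : List GaussLetter} (e : ColoringEquiv t w w')
    (hw : IsGaussWord w) (hw' : IsGaussWord w') (hpos : 0 < w.length) (hpos' : 0 < w'.length) :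
    ∃ Θ : ∀ (B : Type) [AddCommGroup B] [Module R B], arcColorings t B w ≃ₗ[R] arcColorings t B w',
      ∀ (B B' : Type) [AddCommGroup B] [Module R B] [AddCommGroup B'] [Module R B']
        (f : B →ₗ[R] B') (x : arcColorings t B w) (x' : arcColorings t B' w),
        (∀ m, (x' : ℕ → B') m = f ((x : ℕ → B) m)) →
          ∀ m, (Θ B' x' : ℕ → B') m = f ((Θ B x : ℕ → B) m) := by
  refine ⟨fun B _ _ => ((colorings.arcEquiv t hw hpos).symm.trans (e.toEquiv B)).trans
    (colorings.arcEquiv t hw' hpos'), fun B B' _ _ _ _ f x x' h m => ?_⟩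
  have h1 : (colorings.arcEquiv t hw hpos).symm x'
      = ⟨mapPair f ((colorings.arcEquiv t hw hpos).symm x),
        mapPair_mem t f ((colorings.arcEquiv t hw hpos).symm x).2⟩ := by
    refine Subtype.ext (Prod.ext (h 0) (funext fun c => ?_))
    change (if _ then _ else _) = f (if _ then _ else _)
    split_ifs
    · exact h _
    · exact (map_zero f).symm
  simp only [LinearEquiv.trans_apply]
  rw [h1]
  change passWord t (e.toEquiv B' _).1.2 (w'.take (m % w'.length)) (e.toEquiv B' _).1.1 = _
  rw [e.natural B B' f]
  exact passWord_map t f _ _ _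

variable {k : Type*} [Field k] [Algebra k R] [IsDomain R] {p r : ℕ} [CharP R p] [Fact p.Prime]

/-- The cokernel M of the Jacobian of `w₀` represents colorings, and its tautological coloring
corresponds to a universal coloring η of `w`. The shift of η by L is again a coloring, so it is
induced by an endomorphism ζ of M, with ζ^q = 1 and hence (ζ - 1)^q = 0. The bound on nilpotency on
M improves the exponent to q - 1. Every coloring is the image of η under a linear map, which
transfers the conclusion. -/
theorem shift_sub_one_pow_eq_zero {w₀ w : GaussCode} (e : ColoringEquiv t w₀.1 w.1)
    (hn : 0 < w₀.unders.length) (hpos : 0 < w.1.length) (f : ℤ[T;T⁻¹] →+* R)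
    (hf : ∀ n : ℤ, f (LaurentPolynomial.T n) = (t ^ n : Rˣ)) {d : R} (hd : d ≠ 0)
    [Module.Finite k (R ⧸ Ideal.span {d})] (k₀ : Fin w₀.unders.length)
    (hk₀ : ∀ (B : Type) [AddCommGroup B] [Module R B] (X : Fin w₀.unders.length → B),
      (∀ i, ∑ j, f (w₀.jacobian i j) • X j = 0) → ∀ j, d • (X j - X k₀) = 0)
    {L : ℕ} {c : ℕ → R} {par : ℕ → ℕ}
    (hsol : ∀ (B : Type) [AddCommGroup B] [Module R B],
      arcColorings t B w.1 = cyclicSolutions B L (p ^ r) c par)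
    (hlarge : w₀.unders.length * Module.finrank k (R ⧸ Ideal.span {d}) + 1 ≤ p ^ r - 1)
    (B : Type) [AddCommGroup B] [Module R B] (x : ℕ → B)
    (hx : x ∈ cyclicSolutions B L (p ^ r) c par) :
    ((LinearMap.funLeft R B (· + L) - 1) ^ (p ^ r - 1) : Module.End R (ℕ → B)) x = 0 := by
  classical
  obtain ⟨Θ, hΘ⟩ := e.exists_arcColorings_equiv w₀.2 w.2 (w₀.length_pos hn) hpos
  let n := w₀.unders.length
  let S : Submodule R (Fin n → R) :=
    Submodule.span R (Set.range fun i j => f (w₀.jacobian i j))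
  let ξ : Fin n → (Fin n → R) ⧸ S := fun j => Submodule.Quotient.mk (Pi.single j 1)
  have hmk : ∀ a : Fin n → R, Submodule.Quotient.mk (p := S) a = ∑ j, a j • ξ j := by
    intro a
    conv_lhs => rw [pi_eq_sum_univ' a]
    simp only [ξ, ← Submodule.mkQ_apply, map_sum, map_smul]
  have hξ : ∀ i, ∑ j, f (w₀.jacobian i j) • ξ j = 0 := by
    intro i
    rw [← hmk fun j => f (w₀.jacobian i j), Submodule.Quotient.mk_eq_zero]
    exact Submodule.subset_span ⟨i, rfl⟩
  have hspan : Submodule.span R (Set.range ξ) = ⊤ := by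
    rw [eq_top_iff]
    rintro y -
    obtain ⟨a, rfl⟩ := Submodule.Quotient.mk_surjective _ y
    rw [hmk]
    exact Submodule.sum_mem _ fun j _ =>
      Submodule.smul_mem _ _ (Submodule.subset_span ⟨j, rfl⟩)
  have hlift : ∀ (B : Type) [AddCommGroup B] [Module R B] (X : Fin n → B),
      (∀ i, ∑ j, f (w₀.jacobian i j) • X j = 0) →
        ∃ h : ((Fin n → R) ⧸ S) →ₗ[R] B, ∀ j, h (ξ j) = X j := by
    intro B _ _ X hX
    refine ⟨S.liftQ (Fintype.linearCombination R X) ?_, fun j => ?_⟩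
    · rw [Submodule.span_le]
      rintro _ ⟨i, rfl⟩
      exact hX i
    · rw [Submodule.liftQ_apply]
      simp [Fintype.linearCombination_apply_single]
  let ξ' : arcColorings t ((Fin n → R) ⧸ S) w₀.1 :=
    ⟨longArcColors R w₀ hn ξ, w₀.longArcColors_mem hn f t hf hξ⟩
  let η : ℕ → (Fin n → R) ⧸ S := (Θ _ ξ' : ℕ → (Fin n → R) ⧸ S)
  -- Representability: pull x back to `w₀`, lift it to a linear map on the cokernel, and use
  -- naturality to return to `w`.
  have hfactor : ∀ (B : Type) [AddCommGroup B] [Module R B] (x : ℕ → B),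
      x ∈ arcColorings t B w.1 → ∃ h : ((Fin n → R) ⧸ S) →ₗ[R] B, ∀ m, x m = h (η m) := by
    intro B _ _ x hx
    obtain ⟨X, hX, hXx⟩ := w₀.exists_longArcColors_eq hn f t hf ((Θ B).symm ⟨x, hx⟩).2
    obtain ⟨h, hh⟩ := hlift B X hX
    refine ⟨h, fun m => ?_⟩
    have h1 := hΘ _ _ h ξ' ((Θ B).symm ⟨x, hx⟩) (fun m => by
      rw [← hXx]
      exact (hh _).symm) m
    rwa [LinearEquiv.apply_symm_apply] at h1
  have hη : η ∈ cyclicSolutions ((Fin n → R) ⧸ S) L (p ^ r) c par := by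
    rw [← hsol]
    exact (Θ _ ξ').2
  have hshift : (fun m => η (m + L)) ∈ arcColorings t ((Fin n → R) ⧸ S) w.1 := by
    rw [hsol]
    refine ⟨fun m => ?_, fun j hj s => ?_⟩
    · simp only
      rw [add_right_comm, hη.1]
    · have h1 := hη.2 j hj (s + 1)
      simp only [add_mul, one_mul, ← add_assoc] at h1
      exact h1
  obtain ⟨ζ, hζ⟩ := hfactor _ _ hshift
  have hζpow : ∀ i m, (ζ ^ i) (η m) = η (m + i * L) := by
    intro i
    induction i with
    | zero => intro m; simp
    | succ i ih =>
      intro m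
      rw [pow_succ', Module.End.mul_apply, ih, ← hζ, add_mul, one_mul, add_assoc]
  -- Both ζ^q and the identity send η to itself, because η has period q L. Injectivity of the
  -- equivalence gives the same on the generators of M.
  have hζq : ζ ^ p ^ r = 1 := by
    have h1 : ∀ j, (ζ ^ p ^ r) (ξ j) = ξ j := by
      let y : arcColorings t ((Fin n → R) ⧸ S) w₀.1 :=
        ⟨longArcColors R w₀ hn fun j => (ζ ^ p ^ r) (ξ j),
          w₀.longArcColors_mem hn f t hf fun i => by
            simp only [← map_smul, ← map_sum, hξ, map_zero]⟩
      have h2 : y = ξ' := by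
        refine (Θ _).injective (Subtype.ext (funext fun m => ?_))
        rw [hΘ _ _ (ζ ^ p ^ r) ξ' y (fun m => rfl)]
        exact (hζpow _ _).trans (hη.1 m)
      exact congrFun (w₀.longArcColors_injective hn (congrArg Subtype.val h2))
    refine LinearMap.ext_on hspan ?_
    rintro _ ⟨j, rfl⟩
    exact h1 j
  have hY : (ζ - 1) ^ p ^ r = 0 := by
    have h1 := congrArg (Polynomial.aeval ζ)
      (sub_pow_char_pow (R := R[X]) (p := p) (n := r) Polynomial.X 1)
    simpa [hζq] using h1
  have hsum : ∀ i, ∑ j, f (w₀.jacobian i j) • (1 : R) = 0 := fun i => by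
    rw [w₀.sum_jacobian_smul f (fun _ => (1 : R))]
    simp
  -- The constant coloring 1 supplies the augmentation.
  obtain ⟨ε, hε⟩ := hlift R (fun _ => 1) hsum
  have hnil := pow_eq_zero_of_smul_sub_eq_zero (k := k) hd hspan k₀ (hk₀ _ ξ hξ) ε hε (ζ - 1) hY
  have hnil' := pow_eq_zero_of_le hlarge hnil
  obtain ⟨h, hh⟩ := hfactor B x (hsol B ▸ hx)
  have hpow : ∀ i m, ((LinearMap.funLeft R B (· + L) - 1) ^ i : Module.End R (ℕ → B)) x m
      = h (((ζ - 1) ^ i) (η m)) := by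
    intro i
    induction i with
    | zero => exact hh
    | succ i ih =>
      intro m
      rw [pow_succ', Module.End.mul_apply, LinearMap.sub_apply, Pi.sub_apply,
        LinearMap.funLeft_apply, Module.End.one_apply, ih, ih, pow_succ, Module.End.mul_apply,
        LinearMap.sub_apply, Module.End.one_apply, ← hζ, map_sub, map_sub]
  ext m
  rw [hpow, hnil']
  exact map_zero h

end Automorphism

/-! ### Ranks of colorings -/

section Rank

variable {κ : Type} [Field κ]

theorem GaussCode.rank_arcColorings_le_one (w : GaussCode) (hn : 0 < w.unders.length)
    (f : ℤ[T;T⁻¹] →+* κ) (t : κˣ) (hf : ∀ n : ℤ, f (LaurentPolynomial.T n) = (t ^ n : κˣ))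
    (r c : Fin (w.unders.length - 1) → Fin w.unders.length)
    (hd : f (w.jacobian.submatrix r c).det ≠ 0) : Module.rank κ (arcColorings t κ w.1) ≤ 1 := by
  have hsum : ∀ i, ∑ j, f (w.jacobian i j) = 0 := fun i => by
    have := w.sum_jacobian_smul f (fun _ => (1 : κ)) i
    simpa using this
  rw [RingHom.map_det] at hd
  obtain ⟨k₀, hk₀⟩ := exists_smul_sub_eq_zero_of_minor (w.jacobian.map f) hsum hn r c hd
  refine (rank_submodule_le_one_iff' _).mpr ⟨fun _ => 1, fun x hx => ?_⟩
  obtain ⟨X, hX, rfl⟩ := w.exists_longArcColors_eq hn f t hf hx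
  refine Submodule.mem_span_singleton.mpr ⟨X k₀, funext fun m => ?_⟩
  have h1 : ∀ j, X j = X k₀ := fun j =>
    sub_eq_zero.mp ((smul_eq_zero.mp (hk₀ κ X hX j)).resolve_left hd)
  change X k₀ * 1 = X _
  rw [mul_one]; exact (h1 _).symm

/-- If the rank were at most one, the kernel of the Jacobian would consist of constants and its
adjugate would be nonzero; but the adjugate entries are minors up to sign. -/
theorem GaussCode.one_lt_rank_arcColorings (w : GaussCode) (hn : 0 < w.unders.length)
    (f : ℤ[T;T⁻¹] →+* κ) (t : κˣ) (hf : ∀ n : ℤ, f (LaurentPolynomial.T n) = (t ^ n : κˣ))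
    (h : ∀ r c : Fin (w.unders.length - 1) → Fin w.unders.length,
      f (w.jacobian.submatrix r c).det = 0) : 1 < Module.rank κ (arcColorings t κ w.1) := by
  by_contra! hle
  have hconst := eq_of_rank_cyclicSolutions_le_one _ _ _ hle
  have : Nonempty (Fin w.unders.length) := ⟨⟨0, hn⟩⟩
  refine adjugate_ne_zero_of_forall_mulVec_eq_zero (A := w.jacobian.map f) (fun _ => 1)
    (fun X hX => ?_) (adjugate_eq_zero_of_minors hn _ fun r c => ?_)
  · have hmem := w.longArcColors_mem hn f t hf (X := X) fun i => congrFun hX i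
    refine ⟨X ⟨0, hn⟩, w.longArcColors_injective (R := κ) hn (funext fun m => ?_)⟩
    rw [hconst _ hmem m 0, w.longArcColors_apply hn X (Nat.zero_le _)]
    change _ = X _ * 1
    simp [underCount]
  · rw [← h r c, RingHom.map_det]
    rfl

end Rank

theorem rank_arcColorings_eq {κ : Type} [Field κ] {t : κˣ} {w w' : GaussCode}
    (h : w.toVirtualKnot = w'.toVirtualKnot) (hpos : 0 < w.1.length) (hpos' : 0 < w'.1.length) :
    Module.rank κ (arcColorings t κ w.1) = Module.rank κ (arcColorings t κ w'.1) := by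
  obtain ⟨e⟩ := nonempty_coloringEquiv_of_toVirtualKnot_eq t h
  exact (((colorings.arcEquiv t w.2 hpos).symm.trans (e.toEquiv κ)).trans
    (colorings.arcEquiv t w'.2 hpos')).rank_eq

/-- The empty code needs the pairs of colors: for length zero the sequence model imposes no
condition at all, while a pair is just one free color. -/
theorem rank_arcColorings_le_one_of_nil {κ : Type} [Field κ] {t : κˣ} {w w' : GaussCode}
    (h : w.toVirtualKnot = w'.toVirtualKnot) (hpos : 0 < w.1.length) (hnil : w'.1 = []) :
    Module.rank κ (arcColorings t κ w.1) ≤ 1 := by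
  obtain ⟨e⟩ := nonempty_coloringEquiv_of_toVirtualKnot_eq t h
  rw [((colorings.arcEquiv t w.2 hpos).symm.trans (e.toEquiv κ)).rank_eq, hnil]
  refine (rank_submodule_le_one_iff' _).mpr ⟨(1, 0), fun x hx => ?_⟩
  refine Submodule.mem_span_singleton.mpr ⟨x.1, Prod.ext (mul_one x.1) (funext fun c => ?_)⟩
  exact (mul_zero x.1).trans (hx.2.2 c (by simp)).symm

/-! ### Gauss codes of rotation invariant diagrams -/

section Geometry

open Filter Topology

/-- The reparametrization is only known to be an increasing homeomorphism. Still, each difference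
quotient of the curve at φ s is a positive multiple of z times one at s, or both vanish. The
multiple is the ratio of norms, whose limit exists and is positive because the curve is immersed. -/
theorem exists_pos_deriv_reparametrization {c : ℝ → ℂ} {φ : ℝ ≃o ℝ} {z : ℂ} (hz : ‖z‖ = 1)
    (h : ∀ s, c (φ s) = z * c s) (hc : Differentiable ℝ c) (hc' : ∀ s, deriv c s ≠ 0) (s : ℝ) :
    ∃ ρ : ℝ, 0 < ρ ∧ deriv c (φ s) = ρ * (z * deriv c s) := by
  have hz0 : z ≠ 0 := fun h0 => by simp [h0] at hz
  have h1 : Tendsto (slope c s) (𝓝[≠] s) (𝓝 (deriv c s)) :=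
    hasDerivAt_iff_tendsto_slope.mp (hc s).hasDerivAt
  have hφ : Tendsto φ (𝓝[≠] s) (𝓝[≠] (φ s)) :=
    tendsto_nhdsWithin_of_tendsto_nhds_of_eventually_within _
      (φ.continuous.continuousAt.tendsto.mono_left nhdsWithin_le_nhds)
      (eventually_nhdsWithin_of_forall fun x hx => φ.injective.ne hx)
  have h2 : Tendsto (fun x => slope c (φ s) (φ x)) (𝓝[≠] s) (𝓝 (deriv c (φ s))) :=
    (hasDerivAt_iff_tendsto_slope.mp (hc (φ s)).hasDerivAt).comp hφ
  have h3 : ∀ x, x ≠ s → slope c (φ s) (φ x)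
      = ((‖slope c (φ s) (φ x)‖ / ‖slope c s x‖ : ℝ) : ℂ) * (z * slope c s x) := by
    intro x hx
    have hpos : 0 < (x - s) / (φ x - φ s) := by
      rcases lt_or_gt_of_ne hx with hlt | hgt
      · exact div_pos_of_neg_of_neg (sub_neg.mpr hlt) (sub_neg.mpr (φ.strictMono hlt))
      · exact div_pos (sub_pos.mpr hgt) (sub_pos.mpr (φ.strictMono hgt))
    have hxs : ((x - s : ℝ) : ℂ) ≠ 0 := by exact_mod_cast sub_ne_zero.mpr hx
    have hφxs : ((φ x - φ s : ℝ) : ℂ) ≠ 0 := by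
      exact_mod_cast sub_ne_zero.mpr (φ.injective.ne hx)
    have h4 : slope c (φ s) (φ x) = (((x - s) / (φ x - φ s) : ℝ) : ℂ) * (z * slope c s x) := by
      simp only [slope, vsub_eq_sub, h, Complex.real_smul]
      push_cast at hxs hφxs ⊢
      field_simp
    by_cases h0 : slope c s x = 0
    · rw [h4, h0]; simp
    · conv_lhs => rw [h4]
      have h5 : ‖slope c (φ s) (φ x)‖ = (x - s) / (φ x - φ s) * ‖slope c s x‖ := by
        rw [h4, norm_mul, norm_mul, hz, one_mul, Complex.norm_real, Real.norm_of_nonneg hpos.le]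
      rw [h5, mul_div_cancel_right₀ _ (norm_ne_zero_iff.mpr h0)]
  have hlim : Tendsto (fun x => slope c (φ s) (φ x)) (𝓝[≠] s)
      (𝓝 (((‖deriv c (φ s)‖ / ‖deriv c s‖ : ℝ) : ℂ) * (z * deriv c s))) := by
    refine Tendsto.congr' (eventually_nhdsWithin_of_forall fun x hx => (h3 x hx).symm) ?_
    exact (Complex.continuous_ofReal.continuousAt.tendsto.comp
      (h2.norm.div h1.norm (norm_ne_zero_iff.mpr (hc' s)))).mul (h1.const_mul z)
  exact ⟨_, div_pos (norm_pos_iff.mpr (hc' _)) (norm_pos_iff.mpr (hc' _)),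
    tendsto_nhds_unique h2 hlim⟩

theorem PlanarDiagram.crossingSign_reparametrization (P : PlanarDiagram) {φ : ℝ ≃o ℝ} {z : ℂ}
    (hz : ‖z‖ = 1) (h : ∀ s, P.curve (φ s) = z * P.curve s) (s t : ℝ) :
    P.crossingSign (φ s) (φ t) = P.crossingSign s t := by
  have hd : Differentiable ℝ P.curve := P.smooth.differentiable (by simp)
  obtain ⟨ρ, hρ, hs⟩ := exists_pos_deriv_reparametrization hz h hd P.immersed s
  obtain ⟨σ, hσ, ht⟩ := exists_pos_deriv_reparametrization hz h hd P.immersed t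
  have h1 : starRingEnd ℂ (deriv P.curve (φ s)) * deriv P.curve (φ t)
      = ((ρ * σ : ℝ) : ℂ) * (starRingEnd ℂ (deriv P.curve s) * deriv P.curve t) := by
    have h2 : starRingEnd ℂ z * z = 1 := by
      rw [← Complex.normSq_eq_conj_mul_self, Complex.normSq_eq_norm_sq, hz]; simp
    rw [hs, ht]
    simp only [map_mul, Complex.conj_ofReal, Complex.ofReal_mul]
    linear_combination (ρ * σ * starRingEnd ℂ (deriv P.curve s) * deriv P.curve t) * h2
  unfold PlanarDiagram.crossingSign
  simp only [h1, Complex.im_ofReal_mul, mul_pos_iff_of_pos_left (mul_pos hρ hσ)]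

theorem PlanarDiagram.crossingSign_add_int (P : PlanarDiagram) (s t : ℝ) (m n : ℤ) :
    P.crossingSign (s + m) (t + n) = P.crossingSign s t := by
  have h : ∀ (s : ℝ) (m : ℤ), deriv P.curve (s + m) = deriv P.curve s := by
    intro s m
    rw [← deriv_comp_add_const]
    congr 1
    ext x
    have := P.periodic.int_mul m x
    rwa [mul_one] at this
  unfold PlanarDiagram.crossingSign
  rw [h, h]

/-- The parameters of the letters of a Gauss code, extended to all integers. -/
noncomputable def liftParam {N : ℕ} (hN : 0 < N) (θ : Fin N → ℝ) (i : ℤ) : ℝ :=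
  θ ⟨(i % N).toNat, by
    have := Int.emod_nonneg i (show (N : ℤ) ≠ 0 by omega)
    have := Int.emod_lt_of_pos i (show (0 : ℤ) < N by omega)
    omega⟩ + (i / N : ℤ)

theorem liftParam_fin {N : ℕ} (hN : 0 < N) (θ : Fin N → ℝ) (i : Fin N) (m : ℤ) :
    liftParam hN θ (i + N * m) = θ i + m := by
  have h1 : ((i : ℤ) + N * m) % N = i := by
    rw [Int.add_mul_emod_self_left]
    exact Int.emod_eq_of_lt (by omega) (by omega)
  have h2 : ((i : ℤ) + N * m) / N = m := by
    rw [Int.add_mul_ediv_left _ _ (by omega), Int.ediv_eq_zero_of_lt (by omega) (by omega), zero_add]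
  simp only [liftParam, h1, h2]
  rfl

theorem exists_fin_add_mul {N : ℕ} (hN : 0 < N) (i : ℤ) : ∃ (j : Fin N) (m : ℤ), i = j + N * m := by
  have h1 := Int.emod_nonneg i (show (N : ℤ) ≠ 0 by omega)
  have h2 := Int.emod_lt_of_pos i (show (0 : ℤ) < N by omega)
  refine ⟨⟨(i % N).toNat, by omega⟩, i / N, ?_⟩
  have := Int.emod_add_mul_ediv i N
  simp only
  omega

theorem liftParam_add_mul {N : ℕ} (hN : 0 < N) (θ : Fin N → ℝ) (i m : ℤ) :
    liftParam hN θ (i + N * m) = liftParam hN θ i + m := by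
  obtain ⟨j, n, rfl⟩ := exists_fin_add_mul hN i
  rw [add_assoc, ← mul_add, liftParam_fin, liftParam_fin]
  push_cast
  ring

theorem liftParam_strictMono {N : ℕ} (hN : 0 < N) {θ : Fin N → ℝ} (hθ : StrictMono θ)
    (hθ' : ∀ i, θ i ∈ Set.Ico (0 : ℝ) 1) : StrictMono (liftParam hN θ) := by
  refine strictMono_int_of_lt_succ fun i => ?_
  obtain ⟨j, m, rfl⟩ := exists_fin_add_mul hN i
  by_cases hj : (j : ℕ) + 1 < N
  · have h1 := liftParam_fin hN θ ⟨j + 1, hj⟩ m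
    have h2 : θ j < θ ⟨j + 1, hj⟩ := hθ (by simp [Fin.lt_def])
    rw [liftParam_fin, add_right_comm]
    push_cast at h1
    rw [h1]
    linarith
  · have h1 := liftParam_fin hN θ ⟨0, hN⟩ (m + 1)
    have h2 : ((j : ℤ) + N * m + 1) = ((⟨0, hN⟩ : Fin N) : ℕ) + N * (m + 1) := by
      have : (j : ℕ) + 1 = N := by omega
      push_cast [← this]
      ring
    rw [h2, h1, liftParam_fin]
    have h3 := (hθ' j).2
    have h4 := (hθ' ⟨0, hN⟩).1
    push_cast
    linarith

/-- A strictly increasing bijection of the integers is a translation. -/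
theorem exists_eq_add_of_strictMono {τ : ℤ → ℤ} (h : StrictMono τ) (h' : Function.Surjective τ) :
    ∃ l, ∀ i, τ i = i + l := by
  have h1 : ∀ i, τ (i + 1) = τ i + 1 := by
    intro i
    have h2 : τ i < τ (i + 1) := h (by omega)
    obtain ⟨k, hk⟩ := h' (τ i + 1)
    have h3 : i < k := h.lt_iff_lt.mp (by omega)
    have h4 : τ (i + 1) ≤ τ k := h.monotone (by omega)
    omega
  refine ⟨τ 0, fun i => ?_⟩
  induction i with
  | zero => simp
  | succ i ih => rw [h1, ih]; ring
  | pred i ih =>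
    have := h1 (-(i : ℤ) - 1)
    rw [sub_add_cancel, ih] at this
    omega

/-- An increasing bijection preserving the lifted crossing parameters permutes their integer indices
monotonically, hence by a translation. -/
theorem exists_liftParam_map {N : ℕ} (hN : 0 < N) {θ : Fin N → ℝ} (hθ : StrictMono θ)
    (hθ' : ∀ i, θ i ∈ Set.Ico (0 : ℝ) 1) (φ : ℝ ≃o ℝ)
    (h : ∀ s, φ s ∈ Set.range (liftParam hN θ) ↔ s ∈ Set.range (liftParam hN θ)) :
    ∃ l : ℤ, ∀ i, φ (liftParam hN θ i) = liftParam hN θ (i + l) := by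
  have hmono := liftParam_strictMono hN hθ hθ'
  choose τ hτ using fun i => (h (liftParam hN θ i)).mpr ⟨i, rfl⟩
  obtain ⟨l, hl⟩ := exists_eq_add_of_strictMono (τ := τ)
    (fun i j hij => hmono.lt_iff_lt.mp (by rw [hτ, hτ]; exact φ.strictMono (hmono hij)))
    (fun j => by
      obtain ⟨i, hi⟩ := (h (φ.symm (liftParam hN θ j))).mp (by simp)
      refine ⟨i, hmono.injective ?_⟩
      rw [hτ, hi, OrderIso.apply_symm_apply])
  exact ⟨l, fun i => by rw [← hτ, hl]⟩

theorem exists_liftParam_le {N : ℕ} (hN : 0 < N) {θ : Fin N → ℝ} (hθ : StrictMono θ)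
    (hθ' : ∀ i, θ i ∈ Set.Ico (0 : ℝ) 1) (s : ℝ) :
    ∃ i, liftParam hN θ i ≤ s ∧ s < liftParam hN θ (i + 1) := by
  have hmono := liftParam_strictMono hN hθ hθ'
  have h0 : ∀ m : ℤ, liftParam hN θ (N * m) = liftParam hN θ 0 + m := fun m => by
    rw [← liftParam_add_mul, zero_add]
  obtain ⟨i, hi, hmax⟩ := Int.exists_greatest_of_bdd (P := fun i => liftParam hN θ i ≤ s)
    ⟨N * (⌊s - liftParam hN θ 0⌋ + 1), fun i hi => by
      have h2 := h0 (⌊s - liftParam hN θ 0⌋ + 1)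
      have h3 := Int.lt_floor_add_one (s - liftParam hN θ 0)
      push_cast at h2
      exact (hmono.lt_iff_lt.mp (by linarith)).le⟩
    ⟨N * ⌊s - liftParam hN θ 0⌋, by
      have h2 := h0 ⌊s - liftParam hN θ 0⌋
      have h3 := Int.floor_le (s - liftParam hN θ 0)
      linarith⟩
  refine ⟨i, hi, ?_⟩
  by_contra! h
  have := hmax _ h
  omega

/-- A rotation of prime power order that leaves a diagram invariant and does not fix a point of it
acts on the letters of the Gauss code with a rotation number prime to its order. -/
theorem PlanarDiagram.exists_rotation_number (P : PlanarDiagram) {p r : ℕ} (hp : p.Prime)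
    (hr : r ≠ 0) (h0 : ∀ s, P.curve s ≠ 0) {φ : ℝ ≃o ℝ} (hφ : ∀ s, φ (s + 1) = φ s + 1)
    (hcurve : ∀ s, P.curve (φ s)
      = Complex.exp ((2 * Real.pi / (p ^ r : ℕ) : ℝ) * Complex.I) * P.curve s) {N : ℕ} (hN : 0 < N)
    {θ : Fin N → ℝ} (hθ : StrictMono θ) (hθ' : ∀ i, θ i ∈ Set.Ico (0 : ℝ) 1) {l : ℤ}
    (hl : ∀ i, φ (liftParam hN θ i) = liftParam hN θ (i + l)) :
    ∃ m : ℤ, (p ^ r : ℕ) * l = N * m ∧ ¬ (p : ℤ) ∣ m := by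
  set q := p ^ r with hq
  set z := Complex.exp ((2 * Real.pi / q : ℝ) * Complex.I) with hz
  have hmono := liftParam_strictMono hN hθ hθ'
  have hq0 : q ≠ 0 := pow_ne_zero _ hp.ne_zero
  have hzpow : IsPrimitiveRoot z q := by
    convert Complex.isPrimitiveRoot_exp q hq0 using 2
    push_cast
    ring
  let g : CircleDeg1Lift := ⟨⟨φ, φ.monotone⟩, hφ⟩
  have hg : ∀ s, g s = φ s := fun _ => rfl
  have hiter : ∀ k s, P.curve ((g ^ k) s) = z ^ k * P.curve s := by
    intro k
    induction k with
    | zero => intro s; simp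
    | succ k ih =>
      intro s
      rw [pow_succ', CircleDeg1Lift.mul_apply, hg, hcurve, ih, pow_succ', mul_assoc]
  have hiter' : ∀ (k : ℕ) i, (g ^ k) (liftParam hN θ i) = liftParam hN θ (i + k * l) := by
    intro k
    induction k with
    | zero => intro i; simp
    | succ k ih =>
      intro i
      rw [pow_succ', CircleDeg1Lift.mul_apply, hg, ih, hl]
      congr 1
      push_cast
      ring
  have hstrict : ∀ k, StrictMono (g ^ k : CircleDeg1Lift) := by
    intro k
    rw [CircleDeg1Lift.coe_pow]
    exact φ.strictMono.iterate k
  -- At a point that is not a double point the curve determines the parameter modulo 1, so the q-th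
  -- iterate moves s by an integer.
  obtain ⟨s, hs, hs'⟩ : ∃ s ∈ Set.Ico (0 : ℝ) 1, ∀ t ∈ Set.Ico (0 : ℝ) 1,
      P.curve s = P.curve t → s = t := by
    obtain ⟨s, hs, hs'⟩ := ((Set.Ico_infinite (zero_lt_one' ℝ)).sdiff P.finite_double).nonempty
    refine ⟨s, hs, fun t ht hst => ?_⟩
    by_contra hne
    exact hs' ⟨hs, t, ht, hne, hst⟩
  obtain ⟨m, hm⟩ : ∃ m : ℤ, (g ^ q) s = s + m := by
    refine ⟨⌊(g ^ q) s⌋, ?_⟩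
    have h1 : P.curve (Int.fract ((g ^ q) s)) = P.curve ((g ^ q) s) := by
      have := P.periodic.sub_int_mul_eq (x := (g ^ q) s) ⌊(g ^ q) s⌋
      rwa [mul_one] at this
    have h2 := hs' _ ⟨Int.fract_nonneg ((g ^ q) s), Int.fract_lt_one ((g ^ q) s)⟩ (by
      rw [h1, hiter, hzpow.pow_eq_one, one_mul])
    have h3 := Int.fract_add_floor ((g ^ q) s)
    rw [← h2] at h3
    exact h3.symm
  refine ⟨m, ?_, ?_⟩
  -- The q-th iterate moves s by m and indices by q l, while translation by m moves indices by N m.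
  -- Locating s + m between consecutive crossing parameters in both ways forces q l = N m.
  · obtain ⟨i, hi, hi'⟩ := exists_liftParam_le hN hθ hθ' s
    have h1 := (hstrict q).monotone hi
    have h2 := hstrict q hi'
    rw [hm, hiter'] at h1 h2
    have h3 := liftParam_add_mul hN θ i m
    have h4 := liftParam_add_mul hN θ (i + 1) m
    have h5 : i + q * l < i + 1 + N * m := hmono.lt_iff_lt.mp (by linarith)
    have h6 : i + N * m < i + 1 + q * l := hmono.lt_iff_lt.mp (by linarith)
    omega
  · rintro ⟨a, rfl⟩
    obtain ⟨r, rfl⟩ := Nat.exists_eq_succ_of_ne_zero hr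
    -- From here on r is the old exponent minus one. If p divides m, the iterate of order p^r moves
    -- s by exactly m / p, since a strict deviation would persist through p iterations. The
    -- corresponding rotation then fixes a nonzero point, although z has order p^(r+1).
    have hqp : q = p ^ r * p := by rw [hq, pow_succ]
    have hfix : (g ^ p ^ r) s = s + a := by
      have h1 : ∀ k : ℕ, ((g ^ p ^ r) s < s + a → 0 < k → ((g ^ p ^ r) ^ k) s < s + k * a) ∧
          (s + a < (g ^ p ^ r) s → 0 < k → s + k * a < ((g ^ p ^ r) ^ k) s) := by
        intro k
        induction k with
        | zero => simp
        | succ k ih =>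
          have h2 : (g ^ p ^ r) (s + k * a) = (g ^ p ^ r) s + k * a := by
            have := (g ^ p ^ r).map_add_int s (k * a)
            push_cast at this
            exact this
          rw [pow_succ', CircleDeg1Lift.mul_apply]
          push_cast
          rcases k.eq_zero_or_pos with rfl | hk
          · simp
          constructor
          · intro h _
            have h3 := hstrict (p ^ r) (ih.1 h hk)
            rw [h2] at h3
            linarith
          · intro h _
            have h3 := hstrict (p ^ r) (ih.2 h hk)
            rw [h2] at h3
            linarith
      have h4 := h1 p
      rw [← pow_mul, ← hqp, hm] at h4
      push_cast at h4
      rcases lt_trichotomy ((g ^ p ^ r) s) (s + a) with h | h | h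
      · exact absurd (h4.1 h hp.pos) (lt_irrefl _)
      · exact h
      · exact absurd (h4.2 h hp.pos) (lt_irrefl _)
    have h5 := hiter (p ^ r) s
    have h6 := P.periodic.int_mul a s
    rw [mul_one] at h6
    rw [hfix, h6] at h5
    have h7 : z ^ p ^ r = 1 := by
      have := mul_right_cancel₀ (h0 s) ((one_mul _).trans h5)
      exact this.symm
    have h8 := hzpow.dvd_of_pow_eq_one _ h7
    rw [hqp] at h8
    have h9 := Nat.le_of_dvd (pow_pos hp.pos r) h8
    have h10 := hp.one_lt
    have h11 := pow_pos hp.pos r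
    nlinarith

end Geometry

/-! ### Shift-invariant recurrences. -/

section CyclicSolutions

variable {R : Type*} [CommRing R] {B : Type*} [AddCommGroup B] [Module R B]

theorem mem_cyclicSolutions_iff_of_shift {L q : ℕ} {c : ℕ → R} {par : ℕ → ℕ} (hL : 0 < L)
    (hc : ∀ m, c (m + L) = c m) (hpar : ∀ m, par (m + L) ≡ par m + L [MOD q * L]) {x : ℕ → B} :
    x ∈ cyclicSolutions B L q c par ↔ (∀ m, x (m + q * L) = x m) ∧
      ∀ m, x (m + 1) = c m • x m + (1 - c m) • x (par m) := by
  have hc' : ∀ s m, c (m + s * L) = c m := fun s m => by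
    have h : Function.Periodic c L := hc
    exact h.nat_mul s m
  have hpar' : ∀ s m, par (m + s * L) ≡ par m + s * L [MOD q * L] := by
    intro s m
    induction s with
    | zero => simpa using Nat.ModEq.refl _
    | succ s ih =>
      rw [Nat.succ_mul, ← add_assoc, ← add_assoc]
      exact (hpar _).trans (ih.add_right L)
  have hmod : ∀ (_ : ∀ m, x (m + q * L) = x m) {a b : ℕ}, a ≡ b [MOD q * L] → x a = x b := by
    intro hx a b hab
    have h : Function.Periodic x (q * L) := hx
    rw [← h.map_mod_nat a, ← h.map_mod_nat b, hab]
  constructor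
  · rintro ⟨h1, h2⟩
    refine ⟨h1, fun m => ?_⟩
    have h3 := h2 (m % L) (Nat.mod_lt _ hL) (m / L)
    have h4 : m % L + m / L * L = m := Nat.mod_add_div' m L
    have h5 := hc' (m / L) (m % L)
    have h6 := hpar' (m / L) (m % L)
    rw [h4] at h5 h6
    rw [add_right_comm, h4, ← h5, ← hmod h1 h6] at h3
    exact h3
  · rintro ⟨h1, h2⟩
    refine ⟨h1, fun j _ s => ?_⟩
    rw [add_right_comm, h2, hc', hmod h1 (hpar' s j)]

/-- When the coefficients are L-periodic and the over-positions shift by L modulo the length, the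
recurrences at all letters are those at the first L letters together with their translates. Label
names play no role. -/
theorem arcColorings_eq_cyclicSolutions (t : Rˣ) {w : List GaussLetter} {L q : ℕ}
    (hpos : 0 < w.length) (hL : q * L = w.length)
    (h : ∀ m, (letterAt w (m + L)).isOver = (letterAt w m).isOver ∧
      (letterAt w (m + L)).sign = (letterAt w m).sign ∧
      overIndex w (letterAt w (m + L)).label
        ≡ overIndex w (letterAt w m).label + L [MOD w.length]) :
    arcColorings t B w = cyclicSolutions B L q (fun m => letterCoeff t (letterAt w m))
      fun m => overIndex w (letterAt w m).label := by
  have hper : ∀ m, letterAt w (m + w.length) = letterAt w m := fun m => by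
    rw [letterAt, Nat.add_mod_right, letterAt]
  ext x
  rw [arcColorings, mem_cyclicSolutions_iff_of_shift hpos (fun m => by rw [hper]) (fun m => by
    rw [hper]; simp [Nat.ModEq]), mem_cyclicSolutions_iff_of_shift
    (Nat.pos_of_ne_zero fun h0 => by simp [h0] at hL; omega)
    (fun m => by simp only [letterCoeff, (h m).1, (h m).2.1])
    (fun m => by rw [hL]; exact (h m).2.2), hL, one_mul]

end CyclicSolutions

theorem IsGaussWord.sign_eq {w : List GaussLetter} (hw : IsGaussWord w) {l l' : GaussLetter}
    (hl : l ∈ w) (hl' : l' ∈ w) (h : l.label = l'.label) (ho : l.isOver = true)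
    (ho' : l'.isOver = false) : l.sign = l'.sign := by
  have := List.inj_on_of_nodup_map hw.1 hl' (hw.2 l hl) (by simp [h, ho, ho'])
  rw [this]

/-! ### Shift invariance of the Gauss code of an invariant diagram. -/

section Geometry

namespace PlanarDiagram

variable (P : PlanarDiagram) {w : GaussCode} {θ : Fin w.1.length → ℝ}

/-- A double point has only two parameters, so a letter has a unique possible partner, and asymmetry
of over and under fixes the roles. -/
theorem classical_iff_of_gaussCode (hθ : StrictMono θ) (hθ' : ∀ i, θ i ∈ Set.Ico (0 : ℝ) 1)
    (hw : ∀ i j, (w.1.get i).label = (w.1.get j).label →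
      (w.1.get i).isOver = true → (w.1.get j).isOver = false → P.classical (θ i) (θ j))
    (i j : Fin w.1.length) : P.classical (θ i) (θ j) ↔ (w.1.get i).label = (w.1.get j).label ∧
      (w.1.get i).isOver = true ∧ (w.1.get j).isOver = false := by
  have hne : ∀ i j, P.classical (θ i) (θ j) → θ i ≠ θ j := fun i j h he => by
    have := (P.classical_double _ _ h).2 0
    simp [he] at this
  refine ⟨fun h => ?_, fun h => hw i j h.1 h.2.1 h.2.2⟩
  obtain ⟨k, hk⟩ := List.mem_iff_get.mp (w.2.2 _ (List.get_mem w.1 i))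
  by_cases ho : (w.1.get i).isOver = true
  · have h1 := hw i k (by rw [hk]) ho (by simp [hk, -List.get_eq_getElem, ho])
    have h2 := P.double (θ j) (θ i) (θ k) (hθ' _) (hθ' _) (hθ' _)
      (P.classical_double _ _ h).1.symm (P.classical_double _ _ h1).1
    have hjk : j = k := hθ.injective (by
      rcases h2 with h2 | h2 | h2
      · exact absurd h2.symm (hne _ _ h)
      · exact absurd h2 (hne _ _ h1)
      · exact h2)
    subst hjk
    exact ⟨by rw [hk], ho, by simp [hk, -List.get_eq_getElem, ho]⟩
  · rw [Bool.not_eq_true] at ho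
    have h1 := hw k i (by rw [hk]) (by simp [hk, -List.get_eq_getElem, ho]) ho
    have h2 := P.double (θ j) (θ i) (θ k) (hθ' _) (hθ' _) (hθ' _)
      (P.classical_double _ _ h).1.symm (P.classical_double _ _ h1).1.symm
    have hjk : j = k := hθ.injective (by
      rcases h2 with h2 | h2 | h2
      · exact absurd h2.symm (hne _ _ h)
      · exact absurd h2.symm (hne _ _ h1)
      · exact h2)
    subst hjk
    exact absurd h1 (P.classical_asymm _ _ h)

theorem liftParam_natCast {N : ℕ} (hN : 0 < N) (θ : Fin N → ℝ) (m : ℕ) :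
    liftParam hN θ m = θ ⟨m % N, Nat.mod_lt m hN⟩ + (m / N : ℕ) := by
  rw [← Int.cast_natCast (m / N), ← liftParam_fin hN]
  congr 1
  exact_mod_cast (Nat.mod_add_div m N).symm

/-- The letters of the Gauss code of a diagram that is invariant under a rotation of prime power
order are invariant under a shift, up to the names of the labels. -/
theorem exists_letterAt_shift {p r : ℕ} (hp : p.Prime) (hr : r ≠ 0) (h0 : ∀ s, P.curve s ≠ 0)
    (hinv : P.InvariantUnderRotation (2 * Real.pi / (p ^ r : ℕ))) (hpos : 0 < w.1.length)
    (hcode : P.HasGaussCode w) :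
    ∃ L, p ^ r * L = w.1.length ∧ ∀ m,
      (letterAt w.1 (m + L)).isOver = (letterAt w.1 m).isOver ∧
      (letterAt w.1 (m + L)).sign = (letterAt w.1 m).sign ∧
      overIndex w.1 (letterAt w.1 (m + L)).label
        ≡ overIndex w.1 (letterAt w.1 m).label + L [MOD w.1.length] := by
  obtain ⟨θ, hθ, hθ', hcl, hw⟩ := hcode
  obtain ⟨φ, hφ, hcurve, hφcl⟩ := hinv
  set Θ := liftParam hpos θ with hΘ
  have hfin := P.classical_iff_of_gaussCode hθ hθ' fun i j h h1 h2 => (hw i j h h1 h2).1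
  have hpartner : ∀ i : Fin w.1.length, ∃ j, P.classical (θ i) (θ j) ∨ P.classical (θ j) (θ i) := by
    intro i
    obtain ⟨k, hk⟩ := List.mem_iff_get.mp (w.2.2 _ (List.get_mem w.1 i))
    refine ⟨k, ?_⟩
    rw [hfin, hfin, hk]
    cases (w.1.get i).isOver <;> simp
  -- Crossing parameters are those with a classical partner, a condition that the rotation visibly
  -- preserves.
  have hrange : ∀ s, s ∈ Set.range Θ ↔ ∃ t, P.classical s t ∨ P.classical t s := by
    intro s
    constructor
    · rintro ⟨i, rfl⟩
      obtain ⟨j, m, rfl⟩ := exists_fin_add_mul hpos i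
      obtain ⟨k, hk⟩ := hpartner j
      refine ⟨θ k + m, ?_⟩
      rwa [hΘ, liftParam_fin, P.classical_add_int, P.classical_add_int]
    · rintro ⟨t, ht⟩
      have hs := Int.fract_add_floor s
      have ht' := Int.fract_add_floor t
      rw [← hs, ← ht', P.classical_add_int, P.classical_add_int] at ht
      obtain ⟨i, hi⟩ : ∃ i, θ i = Int.fract s := by
        have hs1 : Int.fract s ∈ Set.Ico (0 : ℝ) 1 := ⟨Int.fract_nonneg s, Int.fract_lt_one s⟩
        have ht1 : Int.fract t ∈ Set.Ico (0 : ℝ) 1 := ⟨Int.fract_nonneg t, Int.fract_lt_one t⟩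
        rcases ht with ht | ht
        · obtain ⟨i, _, hi, _⟩ := hcl _ hs1 _ ht1 ht
          exact ⟨i, hi⟩
        · obtain ⟨_, i, _, hi⟩ := hcl _ ht1 _ hs1 ht
          exact ⟨i, hi⟩
      exact ⟨i + w.1.length * ⌊s⌋, by rw [hΘ, liftParam_fin, hi, hs]⟩
  obtain ⟨l, hl⟩ := exists_liftParam_map hpos hθ hθ' φ fun s => by
    rw [hrange, hrange]
    constructor
    · rintro ⟨t, ht⟩
      refine ⟨φ.symm t, ?_⟩
      rwa [← hφcl, ← hφcl (φ.symm t), φ.apply_symm_apply]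
    · rintro ⟨t, ht⟩
      exact ⟨φ t, by rwa [hφcl, hφcl]⟩
  obtain ⟨m, hm, hpm⟩ := P.exists_rotation_number hp hr h0 hφ hcurve hpos hθ hθ' hl
  -- With a m + b q = 1, the a-th iterate of the rotation combined with translation by b shifts
  -- indices by L = a l + b N, and q l = N m gives q L = N.
  obtain ⟨a, b, hab⟩ : IsCoprime m ((p ^ r : ℕ) : ℤ) := by
    push_cast
    exact (((Nat.prime_iff_prime_int.mp hp).coprime_iff_not_dvd.mpr hpm).symm).pow_right
  have hz : ‖Complex.exp ((2 * Real.pi / (p ^ r : ℕ) : ℝ) * Complex.I)‖ = 1 :=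
    Complex.norm_exp_ofReal_mul_I _
  have hstep : ∀ i j, (P.classical (Θ (i + l)) (Θ (j + l)) ↔ P.classical (Θ i) (Θ j)) ∧
      P.crossingSign (Θ (i + l)) (Θ (j + l)) = P.crossingSign (Θ i) (Θ j) := by
    intro i j
    rw [hΘ, ← hl, ← hl]
    exact ⟨hφcl _ _, P.crossingSign_reparametrization hz hcurve _ _⟩
  have hsteps : ∀ (a : ℤ) i j,
      (P.classical (Θ (i + a * l)) (Θ (j + a * l)) ↔ P.classical (Θ i) (Θ j)) ∧
      P.crossingSign (Θ (i + a * l)) (Θ (j + a * l)) = P.crossingSign (Θ i) (Θ j) := by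
    intro a i j
    induction a with
    | zero => simp
    | succ a ih =>
      have := hstep (i + a * l) (j + a * l)
      rw [add_one_mul, ← add_assoc, ← add_assoc]
      exact ⟨this.1.trans ih.1, this.2.trans ih.2⟩
    | pred a ih =>
      have := hstep (i + (-a - 1) * l) (j + (-a - 1) * l)
      have h1 : ∀ i : ℤ, i + (-a - 1) * l + l = i + -a * l := fun i => by ring
      rw [h1, h1] at this
      exact ⟨this.1.symm.trans ih.1, this.2.symm.trans ih.2⟩
  have hqL : ((p ^ r : ℕ) : ℤ) * (a * l + w.1.length * b) = w.1.length := by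
    linear_combination a * hm + w.1.length * hab
  have hL0 : 0 ≤ a * l + w.1.length * b := by
    have hq : (0 : ℤ) < ((p ^ r : ℕ) : ℤ) := by exact_mod_cast pow_pos hp.pos r
    by_contra! hneg
    have := mul_neg_of_pos_of_neg hq hneg
    omega
  obtain ⟨L, hL⟩ := Int.eq_ofNat_of_zero_le hL0
  have hshift : ∀ i j : ℕ, (P.classical (Θ (i + L : ℕ)) (Θ (j + L : ℕ)) ↔
      P.classical (Θ i) (Θ j)) ∧
      P.crossingSign (Θ (i + L : ℕ)) (Θ (j + L : ℕ)) = P.crossingSign (Θ i) (Θ j) := by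
    intro i j
    push_cast
    rw [← hL, ← add_assoc, ← add_assoc, hΘ, liftParam_add_mul, liftParam_add_mul,
      P.classical_add_int, P.crossingSign_add_int]
    exact hsteps a i j
  have hletter : ∀ m, letterAt w.1 m = w.1.get ⟨m % w.1.length, Nat.mod_lt m hpos⟩ := fun m => by
    rw [letterAt, List.getD_eq_getElem _ _ (Nat.mod_lt m hpos)]
    rfl
  have hnat : ∀ i j : ℕ, P.classical (Θ i) (Θ j) ↔
      (letterAt w.1 i).label = (letterAt w.1 j).label ∧
      (letterAt w.1 i).isOver = true ∧ (letterAt w.1 j).isOver = false := by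
    intro i j
    have := P.classical_add_int (θ ⟨i % w.1.length, Nat.mod_lt i hpos⟩)
      (θ ⟨j % w.1.length, Nat.mod_lt j hpos⟩) (i / w.1.length : ℕ) (j / w.1.length : ℕ)
    rw [hfin, Int.cast_natCast, Int.cast_natCast] at this
    rw [hΘ, liftParam_natCast, liftParam_natCast, this, hletter, hletter]
  have hsign : ∀ i j : ℕ, P.classical (Θ i) (Θ j) →
      (letterAt w.1 i).sign = P.crossingSign (Θ i) (Θ j) ∧
      (letterAt w.1 j).sign = P.crossingSign (Θ i) (Θ j) := by
    intro i j h
    have h1 := (hnat i j).mp h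
    have h2 := P.crossingSign_add_int (θ ⟨i % w.1.length, Nat.mod_lt i hpos⟩)
      (θ ⟨j % w.1.length, Nat.mod_lt j hpos⟩) (i / w.1.length : ℕ) (j / w.1.length : ℕ)
    rw [Int.cast_natCast, Int.cast_natCast] at h2
    rw [hΘ, liftParam_natCast, liftParam_natCast, h2]
    rw [hletter, hletter] at h1 ⊢
    have h3 := (hw _ _ h1.1 h1.2.1 h1.2.2).2
    exact ⟨h3, by rw [← h3, w.2.sign_eq (List.get_mem _ _) (List.get_mem _ _) h1.1 h1.2.1 h1.2.2]⟩
  have hover : ∀ i j : ℕ, P.classical (Θ i) (Θ j) →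
      overIndex w.1 (letterAt w.1 i).label = i % w.1.length ∧
      overIndex w.1 (letterAt w.1 j).label = i % w.1.length := by
    intro i j h
    have h1 := (hnat i j).mp h
    rw [← h1.1, and_self, letterAt, List.getD_eq_getElem _ _ (Nat.mod_lt i hpos)]
    refine w.2.overIndex_eq (Nat.mod_lt i hpos) ?_
    have := h1.2.1
    rwa [hletter] at this
  refine ⟨L, by rw [hL] at hqL; exact_mod_cast hqL, fun i => ?_⟩
  obtain ⟨j, hj⟩ : ∃ j : ℕ, P.classical (Θ i) (Θ j) ∨ P.classical (Θ j) (Θ i) := by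
    obtain ⟨k, hk⟩ := hpartner ⟨i % w.1.length, Nat.mod_lt i hpos⟩
    refine ⟨k, ?_⟩
    have hΘk : Θ k = θ k + (0 : ℤ) := by
      rw [← liftParam_fin hpos θ k 0, mul_zero, add_zero]
    rw [hΘk, hΘ, liftParam_natCast, ← Int.cast_natCast (i / w.1.length), P.classical_add_int,
      P.classical_add_int]
    exact hk
  have hmod : ∀ i, (i + L) % w.1.length ≡ i % w.1.length + L [MOD w.1.length] := fun i =>
    (Nat.mod_modEq _ _).trans ((Nat.mod_modEq i _).symm.add_right L)
  rcases hj with hj | hj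
  · have hj' := (hshift i j).1.mpr hj
    refine ⟨?_, ?_, ?_⟩
    · rw [((hnat _ _).mp hj).2.1, ((hnat _ _).mp hj').2.1]
    · rw [(hsign _ _ hj).1, (hsign _ _ hj').1, (hshift i j).2]
    · rw [(hover _ _ hj).1, (hover _ _ hj').1]
      exact hmod i
  · have hj' := (hshift j i).1.mpr hj
    refine ⟨?_, ?_, ?_⟩
    · rw [((hnat _ _).mp hj).2.2, ((hnat _ _).mp hj').2.2]
    · rw [(hsign _ _ hj).2, (hsign _ _ hj').2, (hshift j i).2]
    · rw [(hover _ _ hj).2, (hover _ _ hj').2]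
      exact hmod j

end PlanarDiagram

end Geometry

/-! ### Prime power periods -/

/-- The rotation by 2π/q is the `k₁`-th power of the rotation by 2π/(q `k₁`), so the same diagram
serves. -/
theorem VirtualKnot.HasPeriod.of_dvd {K : VirtualKnot} {Q q : ℕ} (h : K.HasPeriod Q) (hq : 1 < q)
    (hdvd : q ∣ Q) : K.HasPeriod q := by
  obtain ⟨h1, P, hP, h0, φ, hφ, hcurve, hcl⟩ := h
  obtain ⟨k₁, rfl⟩ := hdvd
  have hq0 : (q : ℂ) ≠ 0 := by exact_mod_cast (by omega : q ≠ 0)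
  have hk0 : (k₁ : ℂ) ≠ 0 := by
    rintro h
    rw [Nat.cast_eq_zero] at h
    simp [h] at h1
  have key : ∀ k : ℕ, ∃ ψ : ℝ ≃o ℝ, (∀ s, ψ (s + 1) = ψ s + 1) ∧
      (∀ s, P.curve (ψ s)
        = Complex.exp ((2 * Real.pi / (q * k₁ : ℕ) : ℝ) * Complex.I) ^ k * P.curve s) ∧
      ∀ s t, P.classical (ψ s) (ψ t) ↔ P.classical s t := by
    intro k
    induction k with
    | zero => exact ⟨OrderIso.refl ℝ, by simp⟩
    | succ k ih =>
      obtain ⟨ψ, h1, h2, h3⟩ := ih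
      refine ⟨ψ.trans φ, fun s => ?_, fun s => ?_, fun s t => ?_⟩
      · simp only [OrderIso.trans_apply, h1, hφ]
      · simp only [OrderIso.trans_apply, hcurve, h2]
        ring
      · simp only [OrderIso.trans_apply, hcl, h3]
  obtain ⟨ψ, h1, h2, h3⟩ := key k₁
  refine ⟨hq, P, hP, h0, ψ, h1, fun s => ?_, h3⟩
  rw [h2, ← Complex.exp_nat_mul]
  congr 2
  push_cast
  field_simp

theorem ne_zero_of_laurentSpan_pos {k : Type*} [Semiring k] {f : k[T;T⁻¹]}
    (h : 0 < laurentSpan f) : f ≠ 0 := by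
  rintro rfl
  simp [laurentSpan] at h

/-- After clearing denominators, a unit divides a power of X, so it is a monomial and has span 0. -/
theorem not_isUnit_of_laurentSpan_pos {k : Type*} [Field k] {f : k[T;T⁻¹]}
    (h : 0 < laurentSpan f) : ¬ IsUnit f := by
  rw [isUnit_iff_exists_inv]
  rintro ⟨g, hfg⟩
  obtain ⟨n, f', hf'⟩ := LaurentPolynomial.exists_T_pow f
  obtain ⟨m, g', hg'⟩ := LaurentPolynomial.exists_T_pow g
  have h1 : f' * g' = Polynomial.X ^ (n + m) := by
    refine Polynomial.toLaurent_injective ?_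
    rw [map_mul, hf', hg', Polynomial.toLaurent_X_pow, mul_mul_mul_comm, hfg, one_mul,
      ← LaurentPolynomial.T_add]
    push_cast
    rfl
  obtain ⟨i, -, u, hu⟩ := (dvd_prime_pow Polynomial.prime_X _).mp (Dvd.intro _ h1)
  obtain ⟨a, ha, hau⟩ := Polynomial.isUnit_iff.mp u⁻¹.isUnit
  have h2 : f = LaurentPolynomial.C a * LaurentPolynomial.T (i - n) := by
    have h3 : f' = Polynomial.C a * Polynomial.X ^ i := by
      rw [hau, ← hu, mul_comm, mul_assoc, Units.mul_inv, mul_one]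
    rw [h3, Polynomial.toLaurent_C_mul_X_pow] at hf'
    rw [sub_eq_add_neg, LaurentPolynomial.T_add, ← mul_assoc, hf', mul_assoc,
      ← LaurentPolynomial.T_add, add_neg_cancel, LaurentPolynomial.T_zero, mul_one]
  have h3 := LaurentPolynomial.support_coeff_C_mul_T_of_ne_zero ha.ne_zero ((i : ℤ) - n)
  rw [← h2] at h3
  simp [laurentSpan, h3] at h

/-! ### Reduction modulo p and the bound on prime power periods. -/

section Reduction

variable (p : ℕ)

/-- The reduction of integral Laurent polynomials modulo `p`. -/
noncomputable abbrev reduction : ℤ[T;T⁻¹] →+* (ZMod p)[T;T⁻¹] :=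
  AddMonoidAlgebra.mapRingHom ℤ (Int.castRingHom (ZMod p))

theorem reduction_T (n : ℤ) : reduction p (LaurentPolynomial.T n) = LaurentPolynomial.T n :=
  (AddMonoidAlgebra.mapRingHom_single _ _ _).trans (by rw [map_one]; rfl)

theorem reduction_toLaurent (f : ℤ[X]) :
    reduction p (Polynomial.toLaurent f)
      = Polynomial.toLaurent (f.map (Int.castRingHom (ZMod p))) := by
  have h : (reduction p).comp (Polynomial.toLaurent : ℤ[X] →+* ℤ[T;T⁻¹])
      = (Polynomial.toLaurent : (ZMod p)[X] →+* (ZMod p)[T;T⁻¹]).comp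
        (Polynomial.mapRingHom (Int.castRingHom (ZMod p))) := by
    refine Polynomial.ringHom_ext (fun a => ?_) ?_
    · simp
    · simp only [RingHom.comp_apply, Polynomial.toLaurent_X, Polynomial.coe_mapRingHom,
        Polynomial.map_X, reduction_T]
  exact congrArg (fun g => g f) h

theorem dvd_of_reduction_eq_zero {f : ℤ[T;T⁻¹]} (h : reduction p f = 0) :
    (LaurentPolynomial.C (p : ℤ)) ∣ f := by
  obtain ⟨n, f', hf'⟩ := LaurentPolynomial.exists_T_pow f
  have h1 : f'.map (Int.castRingHom (ZMod p)) = 0 := by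
    rw [← Polynomial.toLaurent_eq_zero, ← reduction_toLaurent, hf', map_mul, h, zero_mul]
  have h2 : Polynomial.C (p : ℤ) ∣ f' := Polynomial.C_dvd_iff_dvd_coeff _ _ |>.mpr fun i => by
    have := congrArg (fun g => Polynomial.coeff g i) h1
    simp only [Polynomial.coeff_map, Polynomial.coeff_zero] at this
    exact (ZMod.intCast_zmod_eq_zero_iff_dvd _ _).mp this
  obtain ⟨g, rfl⟩ := h2
  rw [map_mul, Polynomial.toLaurent_C] at hf'
  refine (LaurentPolynomial.isUnit_T (n : ℤ)).dvd_mul_right.mp (hf' ▸ Dvd.intro _ rfl)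

/-- The variable of Laurent polynomials, as a unit. -/
noncomputable def laurentUnit (R : Type*) [CommRing R] : R[T;T⁻¹]ˣ where
  val := LaurentPolynomial.T 1
  inv := LaurentPolynomial.T (-1)
  val_inv := by rw [← LaurentPolynomial.T_add]; simp
  inv_val := by rw [← LaurentPolynomial.T_add]; simp

theorem laurentUnit_zpow {R : Type*} [CommRing R] (n : ℤ) :
    ((laurentUnit R ^ n : R[T;T⁻¹]ˣ) : R[T;T⁻¹]) = LaurentPolynomial.T n := by
  cases n with
  | ofNat n =>
    rw [Int.ofNat_eq_natCast, zpow_natCast, Units.val_pow_eq_pow_val]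
    exact (LaurentPolynomial.T_pow 1 n).trans (by simp)
  | negSucc n =>
    rw [zpow_negSucc, ← inv_pow, Units.val_pow_eq_pow_val]
    refine (LaurentPolynomial.T_pow (-1) (n + 1)).trans ?_
    congr 1
    simp [Int.negSucc_eq]

end Reduction

theorem letterCoeff_map {R S : Type*} [CommRing R] [CommRing S] (g : R →+* S) (t : Rˣ)
    (l : GaussLetter) : g (letterCoeff t l) = letterCoeff (Units.map (g : R →* S) t) l := by
  unfold letterCoeff
  split_ifs
  · exact map_one g
  · rw [← map_zpow]
    rfl

theorem arcColorings_map_eq_cyclicSolutions {R S B : Type*} [CommRing R] [CommRing S]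
    [AddCommGroup B] [Module S B] (g : R →+* S) (t : Rˣ) {w : List GaussLetter} {L q : ℕ}
    (hpos : 0 < w.length) (hL : q * L = w.length)
    (h : ∀ m, (letterAt w (m + L)).isOver = (letterAt w m).isOver ∧
      (letterAt w (m + L)).sign = (letterAt w m).sign ∧
      overIndex w (letterAt w (m + L)).label
        ≡ overIndex w (letterAt w m).label + L [MOD w.length]) :
    arcColorings (Units.map (g : R →* S) t) B w
      = cyclicSolutions B L q (fun m => g (letterCoeff t (letterAt w m)))
        fun m => overIndex w (letterAt w m).label := by
  simp only [letterCoeff_map]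
  exact arcColorings_eq_cyclicSolutions _ hpos hL h

/-- The bound is n times the largest degree of a minor of `w₀` after clearing denominators, plus
one. It works for all p at once since degrees do not grow under reduction. -/
theorem exists_primePow_period_le (w₀ : GaussCode) {Δ : ℤ[T;T⁻¹]}
    (hΔ : w₀.firstElementaryIdeal ≤ Ideal.span {Δ})
    (hmin : ∀ g : ℤ[T;T⁻¹], w₀.firstElementaryIdeal ≤ Ideal.span {g} →
      Ideal.span {Δ} ≤ Ideal.span {g})
    (hspan : ∀ p : ℕ, p.Prime → 0 < laurentSpan (reduction p Δ)) :
    ∃ N, ∀ p r : ℕ, p.Prime → r ≠ 0 → w₀.toVirtualKnot.HasPeriod (p ^ r) → p ^ r ≤ N := by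
  choose a D hD using fun rc : (Fin (w₀.unders.length - 1) → Fin w₀.unders.length) ×
    (Fin (w₀.unders.length - 1) → Fin w₀.unders.length) =>
      LaurentPolynomial.exists_T_pow (w₀.jacobian.submatrix rc.1 rc.2).det
  refine ⟨w₀.unders.length * (Finset.univ.sup fun rc => (D rc).natDegree) + 1,
    fun p r hp hr hper => ?_⟩
  by_contra! hlarge
  have : Fact p.Prime := ⟨hp⟩
  obtain ⟨-, P, ⟨w, hcode, hw⟩, h0, hinv⟩ := hper
  have : CharP (ZMod p)[T;T⁻¹] p := charP_of_injective_ringHom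
    (LaurentPolynomial.C : ZMod p →+* (ZMod p)[T;T⁻¹]).injective p
  have hminor : ∀ r c : Fin (w₀.unders.length - 1) → Fin w₀.unders.length,
      Δ ∣ (w₀.jacobian.submatrix r c).det := fun r c =>
    Ideal.mem_span_singleton.mp (hΔ (Ideal.subset_span ⟨r, c, rfl⟩))
  have hnu := not_isUnit_of_laurentSpan_pos (hspan p hp)
  -- Without crossings the only minor is the empty determinant 1, which would make Δ a unit.
  have hn : 0 < w₀.unders.length := by
    by_contra! hn
    have : IsEmpty (Fin (w₀.unders.length - 1)) := ⟨fun i => by have := i.2; omega⟩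
    have h1 := hminor isEmptyElim isEmptyElim
    rw [Matrix.det_isEmpty] at h1
    exact hnu ((isUnit_of_dvd_one h1).map (reduction p))
  have hpos₀ := w₀.length_pos hn
  -- Otherwise p divides every minor, and minimality of the principal ideal of Δ forces p to divide
  -- Δ.
  obtain ⟨r₀, c₀, hd⟩ : ∃ r c, reduction p (w₀.jacobian.submatrix r c).det ≠ 0 := by
    by_contra! h
    have h1 : w₀.firstElementaryIdeal ≤ Ideal.span {LaurentPolynomial.C (p : ℤ)} := by
      refine Ideal.span_le.mpr ?_
      rintro _ ⟨r, c, rfl⟩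
      exact Ideal.mem_span_singleton.mpr (dvd_of_reduction_eq_zero p (h r c))
    obtain ⟨g, hg⟩ := Ideal.mem_span_singleton.mp (hmin _ h1 (Ideal.mem_span_singleton_self Δ))
    refine ne_zero_of_laurentSpan_pos (hspan p hp) ?_
    rw [hg, map_mul]
    simp
  obtain ⟨𝔪, h𝔪, hΔ𝔪⟩ := exists_max_ideal_of_mem_nonunits hnu
  let _ : Field ((ZMod p)[T;T⁻¹] ⧸ 𝔪) := Ideal.Quotient.field 𝔪
  let g : (ZMod p)[T;T⁻¹] →+* (ZMod p)[T;T⁻¹] ⧸ 𝔪 := Ideal.Quotient.mk 𝔪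
  let F := FractionRing (ZMod p)[T;T⁻¹]
  let ι : (ZMod p)[T;T⁻¹] →+* F := algebraMap _ _
  let t := laurentUnit (ZMod p)
  have ht : ∀ n : ℤ, reduction p (LaurentPolynomial.T n) = (t ^ n : (ZMod p)[T;T⁻¹]ˣ) := fun n => by
    rw [reduction_T, laurentUnit_zpow]
  have ht' : ∀ {κ : Type} [Field κ] (g : (ZMod p)[T;T⁻¹] →+* κ) (n : ℤ),
      (g.comp (reduction p)) (LaurentPolynomial.T n)
        = ((Units.map (g : (ZMod p)[T;T⁻¹] →* κ) t) ^ n : κˣ) := fun g n => by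
    rw [RingHom.comp_apply, ht, ← map_zpow]
    rfl
  -- At a maximal ideal containing Δ all minors vanish, so nonconstant colorings appear; generically
  -- (`hF`) there are none. The rest shows that a large period excludes this jump.
  have hκ := w₀.one_lt_rank_arcColorings hn (g.comp (reduction p)) _ (ht' g) fun r c => by
    obtain ⟨b, hb⟩ := hminor r c
    rw [hb, RingHom.comp_apply, map_mul, map_mul, Ideal.Quotient.eq_zero_iff_mem.mpr hΔ𝔪, zero_mul]
  have hF := w₀.rank_arcColorings_le_one hn (ι.comp (reduction p)) _ (ht' ι) r₀ c₀ fun h =>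
    hd (IsFractionRing.injective (ZMod p)[T;T⁻¹] F (h.trans (map_zero ι).symm))
  refine hκ.not_ge ?_
  rcases w.1.length.eq_zero_or_pos with hnil | hpos
  · exact rank_arcColorings_le_one_of_nil hw.symm hpos₀ (List.length_eq_zero_iff.mp hnil)
  rw [rank_arcColorings_eq hw.symm hpos₀ hpos] at hF ⊢
  obtain ⟨L, hL, hshift⟩ := P.exists_letterAt_shift hp hr h0 hinv hpos hcode
  rw [arcColorings_map_eq_cyclicSolutions _ _ hpos hL hshift] at hF ⊢
  obtain ⟨e⟩ := nonempty_coloringEquiv_of_toVirtualKnot_eq t hw.symm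
  have hdet : ((w₀.jacobian.map (reduction p)).submatrix r₀ c₀).det
      = reduction p (w₀.jacobian.submatrix r₀ c₀).det := by
    rw [RingHom.map_det]
    rfl
  obtain ⟨k₀, hk₀⟩ := exists_smul_sub_eq_zero_of_minor (w₀.jacobian.map (reduction p))
    (fun i => by
      have := w₀.sum_jacobian_smul (reduction p) (fun _ => (1 : (ZMod p)[T;T⁻¹])) i
      simpa using this) hn r₀ c₀ (by rwa [hdet])
  rw [hdet] at hk₀
  have hDmap : Polynomial.toLaurent ((D (r₀, c₀)).map (Int.castRingHom (ZMod p)))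
      = reduction p (w₀.jacobian.submatrix r₀ c₀).det
        * LaurentPolynomial.T (a (r₀, c₀) : ℤ) := by
    rw [← reduction_toLaurent, hD, map_mul, reduction_T]
  have hunit := LaurentPolynomial.isUnit_T (R := ZMod p) (a (r₀, c₀) : ℤ)
  obtain ⟨hfin, hfinrank⟩ := finrank_quotient_span_toLaurent
    (g := (D (r₀, c₀)).map (Int.castRingHom (ZMod p))) (by
      rw [← Polynomial.toLaurent_ne_zero, hDmap]
      exact mul_ne_zero hd hunit.ne_zero)
  rw [hDmap, Ideal.span_singleton_mul_right_unit hunit] at hfin hfinrank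
  have hle : Module.finrank (ZMod p)
      ((ZMod p)[T;T⁻¹] ⧸ Ideal.span {reduction p (w₀.jacobian.submatrix r₀ c₀).det})
      ≤ Finset.univ.sup fun rc => (D rc).natDegree :=
    (hfinrank.trans (Polynomial.natDegree_map_le)).trans
      (Finset.le_sup (f := fun rc => (D rc).natDegree) (Finset.mem_univ (r₀, c₀)))
  refine rank_cyclicSolutions_residueField_le_one L _ _ hr
    (Nat.pos_of_ne_zero fun h => by rw [h, mul_zero] at hL; omega) (fun B _ _ x hx => ?_) ι g hF
  refine shift_sub_one_pow_eq_zero (k := ZMod p) e hn hpos (reduction p) ht hd k₀ hk₀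
    (fun B _ _ => arcColorings_eq_cyclicSolutions t hpos hL hshift) ?_ B x hx
  have := Nat.mul_le_mul_left w₀.unders.length hle
  omega

theorem mainTheorem5 (K : VirtualKnot) (hK : K.AlmostClassical)
    (Δ : ℤ[T;T⁻¹]) (hΔ : K.IsAlexanderPolynomial Δ)
    (hspan : ∀ p : ℕ, p.Prime →
      0 < laurentSpan (AddMonoidAlgebra.mapRingHom ℤ (Int.castRingHom (ZMod p)) Δ)) :
    {q : ℕ | K.HasPeriod q}.Finite := by
  obtain ⟨w₀, rfl, h1, h2⟩ := hΔ
  obtain ⟨N, hN⟩ := exists_primePow_period_le w₀ h1 h2 hspan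
  refine (Finset.range (Nat.factorial N + 1)).finite_toSet.subset fun q hq => ?_
  -- Divisibility is tested on prime powers: each nontrivial prime power divisor of q is itself a
  -- period, hence at most N, hence a divisor of N!.
  have hdvd : q ∣ Nat.factorial N := by
    refine (Nat.dvd_iff_prime_pow_dvd_dvd _ _).mpr fun p r hp hr => ?_
    rcases eq_or_ne r 0 with rfl | hr0
    · simp
    · exact Nat.dvd_factorial (pow_pos hp.pos r)
        (hN p r hp hr0 (hq.of_dvd (Nat.one_lt_pow hr0 hp.one_lt) hr))
  simpa using Nat.lt_succ_of_le (Nat.le_of_dvd (Nat.factorial_pos N) hdvd)
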